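/- Consider the class of equations $$u_t+a\,uu_{xxx}+b\,u_xu_{xx}+c\,u^2u_x+f\,uu_x+g\,u_{xxxxx}+h\,u_{xxx}+m\,u+n\,u_x+k\,xu_x=0,\qquad(1)$$ where $a,b,c,f,g,h,m,n,k$ are arbitrary smooth functions of $t$ on an open interval $I$ (the interval may differ from equation to equation) with $g\,(a^2+b^2+c^2)\ne0$ at every $t\in I$. Integrals with respect to $t$ denote fixed antiderivatives on $I$. A point transformation is a smooth diffeomorphism $(t,x,u)\mapsto(\tilde t,\tilde x,\tilde u)$ between nonempty connected open subsets of the space of $(t,x,u)$. It maps one equation to another if its prolongation identifies them as submanifolds of the fifth-order jet space. An admissible transformation of a class is a triple formed by two equations of the class and a point transformation, with domain over the interval of the first equation and range over that of the second, mapping the first to the second. (i) For every equation (1), and every choice of antiderivatives, the point transformation $$\tilde t=\int g\,e^{-5\int k\,dt}\,dt,\qquad \tilde x=e^{-\int k\,dt}x-\int n\,e^{-\int k\,dt}\,dt,\qquad \tilde u=e^{\int m\,dt}u,$$ defined for all $t\in I$ and $x,u\in\mathbb R$, maps it to an equation of the form (1) (over the image interval) with $g=1$ and $m=n=k=0$.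 (ii) Let $\mathcal C_1$ be the subclass of (1) with $g=1$ and $m=n=k=0$. An equivalence transformation of $\mathcal C_1$ in the generalized extended sense is a bijection of $\mathcal C_1$ onto itself together with, for every equation of $\mathcal C_1$ over an interval $I$, a point transformation of $I\times\mathbb R^2$ onto $\tilde I\times\mathbb R^2$ that maps this equation to its image, $\tilde I$ being the interval of the image; the point transformation may depend on the equation, and all dependences on the equation may be nonlocal. Let $G^\sim_1$ be the set of the transformations $$\tilde t=\alpha(t),\quad \tilde x=\beta x+\gamma(t),\quad \tilde u=\varphi\,(u+\sigma),$$ $$\tilde a=\frac{\beta^3}{\alpha_t\varphi}a,\quad \tilde b=\frac{\beta^3}{\alpha_t\varphi}b,\quad \tilde c=\frac{\beta}{\alpha_t\varphi^2}c,\quad \tilde f=\frac{\beta}{\alpha_t\varphi}(f-2\sigma c),\quad \tilde h=\frac{\beta^3}{\alpha_t}(h-\sigma a),\quad \tilde g=1,\quad \tilde m=\tilde n=\tilde k=0,$$ where $\beta,\varphi,\sigma$ are constants with $\beta\varphi\ne0$, $\alpha$ is a function of $t$ with $\alpha_t=\beta^5$ (the same $\alpha,\beta,\varphi,\sigma$ for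 all equations of $\mathcal C_1$), and, for each equation, $\gamma$ is a function of $t$ with $\gamma_t=\sigma\beta f-\sigma^2\beta c$. Then all elements of $G^\sim_1$ are equivalence transformations of $\mathcal C_1$ in the generalized extended sense; they form a group; on each equation of $\mathcal C_1$, every equivalence transformation of $\mathcal C_1$ in this sense coincides with an element of $G^\sim_1$; and $\mathcal C_1$ is normalized with respect to $G^\sim_1$. That is, for every admissible transformation of $\mathcal C_1$ there is an element of $G^\sim_1$ whose transformation of variables for the first equation restricts to the given point transformation on its domain, and whose image of the first equation has the same coefficients as the second equation at all values of $\tilde t$ in the range of the given transformation. -/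

import Mathlib

open scoped ContDiff Topology

/-- An equation
`u_t + a u u_xxx + b u_x u_xx + c u² u_x + f u u_x + g u_xxxxx + h u_xxx + m u + n u_x + k x u_x = 0`
whose coefficients are smooth functions of `t` on a nonempty open interval `I`, with
`g (a² + b² + c²) ≠ 0` on `I`. The coefficients are functions on `I`; as total functions they are
given the value `0` off `I`, so that `=` is equality of the interval and of the coefficients on it. -/
@[ext]
structure KdVEq where
  I : Set ℝ
  a : ℝ → ℝ
  b : ℝ → ℝ
  c : ℝ → ℝ
  f : ℝ → ℝ
  g : ℝ → ℝ
  h : ℝ → ℝ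
  m : ℝ → ℝ
  n : ℝ → ℝ
  k : ℝ → ℝ
  isOpen_I : IsOpen I
  ordConnected_I : I.OrdConnected
  nonempty_I : I.Nonempty
  smooth_a : ContDiffOn ℝ ∞ a I
  smooth_b : ContDiffOn ℝ ∞ b I
  smooth_c : ContDiffOn ℝ ∞ c I
  smooth_f : ContDiffOn ℝ ∞ f I
  smooth_g : ContDiffOn ℝ ∞ g I
  smooth_h : ContDiffOn ℝ ∞ h I
  smooth_m : ContDiffOn ℝ ∞ m I
  smooth_n : ContDiffOn ℝ ∞ n I
  smooth_k : ContDiffOn ℝ ∞ k I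
  nondegenerate : ∀ t ∈ I, g t * ((a t) ^ 2 + (b t) ^ 2 + (c t) ^ 2) ≠ 0
  off_I : ∀ t, t ∉ I → a t = 0 ∧ b t = 0 ∧ c t = 0 ∧ f t = 0 ∧ g t = 0 ∧ h t = 0 ∧
    m t = 0 ∧ n t = 0 ∧ k t = 0

/-- `∂u/∂t` at `p = (t, x)`. -/
noncomputable def dt (u : ℝ × ℝ → ℝ) (p : ℝ × ℝ) : ℝ := deriv (fun s => u (s, p.2)) p.1

/-- `∂ʲu/∂xʲ` at `p = (t, x)`. -/
noncomputable def dx (j : ℕ) (u : ℝ × ℝ → ℝ) (p : ℝ × ℝ) : ℝ :=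
  iteratedDeriv j (fun y => u (p.1, y)) p.2

/-- The jet of `u` at `p = (t, x)` satisfies the equation. -/
def KdVEq.HoldsAt (E : KdVEq) (u : ℝ × ℝ → ℝ) (p : ℝ × ℝ) : Prop :=
  dt u p + E.a p.1 * u p * dx 3 u p + E.b p.1 * dx 1 u p * dx 2 u p
    + E.c p.1 * (u p) ^ 2 * dx 1 u p + E.f p.1 * u p * dx 1 u p + E.g p.1 * dx 5 u p
    + E.h p.1 * dx 3 u p + E.m p.1 * u p + E.n p.1 * dx 1 u p + E.k p.1 * p.2 * dx 1 u p = 0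

/-- The coefficients of the two equations coincide on `J`. -/
def KdVEq.AgreeOn (E E' : KdVEq) (J : Set ℝ) : Prop :=
  ∀ t ∈ J, E.a t = E'.a t ∧ E.b t = E'.b t ∧ E.c t = E'.c t ∧ E.f t = E'.f t ∧ E.g t = E'.g t ∧
    E.h t = E'.h t ∧ E.m t = E'.m t ∧ E.n t = E'.n t ∧ E.k t = E'.k t

/-- The subclass `g = 1`, `m = n = k = 0`. -/
def gaugedClass : Set KdVEq :=
  {E | ∀ t ∈ E.I, E.g t = 1 ∧ E.m t = 0 ∧ E.n t = 0 ∧ E.k t = 0}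

/-- A local homeomorphism of the space of `(t, x, u)`. -/
abbrev VarMap := OpenPartialHomeomorph (ℝ × ℝ × ℝ) (ℝ × ℝ × ℝ)

/-- A (local) point transformation: a smooth diffeomorphism between connected nonempty open subsets
of the space of `(t, x, u)`. All three components may depend on all three variables. -/
structure IsPointTransformation (Φ : VarMap) : Prop where
  connected : IsConnected Φ.source
  smooth : ContDiffOn ℝ ∞ Φ Φ.source
  smooth_symm : ContDiffOn ℝ ∞ Φ.symm Φ.target

/-- The prolongation of `Φ` to fifth-order jets identifies `E` with `E'` as submanifolds of the jet
space: whenever `Φ` maps the graph of `u` near `p` into the graph of `v`, `p` going to `q`, the jet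
of `u` at `p` lies on `E` if and only if the jet of `v` at `q` lies on `E'`.
As `Φ` is a diffeomorphism and `v` is smooth, such a `v` exists for the jet of `u` at `p` exactly
when the prolongation of `Φ` is defined there. -/
def MapsEquation (E E' : KdVEq) (Φ : VarMap) : Prop :=
  ∀ (u v : ℝ × ℝ → ℝ) (p q : ℝ × ℝ),
    (p.1, p.2, u p) ∈ Φ.source → ContDiffAt ℝ ∞ u p → ContDiffAt ℝ ∞ v q →
    Φ (p.1, p.2, u p) = (q.1, q.2, v q) →
    (∀ᶠ r in 𝓝 p, v ((Φ (r.1, r.2, u r)).1, (Φ (r.1, r.2, u r)).2.1) = (Φ (r.1, r.2, u r)).2.2) →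
    (E.HoldsAt u p ↔ E'.HoldsAt v q)

/-- `(E, E', Φ)` is an admissible transformation: `Φ` is a point transformation from `E` to `E'`. -/
structure IsAdmissible (E E' : KdVEq) (Φ : VarMap) : Prop where
  isPointTransformation : IsPointTransformation Φ
  source_subset : ∀ z ∈ Φ.source, z.1 ∈ E.I
  target_subset : ∀ z ∈ Φ.target, z.1 ∈ E'.I
  maps : MapsEquation E E' Φ

/-- A (generalized extended) equivalence transformation of the class `C`: an invertible
transformation `E ↦ Ẽ` of the arbitrary elements that preserves the class, together with a point
transformation of the variables from `E` to `Ẽ`. The transformation of the variables may depend on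
the arbitrary elements, and both dependences on `E` may be nonlocal. -/
structure EquivTransformation (C : Set KdVEq) where
  onEq : C ≃ C
  onVar : C → VarMap
  source_eq : ∀ E, (onVar E).source = {z | z.1 ∈ E.1.I}
  target_eq : ∀ E, (onVar E).target = {z | z.1 ∈ (onEq E).1.I}
  admissible : ∀ E, IsAdmissible E.1 (onEq E).1 (onVar E)

/-- `R` is the composition of `S` after `T`. -/
def EquivTransformation.IsComp {C : Set KdVEq} (S T R : EquivTransformation C) : Prop :=
  ∀ E, R.onEq E = S.onEq (T.onEq E) ∧
    Set.EqOn (R.onVar E) (S.onVar (T.onEq E) ∘ T.onVar E) (T.onVar E).source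

/-- The admissible transformation `(E, E', Φ)` is induced by `T`: on its domain, `Φ` is the
transformation of variables that `T` prescribes for `E`, and `E'` is the image of `E` under `T`
over the range of the new variable `t`. -/
def EquivTransformation.Induces {C : Set KdVEq} (T : EquivTransformation C)
    (E : C) (E' : KdVEq) (Φ : VarMap) : Prop :=
  Set.EqOn Φ (T.onVar E) Φ.source ∧ E'.AgreeOn (T.onEq E).1 (Prod.fst '' Φ.target)

/-- The class `C` is normalized with respect to `G`: every admissible transformation between
equations of `C` is induced by an element of `G`. -/
def IsNormalizedWrt (C : Set KdVEq) (G : Set (EquivTransformation C)) : Prop :=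
  ∀ (E : C) (E' : C) (Φ : VarMap), IsAdmissible E.1 E'.1 Φ → ∃ T ∈ G, T.Induces E E'.1 Φ

/-- `t̃ = α(t)`, `x̃ = β(t) x + γ(t)`, `ũ = φ(t) (u + σ exp(-M(t)))`, where `M` stands for `∫ m dt`. -/
noncomputable def varFormula (α β γ φ : ℝ → ℝ) (σ : ℝ) (M : ℝ → ℝ) (z : ℝ × ℝ × ℝ) : ℝ × ℝ × ℝ :=
  (α z.1, β z.1 * z.2.1 + γ z.1, φ z.1 * (z.2.2 + σ * Real.exp (-M z.1)))

/-- The formulas for the new arbitrary elements (those of `E'`, at `α(t)`) through the old ones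
(those of `E`, at `t`), where `M` stands for `∫ m dt`. -/
def CoeffFormula (α β γ φ : ℝ → ℝ) (σ : ℝ) (M : ℝ → ℝ) (E E' : KdVEq) (t : ℝ) : Prop :=
  E'.a (α t) = (β t) ^ 3 / (deriv α t * φ t) * E.a t ∧
  E'.b (α t) = (β t) ^ 3 / (deriv α t * φ t) * E.b t ∧
  E'.c (α t) = β t / (deriv α t * (φ t) ^ 2) * E.c t ∧
  E'.f (α t) = β t / (deriv α t * φ t) * (E.f t - 2 * σ * E.c t * Real.exp (-M t)) ∧
  E'.g (α t) = (β t) ^ 5 / deriv α t * E.g t ∧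
  E'.h (α t) = (β t) ^ 3 / deriv α t * (E.h t - σ * E.a t * Real.exp (-M t)) ∧
  E'.m (α t) = 1 / deriv α t * (E.m t - deriv φ t / φ t) ∧
  E'.n (α t) = β t / deriv α t * (E.n t + deriv (fun s => γ s / β s) t - E.k t * (γ t / β t)
    + σ ^ 2 * E.c t * Real.exp (-2 * M t) - σ * E.f t * Real.exp (-M t)) ∧
  E'.k (α t) = 1 / deriv α t * (E.k t + deriv β t / β t)

/-- Parameters of the group of the subclass `g = 1`, `m = n = k = 0`: smooth functions `α`, `β`, `φ`
of `t` and `γ` (an antiderivative, which depends on the equation) and a constant `σ` such that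
`α_t β φ ≠ 0`, `β_t = φ_t = 0`, `α_t = β⁵` and `γ_t = σ β f - σ² β c`. -/
structure GaugedParams where
  α : ℝ → ℝ
  β : ℝ → ℝ
  φ : ℝ → ℝ
  σ : ℝ
  γ : gaugedClass → ℝ → ℝ
  smooth_α : ContDiff ℝ ∞ α
  smooth_β : ContDiff ℝ ∞ β
  smooth_φ : ContDiff ℝ ∞ φ
  smooth_γ : ∀ E, ContDiffOn ℝ ∞ (γ E) E.1.I
  nondegenerate : ∀ t, deriv α t * β t * φ t ≠ 0
  deriv_β : ∀ t, deriv β t = 0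
  deriv_φ : ∀ t, deriv φ t = 0
  deriv_α : ∀ t, deriv α t = (β t) ^ 5
  deriv_γ : ∀ E, ∀ t ∈ E.1.I,
    deriv (γ E) t = σ * β t * E.1.f t - σ ^ 2 * β t * E.1.c t

/-- `T` is given by the formulas with the parameters `P`; as `m = 0` in the subclass, `∫ m dt = 0`. -/
def EquivTransformation.IsGivenBy (T : EquivTransformation gaugedClass) (P : GaugedParams) : Prop :=
  ∀ E : gaugedClass,
    Set.EqOn (T.onVar E) (varFormula P.α P.β (P.γ E) P.φ P.σ (fun _ => 0)) {z | z.1 ∈ E.1.I} ∧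
    ∀ t ∈ E.1.I, CoeffFormula P.α P.β (P.γ E) P.φ P.σ (fun _ => 0) E.1 (T.onEq E).1 t

/-- The transformations given by the formulas with some parameters as above. -/
def gaugedGroup : Set (EquivTransformation gaugedClass) := {T | ∃ P : GaugedParams, T.IsGivenBy P}

/-! Sufficiency is the chain rule. For a change of variables of the displayed form, the left-hand
side of the new equation times `α_t` equals `φ` times the left-hand side of the old one
(`holdsAt_iff_of_coeffFormula`). Reading the coefficient formulas as the definition of the image
equation then gives the gauging in (i), where `β` and `φ` are exponentials of antiderivatives of
`-k` and `m`, as well as the elements of the group in (ii). On the subclass, the action on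
coefficients depends only on `β`, `φ`, `σ` and a time shift, never on `γ`. Bijectivity and the group
laws thus become algebra of four constants, plus a choice of antiderivative for each equation.

Necessity concerns a point transformation with components `T`, `X`, `U`, each depending on `(t, x,
u)` a priori. Instead of general prolongation formulas, graphs are perturbed: `u` and `u + w` pass
through one point, and both jets satisfy the first equation. Their images are graphs of `v` and `v +
δ`, with `δ = κ w∘B + o(w∘B)` and `κ ≠ 0`, where `B` inverts the map of independent variables along
the graph of `u + w` (`IsAdmissible.exists_perturbation`). If `δ` has order five along the new
`x`-direction, subtracting the two image equations leaves `δ_t + δ_xxxxx = 0` at the point.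

The perturbation `w = (t - t₀)⁵` is invisible to the equation and forces `T_x = T_u = 0`
(`IsAdmissible.fderiv_time`). The perturbation `w = (t - t₀) - (x - x₀)⁵/120` gives `T_t = (X_x + b
X_u)⁵` for every slope `b` at which the base is nonzero, hence `X_u = 0` and `X_x⁵ = T_t`
(`IsAdmissible.fderiv_space`). Finally `w = (x - x₀)⁴/24` is invisible because `u_xxxx` does not
occur; it changes the fifth `x`-derivative of the image by a multiple of `(∂_x + b ∂_u) U_u`, which
must therefore vanish (`IsAdmissible.fderiv_fderiv_dependent`). So locally `T = α(t)`, `X = β(t) x +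
γ(t)`, `U = φ(t) u + ψ(t, x)`.

What remains is an identity polynomial in the jet variables (`IsAdmissible.jet_identity`), which is
split into coefficients. Nondegeneracy `a² + b² + c² ≠ 0` enters here and yields `ψ_x = 0`; the
other coefficients then give `β_t = φ_t = ψ_t = 0`, the equation for `γ_t` and the transformed
coefficients (`IsAdmissible.differential`). Connectedness of the domain turns these pointwise facts
into global constants, and an antiderivative on the whole interval extends the transformation to an
element of the group. -/

/-! ### Derivatives at a point read off from asymptotic expansions -/

theorem eq_zero_of_const_mul_pow_isLittleO {c x₀ : ℝ} {n : ℕ}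
    (h : (fun x => c * (x - x₀) ^ n) =o[𝓝 x₀] fun x => (x - x₀) ^ n) : c = 0 := by
  by_contra hc
  have h2 := (Asymptotics.isLittleO_const_mul_left_iff hc).1 h
  -- For positive `n` the power vanishes at `x₀`, so the contradiction has to be found on the
  -- punctured neighbourhood.
  have h3 : (fun x : ℝ => (x - x₀) ^ n) =o[𝓝[≠] x₀] fun x => (x - x₀) ^ n :=
    h2.mono nhdsWithin_le_nhds
  have h4 := Asymptotics.isLittleO_irrefl' (l := 𝓝[≠] x₀) (f' := fun x : ℝ => (x - x₀) ^ n) ?_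
  · exact h4 h3
  · refine Filter.Eventually.frequently ?_
    filter_upwards [self_mem_nhdsWithin] with x hx
    simpa [sub_eq_zero] using fun (h : x = x₀) => absurd h hx

/-- Strong induction on the order: once the lower derivatives vanish, the Taylor polynomial of order
`k` is its leading term, and that term is `o((x - x₀)^k)` because both `h` and the Taylor remainder
are. -/
theorem iteratedDeriv_eq_zero_of_isLittleO {h : ℝ → ℝ} {x₀ : ℝ} {n : ℕ}
    (hs : ContDiffAt ℝ n h x₀) (ho : h =o[𝓝 x₀] fun x => (x - x₀) ^ n) :
    ∀ i ≤ n, iteratedDeriv i h x₀ = 0 := by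
  intro i
  induction i using Nat.strong_induction_on with
  | _ k ih =>
  intro hk
  obtain ⟨U, hU, hUs⟩ := hs.contDiffOn' le_rfl (by simp)
  obtain ⟨hx₀, hUs⟩ := hUs
  obtain ⟨ε, hε, hb⟩ := Metric.isOpen_iff.1 hU x₀ hx₀
  have hD : ContDiffOn ℝ n h (Metric.ball x₀ ε) :=
    hUs.mono fun y hy => ⟨Set.mem_insert_of_mem _ trivial, hb hy⟩
  have hT := taylor_isLittleO (convex_ball x₀ ε) (Metric.mem_ball_self hε)
    (hD.of_le (by exact_mod_cast hk : (k : WithTop ℕ∞) ≤ n))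
  rw [Metric.isOpen_ball.nhdsWithin_eq (Metric.mem_ball_self hε)] at hT
  have hok : h =o[𝓝 x₀] fun x => (x - x₀) ^ k := by
    refine ho.trans_isBigO ?_
    have : (fun x : ℝ => (x - x₀) ^ n) = fun x => (x - x₀) ^ k * (x - x₀) ^ (n - k) := by
      funext x; rw [← pow_add]; congr 1; omega
    rw [this]
    have hb : (fun x : ℝ => (x - x₀) ^ (n - k)) =O[𝓝 x₀] fun _ => (1 : ℝ) :=
      (show ContinuousAt (fun x : ℝ => (x - x₀) ^ (n - k)) x₀ by fun_prop).isBigO_one ℝ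
    simpa using (Asymptotics.isBigO_refl (fun x : ℝ => (x - x₀) ^ k) (𝓝 x₀)).mul hb
  have hE : ∀ x, taylorWithinEval h k (Metric.ball x₀ ε) x₀ x
      = ((k.factorial : ℝ)⁻¹ * iteratedDeriv k h x₀) * (x - x₀) ^ k := by
    intro x
    rw [taylor_within_apply, Finset.sum_range_succ, Finset.sum_eq_zero]
    · rw [iteratedDerivWithin_of_isOpen Metric.isOpen_ball (Metric.mem_ball_self hε)]
      simp; ring
    · intro j hj
      have hj' := Finset.mem_range.1 hj
      rw [iteratedDerivWithin_of_isOpen Metric.isOpen_ball (Metric.mem_ball_self hε),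
        ih j hj' (by omega), smul_zero]
  have := hok.sub hT
  simp only [sub_sub_cancel, hE] at this
  have := eq_zero_of_const_mul_pow_isLittleO this
  simpa [Nat.factorial_ne_zero] using this

theorem contDiffAt_of_infty {E F : Type*} [NormedAddCommGroup E] [NormedSpace ℝ E]
    [NormedAddCommGroup F] [NormedSpace ℝ F] {f : E → F} {x : E} (h : ContDiffAt ℝ ∞ f x) (n : ℕ) :
    ContDiffAt ℝ n f x := h.of_le (by exact_mod_cast le_top)

theorem iteratedDeriv_const_mul_sub_pow (c x₀ : ℝ) (n i : ℕ) :
    iteratedDeriv i (fun x : ℝ => c * (x - x₀) ^ n) x₀ =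
      if i = n then c * n.factorial else 0 := by
  rw [iteratedDeriv_const_mul_field]
  have := iteratedDeriv_comp_sub_const i (fun x : ℝ => x ^ n) x₀
  simp only [this]
  rw [sub_self, iteratedDeriv_fun_pow_zero]
  split_ifs <;> simp

/-- This replaces higher chain rules below: an expansion with a single power suffices to know all
derivatives up to its order. -/
theorem iteratedDeriv_of_sub_isLittleO {h : ℝ → ℝ} {x₀ c : ℝ} {n : ℕ}
    (hs : ContDiffAt ℝ n h x₀)
    (ho : (fun x => h x - c * (x - x₀) ^ n) =o[𝓝 x₀] fun x => (x - x₀) ^ n) :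
    ∀ i ≤ n, iteratedDeriv i h x₀ = if i = n then c * n.factorial else 0 := by
  intro i hi
  have hp : ContDiffAt ℝ n (fun x : ℝ => c * (x - x₀) ^ n) x₀ := by fun_prop
  have h1 := iteratedDeriv_eq_zero_of_isLittleO (hs.sub hp) ho i hi
  rw [iteratedDeriv_fun_sub (hs.of_le (by exact_mod_cast hi)) (hp.of_le (by exact_mod_cast hi)),
    iteratedDeriv_const_mul_sub_pow] at h1
  linarith

/-! ### Partial derivatives and affine changes of variables -/

theorem dx_add {u w : ℝ × ℝ → ℝ} {p : ℝ × ℝ} (hu : ContDiffAt ℝ ∞ u p) (hw : ContDiffAt ℝ ∞ w p)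
    (j : ℕ) : dx j (fun r => u r + w r) p = dx j u p + dx j w p := by
  have hi : ContDiffAt ℝ ∞ (fun y : ℝ => (p.1, y)) p.2 := by fun_prop
  exact iteratedDeriv_fun_add (contDiffAt_of_infty (hu.comp p.2 hi) j)
    (contDiffAt_of_infty (hw.comp p.2 hi) j)

theorem dt_add {u w : ℝ × ℝ → ℝ} {p : ℝ × ℝ} (hu : ContDiffAt ℝ ∞ u p) (hw : ContDiffAt ℝ ∞ w p) :
    dt (fun r => u r + w r) p = dt u p + dt w p := by
  have hi : ContDiffAt ℝ ∞ (fun y : ℝ => (y, p.2)) p.1 := by fun_prop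
  exact deriv_fun_add ((hu.comp p.1 hi).differentiableAt (by simp))
    ((hw.comp p.1 hi).differentiableAt (by simp))

theorem hasDerivAt_dt {u : ℝ × ℝ → ℝ} {p : ℝ × ℝ} (hu : ContDiffAt ℝ ∞ u p) :
    HasDerivAt (fun s => u (s, p.2)) (dt u p) p.1 := by
  have hi : ContDiffAt ℝ ∞ (fun y : ℝ => (y, p.2)) p.1 := by fun_prop
  exact ((hu.comp p.1 hi).differentiableAt (by simp)).hasDerivAt

theorem dx_congr {u w : ℝ × ℝ → ℝ} {p : ℝ × ℝ} (h : u =ᶠ[𝓝 p] w) (j : ℕ) :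
    dx j u p = dx j w p := by
  have hi : ContinuousAt (fun y : ℝ => (p.1, y)) p.2 := by fun_prop
  exact Filter.EventuallyEq.iteratedDeriv_eq j (hi.eventually h)

theorem dt_congr {u w : ℝ × ℝ → ℝ} {p : ℝ × ℝ} (h : u =ᶠ[𝓝 p] w) :
    dt u p = dt w p := by
  have hi : ContinuousAt (fun y : ℝ => (y, p.2)) p.1 := by fun_prop
  exact Filter.EventuallyEq.deriv_eq (hi.eventually h)

theorem dt_eq_fderiv {u : ℝ × ℝ → ℝ} {p : ℝ × ℝ} (hu : ContDiffAt ℝ ∞ u p) :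
    dt u p = fderiv ℝ u p (1, 0) := by
  have h1 : HasFDerivAt u (fderiv ℝ u p) (p.1, p.2) := (hu.differentiableAt (by simp)).hasFDerivAt
  have h2 : HasDerivAt (fun y : ℝ => (y, p.2)) ((1 : ℝ), (0 : ℝ)) p.1 :=
    (hasDerivAt_id p.1).prodMk (hasDerivAt_const _ _)
  exact (h1.comp_hasDerivAt p.1 h2).deriv

theorem dx_one_eq_fderiv {u : ℝ × ℝ → ℝ} {p : ℝ × ℝ} (hu : ContDiffAt ℝ ∞ u p) :
    dx 1 u p = fderiv ℝ u p (0, 1) := by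
  have h1 : HasFDerivAt u (fderiv ℝ u p) (p.1, p.2) := (hu.differentiableAt (by simp)).hasFDerivAt
  have h2 : HasDerivAt (fun y : ℝ => (p.1, y)) ((0 : ℝ), (1 : ℝ)) p.2 :=
    (hasDerivAt_const _ _).prodMk (hasDerivAt_id p.2)
  rw [dx, iteratedDeriv_one]
  exact (h1.comp_hasDerivAt p.2 h2).deriv

theorem fderiv_apply_eq {u : ℝ × ℝ → ℝ} {p : ℝ × ℝ} (hu : ContDiffAt ℝ ∞ u p) (d : ℝ × ℝ) :
    fderiv ℝ u p d = d.1 * dt u p + d.2 * dx 1 u p := by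
  rw [dt_eq_fderiv hu, dx_one_eq_fderiv hu]
  have : d = d.1 • ((1 : ℝ), (0 : ℝ)) + d.2 • ((0 : ℝ), (1 : ℝ)) := by ext <;> simp
  conv_lhs => rw [this]
  simp only [map_add, map_smul, smul_eq_mul]

theorem iteratedDeriv_comp_affine (g : ℝ → ℝ) (b c : ℝ) (j : ℕ) :
    iteratedDeriv j (fun y => g (b * y + c)) = fun y => b ^ j * iteratedDeriv j g (b * y + c) := by
  induction j with
  | zero => simp
  | succ j ih =>
    funext y
    rw [iteratedDeriv_succ, ih, deriv_const_mul_field,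
      deriv_comp_mul_left b (fun z => iteratedDeriv j g (z + c)), deriv_comp_add_const,
      iteratedDeriv_succ]
    simp only [smul_eq_mul]; ring

theorem dx_of_eventuallyEq {v W : ℝ × ℝ → ℝ} {α β γ : ℝ → ℝ} {p : ℝ × ℝ}
    (h : ∀ᶠ r in 𝓝 p, v (α r.1, β r.1 * r.2 + γ r.1) = W r) (j : ℕ) :
    (β p.1) ^ j * dx j v (α p.1, β p.1 * p.2 + γ p.1) = dx j W p := by
  rw [← dx_congr h j]
  simp only [dx]
  rw [iteratedDeriv_comp_affine (fun y => v (α p.1, y))]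

theorem dt_of_eventuallyEq {v W : ℝ × ℝ → ℝ} {α β γ : ℝ → ℝ} {p : ℝ × ℝ} {α' β' γ' : ℝ}
    (hv : ContDiffAt ℝ ∞ v (α p.1, β p.1 * p.2 + γ p.1))
    (hα : HasDerivAt α α' p.1) (hβ : HasDerivAt β β' p.1) (hγ : HasDerivAt γ γ' p.1)
    (h : ∀ᶠ r in 𝓝 p, v (α r.1, β r.1 * r.2 + γ r.1) = W r) :
    α' * dt v (α p.1, β p.1 * p.2 + γ p.1)
      + (β' * p.2 + γ') * dx 1 v (α p.1, β p.1 * p.2 + γ p.1) = dt W p := by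
  rw [← dt_congr h]
  have h1 : HasFDerivAt v _ (α p.1, β p.1 * p.2 + γ p.1) :=
    (hv.differentiableAt (by simp)).hasFDerivAt
  have h2 : HasDerivAt (fun t : ℝ => (α t, β t * p.2 + γ t)) (α', β' * p.2 + γ') p.1 :=
    hα.prodMk ((hβ.mul_const _).add hγ)
  have := (h1.comp_hasDerivAt p.1 h2).deriv
  rw [fderiv_apply_eq hv] at this
  exact this.symm

theorem dx_const_mul_add_const {u : ℝ × ℝ → ℝ} (φ ρ : ℝ → ℝ) (p : ℝ × ℝ) {j : ℕ} (hj : 0 < j) :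
    dx j (fun r => φ r.1 * (u r + ρ r.1)) p = φ p.1 * dx j u p := by
  simp only [dx]
  rw [iteratedDeriv_const_mul_field]
  congr 1
  simp only [add_comm _ (ρ p.1)]
  exact iteratedDeriv_const_add hj _

/-! ### The coefficient formulas are sufficient -/

theorem holdsAt_iff_of_mul_eq {l l' A φ : ℝ} (hA : A ≠ 0) (hφ : φ ≠ 0) (h : l' * A = φ * l) :
    l = 0 ↔ l' = 0 := by
  constructor
  · rintro rfl
    simpa [hA] using h
  · rintro rfl
    simpa [hφ] using h.symm

/-- Every `x`-derivative of `v` is the corresponding one of `u` times `φ` and a power of `β⁻¹`; the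
time derivative brings in `α_t`, `β_t`, `γ_t`, `φ_t` and `M_t = m`. Substitution shows that the two
left-hand sides are proportional. -/
theorem holdsAt_iff_of_coeffFormula {E E' : KdVEq} {α β γ φ M : ℝ → ℝ} {σ : ℝ} {u v : ℝ × ℝ → ℝ}
    {p : ℝ × ℝ} (hα : DifferentiableAt ℝ α p.1) (hβ : DifferentiableAt ℝ β p.1)
    (hγ : DifferentiableAt ℝ γ p.1) (hφ : DifferentiableAt ℝ φ p.1)
    (hM : HasDerivAt M (E.m p.1) p.1) (hne : deriv α p.1 * β p.1 * φ p.1 ≠ 0)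
    (hc : CoeffFormula α β γ φ σ M E E' p.1)
    (hu : ContDiffAt ℝ ∞ u p) (hv : ContDiffAt ℝ ∞ v (α p.1, β p.1 * p.2 + γ p.1))
    (huv : ∀ᶠ r in 𝓝 p, v (α r.1, β r.1 * r.2 + γ r.1)
      = φ r.1 * (u r + σ * Real.exp (-M r.1))) :
    E.HoldsAt u p ↔ E'.HoldsAt v (α p.1, β p.1 * p.2 + γ p.1) := by
  have h0 := huv.self_of_nhds
  have hx (j : ℕ) (hj : 0 < j) := (dx_of_eventuallyEq huv j).trans
    (dx_const_mul_add_const φ (fun t => σ * Real.exp (-M t)) p hj)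
  have ht := dt_of_eventuallyEq hv hα.hasDerivAt hβ.hasDerivAt hγ.hasDerivAt huv
  have hdt : dt (fun r => φ r.1 * (u r + σ * Real.exp (-M r.1))) p
      = deriv φ p.1 * (u p + σ * Real.exp (-M p.1))
        + φ p.1 * (dt u p + σ * (Real.exp (-M p.1) * (-E.m p.1))) := by
    exact (hφ.hasDerivAt.mul ((hasDerivAt_dt hu).add ((hM.neg.exp).const_mul σ))).deriv
  rw [hdt] at ht
  have hα' : deriv α p.1 ≠ 0 := fun h => hne (by simp [h])
  have hβ' : β p.1 ≠ 0 := fun h => hne (by simp [h])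
  have hφ' : φ p.1 ≠ 0 := fun h => hne (by simp [h])
  obtain ⟨ca, cb, cc, cf, cg, ch, cm, cn, ck⟩ := hc
  have hdq : deriv (fun s => γ s / β s) p.1
      = (deriv γ p.1 * β p.1 - γ p.1 * deriv β p.1) / β p.1 ^ 2 := deriv_fun_div hγ hβ hβ'
  have he2 : Real.exp (-2 * M p.1) = Real.exp (-M p.1) ^ 2 := by
    rw [← Real.exp_nat_mul]; congr 1; push_cast; ring
  rw [hdq, he2] at cn
  simp only [KdVEq.HoldsAt, ca, cb, cc, cf, cg, ch, cm, cn, ck, h0]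
  -- The factor of proportionality: new left-hand side times `α_t` equals `φ` times the old one.
  refine holdsAt_iff_of_mul_eq hα' hφ' ?_
  have x1 : dx 1 v (α p.1, β p.1 * p.2 + γ p.1) = φ p.1 * dx 1 u p / β p.1 := by
    rw [eq_div_iff hβ', ← hx 1 one_pos]; ring
  have x2 : dx 2 v (α p.1, β p.1 * p.2 + γ p.1) = φ p.1 * dx 2 u p / β p.1 ^ 2 := by
    rw [eq_div_iff (pow_ne_zero _ hβ'), ← hx 2 two_pos]; ring
  have x3 : dx 3 v (α p.1, β p.1 * p.2 + γ p.1) = φ p.1 * dx 3 u p / β p.1 ^ 3 := by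
    rw [eq_div_iff (pow_ne_zero _ hβ'), ← hx 3 three_pos]; ring
  have x5 : dx 5 v (α p.1, β p.1 * p.2 + γ p.1) = φ p.1 * dx 5 u p / β p.1 ^ 5 := by
    rw [eq_div_iff (pow_ne_zero _ hβ'), ← hx 5 (by norm_num)]; ring
  rw [x1] at ht
  have xt : dt v (α p.1, β p.1 * p.2 + γ p.1) = (deriv φ p.1 * (u p + σ * Real.exp (-M p.1))
        + φ p.1 * (dt u p + σ * (Real.exp (-M p.1) * (-E.m p.1)))
        - (deriv β p.1 * p.2 + deriv γ p.1) * (φ p.1 * dx 1 u p / β p.1)) / deriv α p.1 := by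
    rw [eq_div_iff hα', ← ht]; ring
  rw [x1, x2, x3, x5, xt]
  generalize Real.exp (-M p.1) = e
  field_simp
  ring

theorem mapsEquation_of_coeffFormula {E E' : KdVEq} {α β γ φ M : ℝ → ℝ} {σ : ℝ} {Φ : VarMap}
    (hα : ∀ t ∈ E.I, DifferentiableAt ℝ α t) (hβ : ∀ t ∈ E.I, DifferentiableAt ℝ β t)
    (hγ : ∀ t ∈ E.I, DifferentiableAt ℝ γ t) (hφ : ∀ t ∈ E.I, DifferentiableAt ℝ φ t)
    (hM : ∀ t ∈ E.I, HasDerivAt M (E.m t) t) (hne : ∀ t ∈ E.I, deriv α t * β t * φ t ≠ 0)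
    (hc : ∀ t ∈ E.I, CoeffFormula α β γ φ σ M E E' t)
    (hΦs : ∀ z ∈ Φ.source, z.1 ∈ E.I)
    (hΦ : Set.EqOn Φ (varFormula α β γ φ σ M) Φ.source) : MapsEquation E E' Φ := by
  intro u v p q hp hu hv hq hev
  have ht := hΦs _ hp
  rw [hΦ hp] at hq
  simp only [varFormula, Prod.mk.injEq] at hq
  obtain ⟨h1, h2, -⟩ := hq
  obtain rfl : q = (α p.1, β p.1 * p.2 + γ p.1) := Prod.ext h1.symm h2.symm
  refine holdsAt_iff_of_coeffFormula (hα _ ht) (hβ _ ht) (hγ _ ht) (hφ _ ht) (hM _ ht) (hne _ ht)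
    (hc _ ht) hu hv ?_
  have hcu : ContinuousAt (fun r : ℝ × ℝ => (r.1, r.2, u r)) p := by
    have := hu.continuousAt
    fun_prop
  filter_upwards [hev, hcu.eventually (Φ.open_source.mem_nhds hp)] with r hr hs
  simpa only [hΦ hs, varFormula] using hr

/-! ### Construction of the image equation and of the diffeomorphism -/

theorem contDiffOn_of_hasDerivAt {s : Set ℝ} (hs : IsOpen s) {G g : ℝ → ℝ}
    (hg : ContDiffOn ℝ ∞ g s) (hG : ∀ t ∈ s, HasDerivAt G (g t) t) : ContDiffOn ℝ ∞ G s := by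
  rw [contDiffOn_infty_iff_deriv_of_isOpen hs]
  exact ⟨fun t ht => (hG t ht).differentiableAt.differentiableWithinAt,
    hg.congr fun t ht => (hG t ht).deriv⟩

theorem exists_antiderivative {s : Set ℝ} (hs : IsOpen s) (hc : s.OrdConnected) (hn : s.Nonempty)
    {g : ℝ → ℝ} (hg : ContDiffOn ℝ ∞ g s) : ∃ G : ℝ → ℝ, ∀ t ∈ s, HasDerivAt G (g t) t := by
  obtain ⟨t₀, h₀⟩ := hn
  refine ⟨fun t => ∫ x in t₀..t, g x, fun t ht => ?_⟩
  have hcont := hg.continuousOn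
  refine intervalIntegral.integral_hasDerivAt_right
    ((hcont.mono (hc.uIcc_subset h₀ ht)).intervalIntegrable)
    (hcont.stronglyMeasurableAtFilter hs t ht) (hcont.continuousAt (hs.mem_nhds ht))

/-- Injectivity on an interval is Rolle's theorem; openness and smoothness of the inverse come from
the inverse function theorem. -/
theorem exists_openPartialHomeomorph_of_deriv_ne_zero {s : Set ℝ} (hs : IsOpen s)
    (hc : s.OrdConnected) {α : ℝ → ℝ} (hα : ContDiffOn ℝ ∞ α s) (hd : ∀ t ∈ s, deriv α t ≠ 0) :
    ∃ e : OpenPartialHomeomorph ℝ ℝ, e.source = s ∧ (e : ℝ → ℝ) = α ∧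
      ContDiffOn ℝ ∞ e.symm e.target := by
  have hinj : Set.InjOn α s := by
    have key : ∀ x ∈ s, ∀ y ∈ s, x < y → α x ≠ α y := by
      intro x hx y hy hxy h
      have hI : Set.Icc x y ⊆ s := hc.out hx hy
      obtain ⟨z, hz, hz'⟩ := exists_deriv_eq_zero hxy (hα.continuousOn.mono hI) h
      exact hd z (hI (Set.Ioo_subset_Icc_self hz)) hz'
    intro x hx y hy hxy
    rcases lt_trichotomy x y with h | h | h
    · exact absurd hxy (key x hx y hy h)
    · exact h
    · exact absurd hxy.symm (key y hy x hx h)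
  have hst : ∀ t ∈ s, HasStrictDerivAt α (deriv α t) t := fun t ht =>
    ((hα.contDiffAt (hs.mem_nhds ht))).hasStrictDerivAt (by simp)
  have hopen : IsOpenMap (s.domRestrict α) := by
    rw [isOpenMap_iff_nhds_le]
    intro t
    have h1 := (hst t t.2).map_nhds_eq (hd t t.2)
    have h2 : Filter.map (s.domRestrict α) (𝓝 t) = Filter.map α (Filter.map Subtype.val (𝓝 t)) := rfl
    rw [h2, map_nhds_subtype_coe_eq_nhds t.2 (hs.mem_nhds t.2), h1]
    exact le_rfl
  refine ⟨OpenPartialHomeomorph.ofContinuousOpenRestrict (hinj.toPartialEquiv α s)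
    hα.continuousOn hopen hs, rfl, rfl, ?_⟩
  intro y hy
  set e := OpenPartialHomeomorph.ofContinuousOpenRestrict (hinj.toPartialEquiv α s)
    hα.continuousOn hopen hs with he
  have hm : e.symm y ∈ s := e.map_target hy
  exact (e.contDiffAt_symm_deriv (hd _ hm) hy (hst _ hm).hasDerivAt
    (hα.contDiffAt (hs.mem_nhds hm))).contDiffWithinAt

theorem contDiffOn_indicator_comp_symm {e : OpenPartialHomeomorph ℝ ℝ} {F : ℝ → ℝ}
    (hF : ContDiffOn ℝ ∞ F e.source) (he : ContDiffOn ℝ ∞ e.symm e.target) :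
    ContDiffOn ℝ ∞ (e.target.indicator fun s => F (e.symm s)) e.target :=
  (hF.comp he fun _ hs => e.map_target hs).congr fun _ hs => Set.indicator_of_mem hs _

/-- The local homeomorphism `(t, x, u) ↦ (α(t), β(t) x + γ(t), φ(t) (u + σ exp(-M(t))))`. -/
theorem exists_varMap {e : OpenPartialHomeomorph ℝ ℝ} {β γ φ M : ℝ → ℝ} (σ : ℝ)
    (hn : e.source.Nonempty) (hs : e.source.OrdConnected) (hα : ContDiffOn ℝ ∞ e e.source)
    (hα' : ContDiffOn ℝ ∞ e.symm e.target)
    (hβ : ContDiffOn ℝ ∞ β e.source) (hγ : ContDiffOn ℝ ∞ γ e.source)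
    (hφ : ContDiffOn ℝ ∞ φ e.source) (hM : ContDiffOn ℝ ∞ M e.source)
    (hβ0 : ∀ t ∈ e.source, β t ≠ 0) (hφ0 : ∀ t ∈ e.source, φ t ≠ 0) :
    ∃ Φ : VarMap, IsPointTransformation Φ ∧ Φ.source = {z | z.1 ∈ e.source} ∧
      Φ.target = {z | z.1 ∈ e.target} ∧ Set.EqOn Φ (varFormula e β γ φ σ M) Φ.source := by
  set S : Set (ℝ × ℝ × ℝ) := {z | z.1 ∈ e.source} with hS
  set S' : Set (ℝ × ℝ × ℝ) := {z | z.1 ∈ e.target} with hS'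
  have m1 : Set.MapsTo (fun z : ℝ × ℝ × ℝ => z.1) S e.source := fun z hz => hz
  have m2 : Set.MapsTo (fun z : ℝ × ℝ × ℝ => e.symm z.1) S' e.source :=
    fun z hz => e.map_target hz
  have l {F : ℝ → ℝ} (hF : ContDiffOn ℝ ∞ F e.source) :
      ContDiffOn ℝ ∞ (fun z : ℝ × ℝ × ℝ => F z.1) S := hF.comp contDiffOn_fst m1
  have r0 : ContDiffOn ℝ ∞ (fun z : ℝ × ℝ × ℝ => e.symm z.1) S' :=
    hα'.comp contDiffOn_fst fun z hz => hz
  have r {F : ℝ → ℝ} (hF : ContDiffOn ℝ ∞ F e.source) :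
      ContDiffOn ℝ ∞ (fun z : ℝ × ℝ × ℝ => F (e.symm z.1)) S' := hF.comp r0 m2
  let inv : ℝ × ℝ × ℝ → ℝ × ℝ × ℝ := fun z => (e.symm z.1, (z.2.1 - γ (e.symm z.1)) / β (e.symm z.1),
    z.2.2 / φ (e.symm z.1) - σ * Real.exp (-M (e.symm z.1)))
  have hsm : ContDiffOn ℝ ∞ (varFormula e β γ φ σ M) S := by
    have c1 : ContDiffOn ℝ ∞ (fun z : ℝ × ℝ × ℝ => z.2.1) S := by fun_prop
    have c2 : ContDiffOn ℝ ∞ (fun z : ℝ × ℝ × ℝ => z.2.2) S := by fun_prop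
    exact (l hα).prodMk ((((l hβ).mul c1).add (l hγ)).prodMk
      ((l hφ).mul (c2.add (contDiffOn_const.mul (l hM).neg.exp))))
  have hsm' : ContDiffOn ℝ ∞ inv S' := by
    have c1 : ContDiffOn ℝ ∞ (fun z : ℝ × ℝ × ℝ => z.2.1) S' := by fun_prop
    have c2 : ContDiffOn ℝ ∞ (fun z : ℝ × ℝ × ℝ => z.2.2) S' := by fun_prop
    exact r0.prodMk (((c1.sub (r hγ)).div (r hβ) fun z hz => hβ0 _ (m2 hz)).prodMk
      ((c2.div (r hφ) fun z hz => hφ0 _ (m2 hz)).sub (contDiffOn_const.mul (r hM).neg.exp)))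
  let Φ : VarMap :=
    { toFun := varFormula e β γ φ σ M
      invFun := inv
      source := S
      target := S'
      map_source' := fun z hz => e.map_source hz
      map_target' := fun z hz => e.map_target hz
      left_inv' := fun z hz => by
        have h1 := hβ0 _ hz
        have h2 := hφ0 _ hz
        have h3 : e.symm (e z.1) = z.1 := e.left_inv hz
        simp only [varFormula, inv, h3]
        refine Prod.ext rfl (Prod.ext ?_ ?_)
        · simp [h1]
        · simp [h2]
      right_inv' := fun z hz => by
        have h1 := hβ0 _ (m2 hz)
        have h2 := hφ0 _ (m2 hz)
        have h3 : e (e.symm z.1) = z.1 := e.right_inv hz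
        simp only [varFormula, inv, h3]
        refine Prod.ext rfl (Prod.ext ?_ ?_)
        · simp only; field_simp; ring
        · simp only; field_simp; ring
      open_source := e.open_source.preimage continuous_fst
      open_target := e.open_target.preimage continuous_fst
      continuousOn_toFun := hsm.continuousOn
      continuousOn_invFun := hsm'.continuousOn }
  refine ⟨Φ, ⟨⟨?_, ?_⟩, hsm, hsm'⟩, rfl, rfl, fun z _ => rfl⟩
  · obtain ⟨t, ht⟩ := hn
    exact ⟨(t, 0, 0), ht⟩
  · have hp : IsPreconnected (e.source ×ˢ (Set.univ : Set (ℝ × ℝ))) :=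
      hs.isPreconnected.prod isPreconnected_univ
    convert hp using 1
    ext z
    simp [Φ, hS]

/-- The coefficient formulas are taken as the definition of the image equation, by transporting
functions of the old time along the inverse of `α`. Only smoothness and nondegeneracy then need
checking. -/
theorem exists_isAdmissible_of_params (E : KdVEq) {α β γ φ M : ℝ → ℝ} (σ : ℝ)
    (hα : ContDiffOn ℝ ∞ α E.I) (hβ : ContDiffOn ℝ ∞ β E.I) (hγ : ContDiffOn ℝ ∞ γ E.I)
    (hφ : ContDiffOn ℝ ∞ φ E.I) (hM : ∀ t ∈ E.I, HasDerivAt M (E.m t) t)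
    (hne : ∀ t ∈ E.I, deriv α t * β t * φ t ≠ 0) :
    ∃ (E' : KdVEq) (Φ : VarMap), E'.I = α '' E.I ∧
      (∀ t ∈ E.I, CoeffFormula α β γ φ σ M E E' t) ∧
      Φ.source = {z | z.1 ∈ E.I} ∧ Φ.target = {z | z.1 ∈ E'.I} ∧
      Set.EqOn Φ (varFormula α β γ φ σ M) {z | z.1 ∈ E.I} ∧ IsAdmissible E E' Φ := by
  have hα0 : ∀ t ∈ E.I, deriv α t ≠ 0 := fun t ht h => hne t ht (by simp [h])
  have hβ0 : ∀ t ∈ E.I, β t ≠ 0 := fun t ht h => hne t ht (by simp [h])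
  have hφ0 : ∀ t ∈ E.I, φ t ≠ 0 := fun t ht h => hne t ht (by simp [h])
  obtain ⟨e, he, rfl, hes⟩ :=
    exists_openPartialHomeomorph_of_deriv_ne_zero E.isOpen_I E.ordConnected_I hα hα0
  have hα1 : ContDiffOn ℝ ∞ (deriv e) E.I := ((contDiffOn_infty_iff_deriv_of_isOpen E.isOpen_I).1 hα).2
  have hMs := contDiffOn_of_hasDerivAt E.isOpen_I E.smooth_m hM
  have hexp : ContDiffOn ℝ ∞ (fun t => Real.exp (-M t)) E.I := hMs.neg.exp
  have hexp2 : ContDiffOn ℝ ∞ (fun t => Real.exp (-2 * M t)) E.I := (contDiffOn_const.mul hMs).exp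
  have hderiv {F : ℝ → ℝ} (h : ContDiffOn ℝ ∞ F E.I) : ContDiffOn ℝ ∞ (deriv F) E.I :=
    ((contDiffOn_infty_iff_deriv_of_isOpen E.isOpen_I).1 h).2
  have hγβ : ContDiffOn ℝ ∞ (fun s => γ s / β s) E.I := hγ.div hβ hβ0
  have hmem : ∀ t ∈ E.I, e t ∈ e.target := fun t ht => e.map_source (he ▸ ht)
  have hsy : ∀ t ∈ E.I, e.symm (e t) = t := fun t ht => e.left_inv (he ▸ ht)
  have hmem' : ∀ s ∈ e.target, e.symm s ∈ E.I := fun s hs => he ▸ e.map_target hs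
  have htgt : e.target = e '' E.I := by rw [← he, e.image_source_eq_target]
  have hsm {F : ℝ → ℝ} (hF : ContDiffOn ℝ ∞ F E.I) :
      ContDiffOn ℝ ∞ (e.target.indicator fun s => F (e.symm s)) e.target :=
    contDiffOn_indicator_comp_symm (he ▸ hF) hes
  have hval (F : ℝ → ℝ) (t : ℝ) (ht : t ∈ E.I) :
      (e.target.indicator fun s => F (e.symm s)) (e t) = F t := by
    rw [Set.indicator_of_mem (hmem t ht), hsy t ht]
  have q1 : ∀ t ∈ E.I, deriv e t * φ t ≠ 0 := fun t ht => mul_ne_zero (hα0 t ht) (hφ0 t ht)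
  have q2 : ∀ t ∈ E.I, deriv e t * (φ t) ^ 2 ≠ 0 :=
    fun t ht => mul_ne_zero (hα0 t ht) (pow_ne_zero _ (hφ0 t ht))
  let fa : ℝ → ℝ := fun t => (β t) ^ 3 / (deriv e t * φ t) * E.a t
  let fb : ℝ → ℝ := fun t => (β t) ^ 3 / (deriv e t * φ t) * E.b t
  let fc : ℝ → ℝ := fun t => β t / (deriv e t * (φ t) ^ 2) * E.c t
  let ff : ℝ → ℝ := fun t => β t / (deriv e t * φ t) * (E.f t - 2 * σ * E.c t * Real.exp (-M t))
  let fg : ℝ → ℝ := fun t => (β t) ^ 5 / deriv e t * E.g t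
  let fh : ℝ → ℝ := fun t => (β t) ^ 3 / deriv e t * (E.h t - σ * E.a t * Real.exp (-M t))
  let fm : ℝ → ℝ := fun t => 1 / deriv e t * (E.m t - deriv φ t / φ t)
  let fn : ℝ → ℝ := fun t => β t / deriv e t * (E.n t + deriv (fun s => γ s / β s) t
    - E.k t * (γ t / β t) + σ ^ 2 * E.c t * Real.exp (-2 * M t) - σ * E.f t * Real.exp (-M t))
  let fk : ℝ → ℝ := fun t => 1 / deriv e t * (E.k t + deriv β t / β t)
  -- Extension by zero outside the image interval, as `off_I` requires.
  let ext (F : ℝ → ℝ) : ℝ → ℝ := e.target.indicator fun s => F (e.symm s)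
  let E' : KdVEq :=
    { I := e.target
      a := ext fa
      b := ext fb
      c := ext fc
      f := ext ff
      g := ext fg
      h := ext fh
      m := ext fm
      n := ext fn
      k := ext fk
      isOpen_I := e.open_target
      ordConnected_I := by
        rw [htgt]
        exact (E.ordConnected_I.isPreconnected.image _ hα.continuousOn).ordConnected
      nonempty_I := by rw [htgt]; exact E.nonempty_I.image _
      smooth_a := hsm (((hβ.pow 3).div (hα1.mul hφ) q1).mul E.smooth_a)
      smooth_b := hsm (((hβ.pow 3).div (hα1.mul hφ) q1).mul E.smooth_b)
      smooth_c := hsm ((hβ.div (hα1.mul (hφ.pow 2)) q2).mul E.smooth_c)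
      smooth_f := hsm ((hβ.div (hα1.mul hφ) q1).mul
        (E.smooth_f.sub ((contDiffOn_const.mul E.smooth_c).mul hexp)))
      smooth_g := hsm (((hβ.pow 5).div hα1 hα0).mul E.smooth_g)
      smooth_h := hsm (((hβ.pow 3).div hα1 hα0).mul
        (E.smooth_h.sub ((contDiffOn_const.mul E.smooth_a).mul hexp)))
      smooth_m := hsm ((contDiffOn_const.div hα1 hα0).mul
        (E.smooth_m.sub ((hderiv hφ).div hφ hφ0)))
      smooth_n := hsm ((hβ.div hα1 hα0).mul ((((E.smooth_n.add (hderiv hγβ)).sub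
        (E.smooth_k.mul hγβ)).add ((contDiffOn_const.mul E.smooth_c).mul hexp2)).sub
        ((contDiffOn_const.mul E.smooth_f).mul hexp)))
      smooth_k := hsm ((contDiffOn_const.div hα1 hα0).mul
        (E.smooth_k.add ((hderiv hβ).div hβ hβ0)))
      nondegenerate := by
        intro s hs
        have ht := hmem' s hs
        simp only [ext, Set.indicator_of_mem hs, fa, fb, fc, fg]
        set t := e.symm s
        have d := E.nondegenerate t ht
        have n1 := hα0 t ht
        have n2 := hβ0 t ht
        have n3 := hφ0 t ht
        have hg : E.g t ≠ 0 := fun h => d (by simp [h])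
        refine mul_ne_zero (mul_ne_zero (div_ne_zero (pow_ne_zero _ n2) n1) hg) ?_
        intro h0
        apply d
        have k1 : β t ^ 3 / (deriv e t * φ t) ≠ 0 := div_ne_zero (pow_ne_zero _ n2) (q1 t ht)
        have k2 : β t / (deriv e t * φ t ^ 2) ≠ 0 := div_ne_zero n2 (q2 t ht)
        -- A vanishing sum of three squares makes each square vanish.
        have ha : β t ^ 3 / (deriv e t * φ t) * E.a t = 0 := by nlinarith
        have hb : β t ^ 3 / (deriv e t * φ t) * E.b t = 0 := by nlinarith
        have hc : β t / (deriv e t * φ t ^ 2) * E.c t = 0 := by nlinarith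
        rw [(mul_eq_zero.1 ha).resolve_left k1, (mul_eq_zero.1 hb).resolve_left k1,
          (mul_eq_zero.1 hc).resolve_left k2]
        ring
      off_I := by
        intro s hs
        simp only [ext, Set.indicator_of_notMem hs, and_self] }
  have hcoeff : ∀ t ∈ E.I, CoeffFormula e β γ φ σ M E E' t := fun t ht =>
    ⟨hval fa t ht, hval fb t ht, hval fc t ht, hval ff t ht, hval fg t ht, hval fh t ht,
      hval fm t ht, hval fn t ht, hval fk t ht⟩
  obtain ⟨Φ, hΦ, hsrc, htg, hform⟩ := exists_varMap σ (he ▸ E.nonempty_I) (he ▸ E.ordConnected_I)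
    (he ▸ hα) hes (he ▸ hβ) (he ▸ hγ) (he ▸ hφ) (he ▸ hMs) (he ▸ hβ0) (he ▸ hφ0)
  rw [he] at hsrc
  have hd {F : ℝ → ℝ} (h : ContDiffOn ℝ ∞ F E.I) : ∀ t ∈ E.I, DifferentiableAt ℝ F t := fun t ht =>
    (h.contDiffAt (E.isOpen_I.mem_nhds ht)).differentiableAt (by simp)
  refine ⟨E', Φ, htgt, hcoeff, hsrc, htg, hsrc ▸ hform, hΦ, fun z hz => ?_, fun z hz => ?_, ?_⟩
  · rw [hsrc] at hz; exact hz
  · rw [htg] at hz; exact hz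
  · exact mapsEquation_of_coeffFormula (hd hα) (hd hβ) (hd hγ) (hd hφ) hM hne hcoeff
      (fun z hz => by rw [hsrc] at hz; exact hz) hform

/-! ### Reduction of the full class to the subclass -/

theorem exists_gauging_transformation (E : KdVEq) {K M τ ν : ℝ → ℝ}
    (hK : ∀ t ∈ E.I, HasDerivAt K (E.k t) t) (hM : ∀ t ∈ E.I, HasDerivAt M (E.m t) t)
    (hτ : ∀ t ∈ E.I, HasDerivAt τ (E.g t * Real.exp (-5 * K t)) t)
    (hν : ∀ t ∈ E.I, HasDerivAt ν (E.n t * Real.exp (-K t)) t) :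
    ∃ (E' : KdVEq) (Φ : VarMap), E' ∈ gaugedClass ∧
      Φ.source = {z | z.1 ∈ E.I} ∧ Φ.target = {z | z.1 ∈ E'.I} ∧
      (∀ z ∈ Φ.source,
        Φ z = (τ z.1, Real.exp (-K z.1) * z.2.1 - ν z.1, Real.exp (M z.1) * z.2.2)) ∧
      IsAdmissible E E' Φ := by
  have hKs := contDiffOn_of_hasDerivAt E.isOpen_I E.smooth_k hK
  have hMs := contDiffOn_of_hasDerivAt E.isOpen_I E.smooth_m hM
  have hτs := contDiffOn_of_hasDerivAt E.isOpen_I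
    (E.smooth_g.mul (contDiffOn_const.mul hKs).exp) hτ
  have hνs := contDiffOn_of_hasDerivAt E.isOpen_I (E.smooth_n.mul hKs.neg.exp) hν
  have hg0 : ∀ t ∈ E.I, E.g t ≠ 0 := fun t ht h => E.nondegenerate t ht (by simp [h])
  -- With `σ = 0`, the choice `β = exp(-K)` cancels `k`, `φ = exp M` cancels `m`, `γ = -ν` cancels
  -- `n` since `(γ/β)_t = -n + k γ/β`, and `τ_t = g β⁵` makes the new `g` equal to `1`.
  obtain ⟨E', Φ, hI, hc, hs, ht, hΦ, hadm⟩ := exists_isAdmissible_of_params E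
    (α := τ) (β := fun t => Real.exp (-K t)) (γ := fun t => -ν t) (φ := fun t => Real.exp (M t))
    (M := M) 0 hτs hKs.neg.exp hνs.neg hMs.exp hM (fun t ht => by
      rw [(hτ t ht).deriv]
      have := hg0 t ht
      positivity)
  refine ⟨E', Φ, ?_, hs, ht, ?_, hadm⟩
  · intro s hs'
    rw [hI] at hs'
    obtain ⟨t, ht, rfl⟩ := hs'
    obtain ⟨-, -, -, -, cg, -, cm, cn, ck⟩ := hc t ht
    have e5 : Real.exp (-5 * K t) = Real.exp (-K t) ^ 5 := by
      rw [← Real.exp_nat_mul]; congr 1; push_cast; ring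
    have hβd : HasDerivAt (fun s => Real.exp (-K s)) (Real.exp (-K t) * -E.k t) t := (hK t ht).neg.exp
    have hφd : HasDerivAt (fun s => Real.exp (M s)) (Real.exp (M t) * E.m t) t := (hM t ht).exp
    have hq := ((hν t ht).neg.fun_div hβd (Real.exp_ne_zero _)).deriv
    have hg := hg0 t ht
    have he := Real.exp_ne_zero (-K t)
    have he' := Real.exp_ne_zero (M t)
    rw [(hτ t ht).deriv, e5] at cg cm cn ck
    simp only [Pi.neg_apply] at hq
    rw [hβd.deriv] at ck
    rw [hφd.deriv] at cm
    rw [hq] at cn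
    beta_reduce at cg cm cn ck
    generalize Real.exp (-K t) = x at *
    generalize Real.exp (M t) = y at *
    refine ⟨?_, ?_, ?_, ?_⟩
    · rw [cg]; field_simp
    · rw [cm]; field_simp; ring
    · rw [cn]; field_simp; ring
    · rw [ck]; field_simp; ring
  · intro z hz
    rw [hΦ (by rw [← hs]; exact hz)]
    simp [varFormula, sub_eq_add_neg]

/-! ### Algebra of the constants acting on the coefficients -/

theorem KdVEq.eq_of_agreeOn {E E' : KdVEq} (hI : E.I = E'.I) (h : E.AgreeOn E' E.I) : E = E' := by
  have key : ∀ t, E.a t = E'.a t ∧ E.b t = E'.b t ∧ E.c t = E'.c t ∧ E.f t = E'.f t ∧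
      E.g t = E'.g t ∧ E.h t = E'.h t ∧ E.m t = E'.m t ∧ E.n t = E'.n t ∧ E.k t = E'.k t := by
    intro t
    by_cases ht : t ∈ E.I
    · exact h t ht
    · have h1 := E.off_I t ht
      have h2 := E'.off_I t (hI ▸ ht)
      simp [h1, h2]
  refine KdVEq.ext hI ?_ ?_ ?_ ?_ ?_ ?_ ?_ ?_ ?_ <;> funext t <;> simp [key t]

/-- Constant parameters of the transformations of the gauged subclass, `α(t) = β⁵ t + τ`. -/
@[ext]
structure GaugedConsts where
  β : ℝ
  φ : ℝ
  σ : ℝ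
  τ : ℝ
  β_ne_zero : β ≠ 0
  φ_ne_zero : φ ≠ 0

namespace GaugedConsts

/-- The transformation of the time variable. -/
def time (k : GaugedConsts) (t : ℝ) : ℝ := k.β ^ 5 * t + k.τ

theorem hasDerivAt_time (k : GaugedConsts) (t : ℝ) : HasDerivAt k.time (k.β ^ 5) t := by
  exact (((hasDerivAt_id t).const_mul (k.β ^ 5)).add_const k.τ).congr_deriv (mul_one _)

/-- `E'` is the image of `E` under the action of the parameters `k` on the arbitrary elements. -/
def Rel (k : GaugedConsts) (E E' : KdVEq) : Prop :=
  E'.I = k.time '' E.I ∧ ∀ t ∈ E.I,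
    E'.a (k.time t) = E.a t / (k.β ^ 2 * k.φ) ∧
    E'.b (k.time t) = E.b t / (k.β ^ 2 * k.φ) ∧
    E'.c (k.time t) = E.c t / (k.β ^ 4 * k.φ ^ 2) ∧
    E'.f (k.time t) = (E.f t - 2 * k.σ * E.c t) / (k.β ^ 4 * k.φ) ∧
    E'.h (k.time t) = (E.h t - k.σ * E.a t) / k.β ^ 2

/-- The parameters of the identity. -/
def one : GaugedConsts := ⟨1, 1, 0, 0, one_ne_zero, one_ne_zero⟩

/-- The parameters of the composition, `k` after `l`. -/
noncomputable def comp (k l : GaugedConsts) : GaugedConsts where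
  β := k.β * l.β
  φ := k.φ * l.φ
  -- From `φ_k (φ_l (u + σ_l) + σ_k) = φ_k φ_l (u + σ_l + σ_k / φ_l)`.
  σ := l.σ + k.σ / l.φ
  τ := k.time l.τ
  β_ne_zero := mul_ne_zero k.β_ne_zero l.β_ne_zero
  φ_ne_zero := mul_ne_zero k.φ_ne_zero l.φ_ne_zero

/-- The parameters of the inverse. -/
noncomputable def inv (k : GaugedConsts) : GaugedConsts where
  β := k.β⁻¹
  φ := k.φ⁻¹
  -- From `u = φ⁻¹ (ũ - φ σ)`; likewise `t = (t̃ - τ) / β⁵` gives the new shift.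
  σ := -(k.σ * k.φ)
  τ := -(k.τ / k.β ^ 5)
  β_ne_zero := inv_ne_zero k.β_ne_zero
  φ_ne_zero := inv_ne_zero k.φ_ne_zero

theorem time_comp (k l : GaugedConsts) (t : ℝ) : (k.comp l).time t = k.time (l.time t) := by
  simp only [time, comp]; ring

theorem time_inv_time (k : GaugedConsts) (t : ℝ) : k.inv.time (k.time t) = t := by
  have := k.β_ne_zero
  simp only [time, inv]; field_simp; ring

theorem Rel.comp {k l : GaugedConsts} {E E' E'' : KdVEq} (h : l.Rel E E') (h' : k.Rel E' E'') :
    (k.comp l).Rel E E'' := by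
  refine ⟨?_, fun t ht => ?_⟩
  · rw [h'.1, h.1, Set.image_image]
    simp only [time_comp]
  · obtain ⟨a, b, c, f, hh⟩ := h.2 t ht
    obtain ⟨a', b', c', f', hh'⟩ := h'.2 (l.time t) (h.1 ▸ Set.mem_image_of_mem _ ht)
    have h1 := k.β_ne_zero
    have h2 := k.φ_ne_zero
    have h3 := l.β_ne_zero
    have h4 := l.φ_ne_zero
    rw [time_comp, a', b', c', f', hh', a, b, c, f, hh]
    simp only [GaugedConsts.comp]
    refine ⟨?_, ?_, ?_, ?_, ?_⟩ <;> field_simp <;> try ring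

theorem Rel.symm {k : GaugedConsts} {E E' : KdVEq} (h : k.Rel E E') : k.inv.Rel E' E := by
  refine ⟨?_, fun t ht => ?_⟩
  · rw [h.1, Set.image_image]
    simp only [time_inv_time, Set.image_id']
  · rw [h.1] at ht
    obtain ⟨s, hs, rfl⟩ := ht
    obtain ⟨a, b, c, f, hh⟩ := h.2 s hs
    have h1 := k.β_ne_zero
    have h2 := k.φ_ne_zero
    rw [time_inv_time, a, b, c, f, hh]
    simp only [inv]
    refine ⟨?_, ?_, ?_, ?_, ?_⟩ <;> field_simp <;> try ring

theorem rel_one (E : KdVEq) : one.Rel E E := by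
  have h (t : ℝ) : one.time t = t := by simp [time, one]
  refine ⟨by simp [h], fun t _ => ?_⟩
  rw [h]
  simp [one]

/-- `Rel` fixes the interval and `a`, `b`, `c`, `f`, `h`; membership in the subclass fixes the
remaining coefficients. -/
theorem Rel.eq_of_mem {k : GaugedConsts} {E E₁ E₂ : KdVEq} (h₁ : k.Rel E E₁) (h₂ : k.Rel E E₂)
    (hE₁ : E₁ ∈ gaugedClass) (hE₂ : E₂ ∈ gaugedClass) : E₁ = E₂ := by
  have hI : E₁.I = E₂.I := h₁.1.trans h₂.1.symm
  refine KdVEq.eq_of_agreeOn hI fun s hs => ?_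
  have g1 := hE₁ s hs
  have g2 := hE₂ s (hI ▸ hs)
  rw [h₁.1] at hs
  obtain ⟨t, ht, rfl⟩ := hs
  have r1 := h₁.2 t ht
  have r2 := h₂.2 t ht
  simp [g1, g2, r1, r2]

/-- For constant `β` and `φ` the new `m` and `k` vanish, and `α_t = β⁵` keeps `g = 1`. The condition
on `γ_t` says precisely that the new `n`, proportional to `γ_t/β + σ² c - σ f`, is zero. -/
theorem mem_and_rel_of_coeffFormula (k : GaugedConsts) {E E' : KdVEq} (hE : E ∈ gaugedClass)
    {α β γ φ : ℝ → ℝ} (hI : E'.I = α '' E.I) (hα : ∀ t, α t = k.time t)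
    (hβ : ∀ t, β t = k.β) (hφ : ∀ t, φ t = k.φ)
    (hγ : ∀ t ∈ E.I, deriv γ t = k.σ * k.β * E.f t - k.σ ^ 2 * k.β * E.c t)
    (hc : ∀ t ∈ E.I, CoeffFormula α β γ φ k.σ (fun _ => 0) E E' t) :
    E' ∈ gaugedClass ∧ k.Rel E E' := by
  obtain rfl : α = k.time := funext hα
  obtain rfl : β = fun _ => k.β := funext hβ
  obtain rfl : φ = fun _ => k.φ := funext hφ
  have h1 := k.β_ne_zero
  have h2 := k.φ_ne_zero
  refine ⟨fun s hs => ?_, hI, fun t ht => ?_⟩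
  · rw [hI] at hs
    obtain ⟨t, ht, rfl⟩ := hs
    obtain ⟨-, -, -, -, cg, -, cm, cn, ck⟩ := hc t ht
    obtain ⟨eg, em, en, ek⟩ := hE t ht
    rw [(k.hasDerivAt_time t).deriv, deriv_div_const, hγ t ht, en, ek] at cn
    rw [(k.hasDerivAt_time t).deriv] at cg cm ck
    rw [cg, cm, cn, ck, eg, em, ek]
    refine ⟨?_, ?_, ?_, ?_⟩
    · field_simp
    · simp
    · simp only [mul_zero, neg_zero, Real.exp_zero]
      field_simp
      ring
    · simp
  · obtain ⟨a, b, c, f, -, hh, -⟩ := hc t ht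
    rw [(k.hasDerivAt_time t).deriv] at a b c f hh
    rw [a, b, c, f, hh]
    simp only [neg_zero, Real.exp_zero, mul_one]
    refine ⟨?_, ?_, ?_, ?_, ?_⟩ <;> field_simp

end GaugedConsts

/-! ### Parameters realised as equivalence transformations -/

theorem exists_gauged_antiderivative (E : gaugedClass) (σ β : ℝ) : ∃ γ : ℝ → ℝ,
    ∀ t ∈ E.1.I, HasDerivAt γ (σ * β * E.1.f t - σ ^ 2 * β * E.1.c t) t :=
  exists_antiderivative E.1.isOpen_I E.1.ordConnected_I E.1.nonempty_I
    ((contDiffOn_const.mul E.1.smooth_f).sub (contDiffOn_const.mul E.1.smooth_c))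

theorem contDiffOn_gauged_antiderivative {E : gaugedClass} {σ β : ℝ} {γ : ℝ → ℝ}
    (h : ∀ t ∈ E.1.I, HasDerivAt γ (σ * β * E.1.f t - σ ^ 2 * β * E.1.c t) t) :
    ContDiffOn ℝ ∞ γ E.1.I :=
  contDiffOn_of_hasDerivAt E.1.isOpen_I
    ((contDiffOn_const.mul E.1.smooth_f).sub (contDiffOn_const.mul E.1.smooth_c)) h

/-- The parameters with given constants and antiderivatives. -/
noncomputable def GaugedConsts.toParams (k : GaugedConsts) (γ : gaugedClass → ℝ → ℝ)
    (hγ : ∀ E : gaugedClass, ∀ t ∈ E.1.I,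
      HasDerivAt (γ E) (k.σ * k.β * E.1.f t - k.σ ^ 2 * k.β * E.1.c t) t) : GaugedParams where
  α := k.time
  β := fun _ => k.β
  φ := fun _ => k.φ
  σ := k.σ
  γ := γ
  smooth_α := by unfold GaugedConsts.time; fun_prop
  smooth_β := contDiff_const
  smooth_φ := contDiff_const
  smooth_γ E := contDiffOn_gauged_antiderivative (hγ E)
  nondegenerate t := by
    rw [(k.hasDerivAt_time t).deriv]
    exact mul_ne_zero (mul_ne_zero (pow_ne_zero _ k.β_ne_zero) k.β_ne_zero) k.φ_ne_zero
  deriv_β t := deriv_const _ _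
  deriv_φ t := deriv_const _ _
  deriv_α t := (k.hasDerivAt_time t).deriv
  deriv_γ E t ht := (hγ E t ht).deriv

namespace GaugedParams

theorem β_eq (P : GaugedParams) (t : ℝ) : P.β t = P.β 0 :=
  is_const_of_deriv_eq_zero (P.smooth_β.differentiable (by simp)) P.deriv_β t 0

theorem φ_eq (P : GaugedParams) (t : ℝ) : P.φ t = P.φ 0 :=
  is_const_of_deriv_eq_zero (P.smooth_φ.differentiable (by simp)) P.deriv_φ t 0

/-- The constants of the parameters. -/
def consts (P : GaugedParams) : GaugedConsts where
  β := P.β 0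
  φ := P.φ 0
  σ := P.σ
  τ := P.α 0
  β_ne_zero h := P.nondegenerate 0 (by simp [h])
  φ_ne_zero h := P.nondegenerate 0 (by simp [h])

theorem α_eq (P : GaugedParams) (t : ℝ) : P.α t = P.consts.time t := by
  have hd : ∀ s, HasDerivAt (fun s => P.α s - P.consts.time s) 0 s := fun s => by
    have h1 := ((P.smooth_α.differentiable (by simp)) s).hasDerivAt
    rw [P.deriv_α, P.β_eq] at h1
    exact (h1.sub (P.consts.hasDerivAt_time s)).congr_deriv (sub_self _)
  have := is_const_of_deriv_eq_zero (fun s => (hd s).differentiableAt) (fun s => (hd s).deriv) t 0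
  simp only [GaugedConsts.time, consts] at this ⊢
  linarith

theorem hasDerivAt_γ (P : GaugedParams) (E : gaugedClass) {t : ℝ} (ht : t ∈ E.1.I) :
    HasDerivAt (P.γ E) (P.consts.σ * P.consts.β * E.1.f t - P.consts.σ ^ 2 * P.consts.β * E.1.c t)
      t := by
  have h := (((P.smooth_γ E).contDiffAt (E.1.isOpen_I.mem_nhds ht)).differentiableAt
    (by simp)).hasDerivAt
  rw [P.deriv_γ E t ht, P.β_eq] at h
  exact h

/-- The transformation of the variables in terms of the constants. -/
theorem varFormula_eq (P : GaugedParams) (E : gaugedClass) (z : ℝ × ℝ × ℝ) :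
    varFormula P.α P.β (P.γ E) P.φ P.σ (fun _ => 0) z =
      (P.consts.time z.1, P.consts.β * z.2.1 + P.γ E z.1, P.consts.φ * (z.2.2 + P.consts.σ)) := by
  rw [varFormula, P.α_eq, P.β_eq z.1, P.φ_eq z.1, neg_zero, Real.exp_zero, mul_one]
  rfl

theorem exists_image (P : GaugedParams) (E : gaugedClass) :
    ∃ (E' : gaugedClass) (Φ : VarMap), P.consts.Rel E.1 E'.1 ∧
      (∀ t ∈ E.1.I, CoeffFormula P.α P.β (P.γ E) P.φ P.σ (fun _ => 0) E.1 E'.1 t) ∧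
      Φ.source = {z | z.1 ∈ E.1.I} ∧ Φ.target = {z | z.1 ∈ E'.1.I} ∧
      Set.EqOn Φ (varFormula P.α P.β (P.γ E) P.φ P.σ (fun _ => 0)) {z | z.1 ∈ E.1.I} ∧
      IsAdmissible E.1 E'.1 Φ := by
  obtain ⟨E', Φ, hI, hc, hs, ht, hΦ, hadm⟩ := exists_isAdmissible_of_params E.1
    (α := P.α) (β := P.β) (γ := P.γ E) (φ := P.φ) (M := fun _ => 0) P.σ P.smooth_α.contDiffOn
    P.smooth_β.contDiffOn (P.smooth_γ E) P.smooth_φ.contDiffOn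
    (fun t ht => by rw [(E.2 t ht).2.1]; exact hasDerivAt_const _ _)
    (fun t _ => P.nondegenerate t)
  obtain ⟨hm, hr⟩ := P.consts.mem_and_rel_of_coeffFormula E.2 hI P.α_eq P.β_eq P.φ_eq
    (fun t ht => (P.hasDerivAt_γ E ht).deriv) hc
  exact ⟨⟨E', hm⟩, Φ, hr, hc, hs, ht, hΦ, hadm⟩

end GaugedParams

/-- Any antiderivatives `γ` may be used, since the action on coefficients does not see them. -/
theorem GaugedConsts.exists_rel (k : GaugedConsts) (E : gaugedClass) :
    ∃ E' : gaugedClass, k.Rel E.1 E'.1 := by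
  choose γ hγ using fun E : gaugedClass => exists_gauged_antiderivative E k.σ k.β
  obtain ⟨E', -, h, -⟩ := (k.toParams γ hγ).exists_image E
  refine ⟨E', ?_⟩
  convert h using 1
  ext <;> simp [GaugedParams.consts, GaugedConsts.toParams, GaugedConsts.time]

theorem GaugedConsts.Rel.unique {k : GaugedConsts} {E E₁ E₂ : gaugedClass} (h₁ : k.Rel E.1 E₁.1)
    (h₂ : k.Rel E.1 E₂.1) : E₁ = E₂ := Subtype.ext (h₁.eq_of_mem h₂ E₁.2 E₂.2)

/-- The action of the parameters on the arbitrary elements. -/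
noncomputable def GaugedConsts.equiv (k : GaugedConsts) : gaugedClass ≃ gaugedClass where
  toFun E := (k.exists_rel E).choose
  invFun E := (k.inv.exists_rel E).choose
  left_inv E := (k.inv.exists_rel _).choose_spec.unique (k.exists_rel E).choose_spec.symm
  right_inv E := by
    have h := (k.exists_rel (k.inv.exists_rel E).choose).choose_spec
    have h2 := (k.inv.exists_rel E).choose_spec.symm
    have hk : k.inv.inv = k := by
      have h1 := k.β_ne_zero
      have h2 := k.φ_ne_zero
      ext <;> simp only [GaugedConsts.inv] <;> field_simp
    rw [hk] at h2
    exact h.unique h2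

theorem GaugedConsts.rel_equiv (k : GaugedConsts) (E : gaugedClass) : k.Rel E.1 (k.equiv E).1 :=
  (k.exists_rel E).choose_spec

theorem GaugedParams.exists_isGivenBy (P : GaugedParams) :
    ∃ T : EquivTransformation gaugedClass, T.IsGivenBy P := by
  choose F Φ hr hc hs ht hΦ hadm using P.exists_image
  -- The images were chosen equation by equation; uniqueness identifies them with the values of a
  -- bijection.
  have hF : ∀ E, F E = P.consts.equiv E := fun E => (hr E).unique (P.consts.rel_equiv E)
  refine ⟨⟨P.consts.equiv, Φ, hs, fun E => ?_, fun E => ?_⟩, fun E => ⟨hΦ E, ?_⟩⟩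
  · rw [ht, hF]
  · rw [← hF]; exact hadm E
  · simp only [← hF]; exact hc E

namespace EquivTransformation

theorem IsGivenBy.onVar_eq {T : EquivTransformation gaugedClass} {P : GaugedParams}
    (h : T.IsGivenBy P) (E : gaugedClass) {z : ℝ × ℝ × ℝ} (hz : z ∈ (T.onVar E).source) :
    T.onVar E z = (P.consts.time z.1, P.consts.β * z.2.1 + P.γ E z.1,
      P.consts.φ * (z.2.2 + P.consts.σ)) := by
  rw [T.source_eq] at hz
  rw [(h E).1 hz, P.varFormula_eq]

theorem fst_image_target {T : EquivTransformation gaugedClass} (E : gaugedClass) :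
    Prod.fst '' (T.onVar E).target = (T.onEq E).1.I := by
  ext s
  rw [T.target_eq]
  exact ⟨fun ⟨z, hz, h⟩ => h ▸ hz, fun h => ⟨(s, 0, 0), h, rfl⟩⟩

theorem IsGivenBy.rel {T : EquivTransformation gaugedClass} {P : GaugedParams}
    (h : T.IsGivenBy P) (E : gaugedClass) : P.consts.Rel E.1 (T.onEq E).1 := by
  refine (P.consts.mem_and_rel_of_coeffFormula E.2 ?_ P.α_eq P.β_eq P.φ_eq
    (fun t ht => (P.hasDerivAt_γ E ht).deriv) (h E).2).2
  -- `IsGivenBy` does not mention the interval of the image equation; it is recovered from the range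
  -- of the transformation of variables.
  rw [← fst_image_target, ← (T.onVar E).image_source_eq_target, Set.image_image]
  ext s
  constructor
  · rintro ⟨z, hz, rfl⟩
    refine ⟨z.1, by rwa [T.source_eq] at hz, ?_⟩
    simp only [h.onVar_eq E hz, P.α_eq]
  · rintro ⟨t, ht, rfl⟩
    have hz : ((t, 0, 0) : ℝ × ℝ × ℝ) ∈ (T.onVar E).source := by rw [T.source_eq]; exact ht
    refine ⟨_, hz, ?_⟩
    simp only [h.onVar_eq E hz, P.α_eq]

end EquivTransformation

theorem exists_mem_gaugedGroup (k : GaugedConsts) (γ : gaugedClass → ℝ → ℝ)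
    (hγ : ∀ E : gaugedClass, ∀ t ∈ E.1.I,
      HasDerivAt (γ E) (k.σ * k.β * E.1.f t - k.σ ^ 2 * k.β * E.1.c t) t) :
    ∃ T ∈ gaugedGroup, ∀ E, k.Rel E.1 (T.onEq E).1 ∧ ∀ z ∈ (T.onVar E).source,
      T.onVar E z = (k.time z.1, k.β * z.2.1 + γ E z.1, k.φ * (z.2.2 + k.σ)) := by
  obtain ⟨T, hT⟩ := (k.toParams γ hγ).exists_isGivenBy
  have hk : (k.toParams γ hγ).consts = k := by
    ext <;> simp [GaugedParams.consts, GaugedConsts.toParams, GaugedConsts.time]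
  refine ⟨T, ⟨_, hT⟩, fun E => ⟨?_, fun z hz => ?_⟩⟩
  · have := hT.rel E
    rwa [hk] at this
  · have := hT.onVar_eq E hz
    rwa [hk] at this

/-! ### The group laws -/

theorem exists_identity_mem_gaugedGroup : ∃ T ∈ gaugedGroup, T.onEq = Equiv.refl _ ∧
    ∀ E, Set.EqOn (T.onVar E) id (T.onVar E).source := by
  obtain ⟨T, hT, h⟩ := exists_mem_gaugedGroup GaugedConsts.one (fun _ _ => 0) (fun E t _ => by
    simpa [GaugedConsts.one] using hasDerivAt_const t (0 : ℝ))
  refine ⟨T, hT, Equiv.ext fun E => (h E).1.unique (GaugedConsts.rel_one E.1), fun E z hz => ?_⟩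
  rw [(h E).2 z hz]
  simp [GaugedConsts.one, GaugedConsts.time]

theorem exists_comp_mem_gaugedGroup {S T : EquivTransformation gaugedClass} (hS : S ∈ gaugedGroup)
    (hT : T ∈ gaugedGroup) : ∃ R ∈ gaugedGroup, S.IsComp T R := by
  obtain ⟨P, hP⟩ := hS
  obtain ⟨Q, hQ⟩ := hT
  set k := P.consts with hk
  set l := Q.consts with hl
  have hl1 := l.β_ne_zero
  have hl2 := l.φ_ne_zero
  obtain ⟨R, hR, h⟩ := exists_mem_gaugedGroup (k.comp l)
    -- The shift of the composite: `β_k (β_l x + γ_l(t)) + γ_k(t')`, where `t'` is the intermediate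
    -- time and `γ_k` belongs to the intermediate equation. Its derivative is the required one
    -- because `c` and `f` of that equation are known through `Rel`.
    (fun E t => k.β * Q.γ E t + P.γ (T.onEq E) (l.time t)) (fun E t ht => by
      have r := hQ.rel E
      have ht' : l.time t ∈ (T.onEq E).1.I := by rw [r.1]; exact Set.mem_image_of_mem _ ht
      have h1 := (Q.hasDerivAt_γ E ht).const_mul k.β
      have h2 := (P.hasDerivAt_γ (T.onEq E) ht').comp t (l.hasDerivAt_time t)
      obtain ⟨-, -, c, f, -⟩ := r.2 t ht
      rw [← hl] at c f h1
      refine (h1.add h2).congr_deriv ?_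
      rw [c, f]
      simp only [GaugedConsts.comp, ← hk]
      field_simp
      ring)
  refine ⟨R, hR, fun E => ⟨(h E).1.unique ((hQ.rel E).comp (hP.rel _)), fun z hz => ?_⟩⟩
  have hz' : T.onVar E z ∈ (S.onVar (T.onEq E)).source := by
    have := (T.onVar E).map_source hz
    rw [T.target_eq] at this
    rwa [S.source_eq]
  rw [(h E).2 z (by rw [R.source_eq, ← T.source_eq]; exact hz), Function.comp_apply,
    hP.onVar_eq _ hz', hQ.onVar_eq E hz, ← hl, ← hk]
  refine Prod.ext ?_ (Prod.ext ?_ ?_)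
  · exact GaugedConsts.time_comp _ _ _
  · simp only [GaugedConsts.comp]; ring
  · simp only [GaugedConsts.comp]; field_simp; ring

theorem exists_inverse_mem_gaugedGroup {T : EquivTransformation gaugedClass}
    (hT : T ∈ gaugedGroup) : ∃ R ∈ gaugedGroup, R.onEq = T.onEq.symm ∧
      ∀ E, Set.EqOn (R.onVar (T.onEq E)) (T.onVar E).symm (T.onVar E).target := by
  obtain ⟨Q, hQ⟩ := hT
  set l := Q.consts with hl
  have hl1 := l.β_ne_zero
  have hl2 := l.φ_ne_zero
  have hrel : ∀ E, l.inv.Rel (T.onEq E).1 E.1 := fun E => (hQ.rel E).symm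
  obtain ⟨R, hR, h⟩ := exists_mem_gaugedGroup l.inv
    -- Solving `x̃ = β x + γ(t)` for `x`, with the old time expressed through the new one and `γ`
    -- taken for the preimage equation.
    (fun E t => -(l.β⁻¹ * Q.γ (T.onEq.symm E) (l.inv.time t))) (fun E t ht => by
      obtain ⟨F, rfl⟩ := T.onEq.surjective E
      rw [(hQ.rel F).1, ← hl] at ht
      obtain ⟨s, hs, rfl⟩ := ht
      obtain ⟨-, -, c, f, -⟩ := (hQ.rel F).2 s hs
      have h1 := Q.hasDerivAt_γ F hs
      rw [Equiv.symm_apply_apply]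
      rw [← hl] at c f h1
      rw [← l.time_inv_time s] at h1
      have h2 := ((h1.comp (l.time s) (l.inv.hasDerivAt_time _)).const_mul l.β⁻¹).neg
      refine h2.congr_deriv ?_
      rw [c, f, l.time_inv_time]
      simp only [GaugedConsts.inv]
      field_simp
      ring)
  refine ⟨R, hR, Equiv.ext fun E => ?_, fun E z hz => ?_⟩
  · obtain ⟨F, rfl⟩ := T.onEq.surjective E
    rw [Equiv.symm_apply_apply]
    exact (h _).1.unique (hrel F)
  · have hz' : z ∈ (R.onVar (T.onEq E)).source := by rwa [R.source_eq, ← T.target_eq]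
    rw [(h _).2 z hz', Equiv.symm_apply_apply]
    obtain ⟨w, hw, rfl⟩ : ∃ w ∈ (T.onVar E).source, T.onVar E w = z :=
      ⟨_, (T.onVar E).map_target hz, (T.onVar E).right_inv hz⟩
    rw [(T.onVar E).left_inv hw, hQ.onVar_eq E hw, ← hl, l.time_inv_time]
    refine Prod.ext rfl (Prod.ext ?_ ?_)
    · simp only [GaugedConsts.inv]; field_simp; ring
    · simp only [GaugedConsts.inv]; field_simp; ring

/-! ### Images of graphs under point transformations -/

/-- The graph map of `u`. -/
def graphMap (u : ℝ × ℝ → ℝ) (r : ℝ × ℝ) : ℝ × ℝ × ℝ := (r.1, r.2, u r)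

/-- The new independent variables on the graph of `u`. -/
def baseMap (Φ : VarMap) (u : ℝ × ℝ → ℝ) (r : ℝ × ℝ) : ℝ × ℝ :=
  ((Φ (graphMap u r)).1, (Φ (graphMap u r)).2.1)

/-- The independent components of a vector. -/
def baseProj : (ℝ × ℝ × ℝ) →L[ℝ] ℝ × ℝ :=
  (ContinuousLinearMap.fst ℝ ℝ (ℝ × ℝ)).prod
    ((ContinuousLinearMap.fst ℝ ℝ ℝ).comp (ContinuousLinearMap.snd ℝ ℝ (ℝ × ℝ)))

/-- The dependent component of a vector. -/
def valProj : (ℝ × ℝ × ℝ) →L[ℝ] ℝ :=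
  (ContinuousLinearMap.snd ℝ ℝ ℝ).comp (ContinuousLinearMap.snd ℝ ℝ (ℝ × ℝ))

@[simp] theorem baseProj_apply (z : ℝ × ℝ × ℝ) : baseProj z = (z.1, z.2.1) := rfl

@[simp] theorem valProj_apply (z : ℝ × ℝ × ℝ) : valProj z = z.2.2 := rfl

theorem apply_mk_eq {F : Type*} [NormedAddCommGroup F] [NormedSpace ℝ F]
    (D : (ℝ × ℝ × ℝ) →L[ℝ] F) (x y z : ℝ) :
    D (x, y, z) = x • D (1, 0, 0) + y • D (0, 1, 0) + z • D (0, 0, 1) := by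
  rw [← map_smul, ← map_smul, ← map_smul, ← map_add, ← map_add]
  congr 1
  ext <;> simp

theorem contDiffAt_graphMap {u : ℝ × ℝ → ℝ} {p : ℝ × ℝ} (hu : ContDiffAt ℝ ∞ u p) :
    ContDiffAt ℝ ∞ (graphMap u) p := contDiffAt_fst.prodMk (contDiffAt_snd.prodMk hu)

theorem hasFDerivAt_graphMap {u : ℝ × ℝ → ℝ} {p : ℝ × ℝ} (hu : ContDiffAt ℝ ∞ u p) :
    HasFDerivAt (graphMap u) ((ContinuousLinearMap.fst ℝ ℝ ℝ).prod
      ((ContinuousLinearMap.snd ℝ ℝ ℝ).prod (fderiv ℝ u p))) p :=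
  hasFDerivAt_fst.prodMk (hasFDerivAt_snd.prodMk (hu.differentiableAt (by simp)).hasFDerivAt)

theorem IsPointTransformation.contDiffAt {Φ : VarMap} (hΦ : IsPointTransformation Φ)
    {z : ℝ × ℝ × ℝ} (hz : z ∈ Φ.source) : ContDiffAt ℝ ∞ Φ z :=
  hΦ.smooth.contDiffAt (Φ.open_source.mem_nhds hz)

theorem IsPointTransformation.hasFDerivAt {Φ : VarMap} (hΦ : IsPointTransformation Φ)
    {z : ℝ × ℝ × ℝ} (hz : z ∈ Φ.source) : HasFDerivAt Φ (fderiv ℝ Φ z) z :=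
  ((hΦ.contDiffAt hz).differentiableAt (by simp)).hasFDerivAt

theorem IsPointTransformation.fderiv_injective {Φ : VarMap} (hΦ : IsPointTransformation Φ)
    {z : ℝ × ℝ × ℝ} (hz : z ∈ Φ.source) : Function.Injective (fderiv ℝ Φ z) := by
  have hs : ContDiffAt ℝ ∞ Φ.symm (Φ z) :=
    hΦ.smooth_symm.contDiffAt (Φ.open_target.mem_nhds (Φ.map_source hz))
  have h1 : HasFDerivAt Φ.symm _ (Φ z) := (hs.differentiableAt (by simp)).hasFDerivAt
  have h2 := h1.comp z (hΦ.hasFDerivAt hz)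
  have h3 : HasFDerivAt (Φ.symm ∘ Φ) (ContinuousLinearMap.id ℝ _) z := by
    refine (hasFDerivAt_id z).congr_of_eventuallyEq ?_
    filter_upwards [Φ.open_source.mem_nhds hz] with w hw using Φ.left_inv hw
  have h4 := h2.unique h3
  intro x y hxy
  have := fun w => congrArg (fun L : (ℝ × ℝ × ℝ) →L[ℝ] _ => L w) h4
  simp only [ContinuousLinearMap.comp_apply, ContinuousLinearMap.id_apply] at this
  rw [← this x, ← this y, hxy]

theorem IsPointTransformation.hasFDerivAt_baseMap {Φ : VarMap} (hΦ : IsPointTransformation Φ)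
    {u : ℝ × ℝ → ℝ} {p : ℝ × ℝ} (hu : ContDiffAt ℝ ∞ u p) (hp : graphMap u p ∈ Φ.source) :
    HasFDerivAt (baseMap Φ u) (baseProj.comp ((fderiv ℝ Φ (graphMap u p)).comp
      ((ContinuousLinearMap.fst ℝ ℝ ℝ).prod ((ContinuousLinearMap.snd ℝ ℝ ℝ).prod
        (fderiv ℝ u p))))) p :=
  baseProj.hasFDerivAt.comp p ((hΦ.hasFDerivAt hp).comp p (hasFDerivAt_graphMap hu))

theorem IsPointTransformation.contDiffAt_baseMap {Φ : VarMap} (hΦ : IsPointTransformation Φ)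
    {u : ℝ × ℝ → ℝ} {p : ℝ × ℝ} (hu : ContDiffAt ℝ ∞ u p) (hp : graphMap u p ∈ Φ.source) :
    ContDiffAt ℝ ∞ (baseMap Φ u) p :=
  baseProj.contDiff.contDiffAt.comp p ((hΦ.contDiffAt hp).comp p (contDiffAt_graphMap hu))

/-- The graph of `u` is transversal: its image under `Φ` is the graph of a function near the image
of the point over `p`. -/
def Transversal (Φ : VarMap) (u : ℝ × ℝ → ℝ) (p : ℝ × ℝ) : Prop :=
  ∀ d : ℝ × ℝ, baseProj (fderiv ℝ Φ (graphMap u p) (d.1, d.2, fderiv ℝ u p d)) = 0 → d = 0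

/-- The hypothesis is the Jacobian determinant of the new independent variables along the graph,
`D_t T · D_x X - D_x T · D_t X`; Cramer's rule does the rest. -/
theorem transversal_of_ne_zero {Φ : VarMap} {u : ℝ × ℝ → ℝ} {p : ℝ × ℝ}
    (hu : ContDiffAt ℝ ∞ u p) {a b : ℝ} (ha : dt u p = a) (hb : dx 1 u p = b)
    {D : (ℝ × ℝ × ℝ) →L[ℝ] ℝ × ℝ × ℝ} (hD : fderiv ℝ Φ (graphMap u p) = D)
    (h : ((D (1, 0, 0)).1 + (D (0, 0, 1)).1 * a) * ((D (0, 1, 0)).2.1 + (D (0, 0, 1)).2.1 * b)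
      - ((D (0, 1, 0)).1 + (D (0, 0, 1)).1 * b) * ((D (1, 0, 0)).2.1 + (D (0, 0, 1)).2.1 * a)
        ≠ 0) : Transversal Φ u p := by
  intro d hd
  rw [hD, fderiv_apply_eq hu, ha, hb] at hd
  rw [apply_mk_eq D] at hd
  simp only [baseProj_apply, Prod.fst_add, Prod.snd_add, Prod.smul_fst, Prod.smul_snd,
    Prod.mk_eq_zero, smul_eq_mul] at hd
  obtain ⟨h1, h2⟩ := hd
  generalize (D (1, 0, 0)).1 = t1 at *
  generalize (D (0, 1, 0)).1 = t2 at *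
  generalize (D (0, 0, 1)).1 = t3 at *
  generalize (D (1, 0, 0)).2.1 = x1 at *
  generalize (D (0, 1, 0)).2.1 = x2 at *
  generalize (D (0, 0, 1)).2.1 = x3 at *
  refine Prod.ext ((mul_eq_zero.1 (?_ : _ * d.1 = 0)).resolve_left h)
    ((mul_eq_zero.1 (?_ : _ * d.2 = 0)).resolve_left h)
  · linear_combination (x2 + x3 * b) * h1 - (t2 + t3 * b) * h2
  · linear_combination (t1 + t3 * a) * h2 - (x1 + x3 * a) * h1

/-- The image of the graph of a transversal function under a point transformation is the graph of a
function. -/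
theorem IsPointTransformation.exists_image {Φ : VarMap} (hΦ : IsPointTransformation Φ)
    {u : ℝ × ℝ → ℝ} {p : ℝ × ℝ} (hu : ContDiffAt ℝ ∞ u p) (hp : graphMap u p ∈ Φ.source)
    (ht : Transversal Φ u p) :
    ∃ (v : ℝ × ℝ → ℝ) (B : ℝ × ℝ → ℝ × ℝ), ContDiffAt ℝ ∞ v (baseMap Φ u p) ∧
      ContDiffAt ℝ ∞ B (baseMap Φ u p) ∧ B (baseMap Φ u p) = p ∧
      (∀ᶠ y in 𝓝 (baseMap Φ u p), baseMap Φ u (B y) = y) ∧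
      (∀ᶠ r in 𝓝 p, v (baseMap Φ u r) = (Φ (graphMap u r)).2.2) := by
  have hd := hΦ.hasFDerivAt_baseMap hu hp
  set A := baseProj.comp ((fderiv ℝ Φ (graphMap u p)).comp
      ((ContinuousLinearMap.fst ℝ ℝ ℝ).prod ((ContinuousLinearMap.snd ℝ ℝ ℝ).prod
        (fderiv ℝ u p)))) with hA
  have hinj : Function.Injective A := (injective_iff_map_eq_zero A).2 fun d hd => ht d hd
  -- Transversality is injectivity of a linear endomorphism of the plane, so the inverse function
  -- theorem applies; `v` is the new dependent variable on the graph composed with the local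
  -- inverse.
  let A' : (ℝ × ℝ) ≃L[ℝ] ℝ × ℝ :=
    (LinearEquiv.ofInjectiveEndo (A : (ℝ × ℝ) →ₗ[ℝ] ℝ × ℝ) hinj).toContinuousLinearEquiv
  have hA' : (A' : (ℝ × ℝ) →L[ℝ] ℝ × ℝ) = A := by ext <;> rfl
  rw [← hA'] at hd
  have hs := hΦ.contDiffAt_baseMap hu hp
  have hst : HasStrictFDerivAt (baseMap Φ u) (A' : (ℝ × ℝ) →L[ℝ] ℝ × ℝ) p :=
    hs.hasStrictFDerivAt' hd (by simp)
  have hB : ContDiffAt ℝ ∞ (hst.localInverse (baseMap Φ u) A' p) (baseMap Φ u p) :=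
    hs.to_localInverse hd (by simp)
  have hBp : hst.localInverse (baseMap Φ u) A' p (baseMap Φ u p) = p := hst.localInverse_apply_image
  set B := hst.localInverse (baseMap Φ u) A' p
  refine ⟨fun y => (Φ (graphMap u (B y))).2.2, B, ?_, hB, hBp, hst.eventually_right_inverse, ?_⟩
  · have h1 : ContDiffAt ℝ ∞ (fun r => (Φ (graphMap u r)).2.2) (B (baseMap Φ u p)) := by
      rw [hBp]
      exact valProj.contDiff.contDiffAt.comp p ((hΦ.contDiffAt hp).comp p (contDiffAt_graphMap hu))
    exact h1.comp _ hB
  · filter_upwards [hst.eventually_left_inverse] with r hr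
    exact congrArg (fun s => (Φ (graphMap u s)).2.2) hr

theorem MapsEquation.holdsAt_iff {E E' : KdVEq} {Φ : VarMap} (h : MapsEquation E E' Φ)
    {u v : ℝ × ℝ → ℝ} {p : ℝ × ℝ} (hu : ContDiffAt ℝ ∞ u p) (hp : graphMap u p ∈ Φ.source)
    (hv : ContDiffAt ℝ ∞ v (baseMap Φ u p))
    (huv : ∀ᶠ r in 𝓝 p, v (baseMap Φ u r) = (Φ (graphMap u r)).2.2) :
    E.HoldsAt u p ↔ E'.HoldsAt v (baseMap Φ u p) := by
  refine h u v p _ hp hu hv ?_ huv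
  have := huv.self_of_nhds
  rw [this]
  rfl

/-! ### Perturbing a graph and comparing the image equations -/

/-- The change of the image of a graph under a perturbation of the graph. -/
theorem IsAdmissible.exists_perturbation {E E' : KdVEq} {Φ : VarMap} (h : IsAdmissible E E' Φ)
    {u w : ℝ × ℝ → ℝ} {p : ℝ × ℝ} (hu : ContDiffAt ℝ ∞ u p) (hw : ContDiffAt ℝ ∞ w p)
    (hwp : w p = 0) (hp : graphMap u p ∈ Φ.source) (ht : Transversal Φ u p)
    (ht' : Transversal Φ (fun r => u r + w r) p) (hE : E.HoldsAt u p)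
    (hE' : E.HoldsAt (fun r => u r + w r) p) :
    ∃ (v δ : ℝ × ℝ → ℝ) (B : ℝ × ℝ → ℝ × ℝ) (κ : ℝ), κ ≠ 0 ∧
      ContDiffAt ℝ ∞ v (baseMap Φ u p) ∧ ContDiffAt ℝ ∞ δ (baseMap Φ u p) ∧
      ContDiffAt ℝ ∞ B (baseMap Φ u p) ∧ B (baseMap Φ u p) = p ∧
      (∀ᶠ y in 𝓝 (baseMap Φ u p), baseMap Φ (fun r => u r + w r) (B y) = y) ∧
      ((fun y => δ y - κ * w (B y)) =o[𝓝 (baseMap Φ u p)] fun y => w (B y)) ∧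
      E'.HoldsAt v (baseMap Φ u p) ∧ E'.HoldsAt (fun y => v y + δ y) (baseMap Φ u p) := by
  have hΦ := h.isPointTransformation
  have hgm : graphMap (fun r => u r + w r) p = graphMap u p := by simp [graphMap, hwp]
  have hp' : graphMap (fun r => u r + w r) p ∈ Φ.source := hgm ▸ hp
  have hq : baseMap Φ (fun r => u r + w r) p = baseMap Φ u p := by simp only [baseMap, hgm]
  have hu' : ContDiffAt ℝ ∞ (fun r => u r + w r) p := hu.add hw
  obtain ⟨v, -, hv, -, -, -, hvu⟩ := hΦ.exists_image hu hp ht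
  obtain ⟨v', B, hv', hB, hBp, hBr, hvu'⟩ := hΦ.exists_image hu' hp' ht'
  have e1 := (h.maps.holdsAt_iff hu hp hv hvu).1 hE
  have e2 := (h.maps.holdsAt_iff hu' hp' hv' hvu').1 hE'
  rw [hq] at hv' hB hBp hBr e2
  -- Pulled-back defining function of the image graph: it vanishes on the graph of `u`, and on the
  -- graph of `u + w` it equals `v' - v` at the image point.
  let F : ℝ × ℝ × ℝ → ℝ := fun z => valProj (Φ z) - v (baseProj (Φ z))
  have hvz : ContDiffAt ℝ ∞ v (baseProj (Φ (graphMap u p))) := hv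
  have hFs : ContDiffAt ℝ ∞ F (graphMap u p) :=
    (valProj.contDiff.contDiffAt.comp (graphMap u p) (hΦ.contDiffAt hp)).sub
      (hvz.comp (graphMap u p)
        (baseProj.contDiff.contDiffAt.comp (graphMap u p) (hΦ.contDiffAt hp)))
  have hFd : HasFDerivAt F _ (graphMap u p) :=
    (valProj.hasFDerivAt.comp (graphMap u p) (hΦ.hasFDerivAt hp)).sub
      ((hvz.differentiableAt (by simp)).hasFDerivAt.comp (graphMap u p)
        (baseProj.hasFDerivAt.comp (graphMap u p) (hΦ.hasFDerivAt hp)))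
  have hFst := hFs.hasStrictFDerivAt' hFd (by simp)
  set F' := valProj.comp (fderiv ℝ Φ (graphMap u p)) -
    (fderiv ℝ v (baseProj (Φ (graphMap u p)))).comp
      (baseProj.comp (fderiv ℝ Φ (graphMap u p))) with hF'
  have hF0 : ∀ᶠ r in 𝓝 p, F (graphMap u r) = 0 := by
    filter_upwards [hvu] with r hr
    exact sub_eq_zero.2 hr.symm
  have hFu : ∀ d : ℝ × ℝ, F' (d.1, d.2, fderiv ℝ u p d) = 0 := by
    intro d
    have h1 := hFd.comp p (hasFDerivAt_graphMap hu)
    have h2 : HasFDerivAt (F ∘ graphMap u) (0 : (ℝ × ℝ) →L[ℝ] ℝ) p :=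
      (hasFDerivAt_const (0 : ℝ) p).congr_of_eventuallyEq hF0
    exact congrArg (fun L : (ℝ × ℝ) →L[ℝ] ℝ => L d) (h1.unique h2)
  -- If `F'` killed the vertical direction, transversality would supply a tangent vector of the
  -- graph with the same image under the differential of `Φ`. That differential is injective, so the
  -- vertical vector would be tangent to a graph.
  have hκ : F' (0, 0, 1) ≠ 0 := by
    intro h0
    let A := baseProj.comp ((fderiv ℝ Φ (graphMap u p)).comp
      ((ContinuousLinearMap.fst ℝ ℝ ℝ).prod ((ContinuousLinearMap.snd ℝ ℝ ℝ).prod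
        (fderiv ℝ u p))))
    have hinj : Function.Injective A := (injective_iff_map_eq_zero A).2 fun d hd => ht d hd
    obtain ⟨d, hd⟩ := (LinearMap.injective_iff_surjective (f := (A : (ℝ × ℝ) →ₗ[ℝ] ℝ × ℝ))).1 hinj
      (baseProj (fderiv ℝ Φ (graphMap u p) (0, 0, 1)))
    have hd : baseProj (fderiv ℝ Φ (graphMap u p) (d.1, d.2, fderiv ℝ u p d))
      = baseProj (fderiv ℝ Φ (graphMap u p) (0, 0, 1)) := hd
    have h1 := hFu d
    rw [← h0] at h1
    simp only [hF', sub_apply, ContinuousLinearMap.comp_apply, hd] at h1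
    have h2 := sub_left_inj.1 h1
    have h3 : fderiv ℝ Φ (graphMap u p) (d.1, d.2, fderiv ℝ u p d)
        = fderiv ℝ Φ (graphMap u p) (0, 0, 1) := by
      simp only [baseProj_apply, Prod.mk.injEq, valProj_apply] at hd h2
      exact Prod.ext hd.1 (Prod.ext hd.2 h2)
    have h4 := hΦ.fderiv_injective hp h3
    simp only [Prod.mk.injEq] at h4
    have h5 : d = 0 := Prod.ext h4.1 h4.2.1
    rw [h5] at h4
    simp at h4
  -- The two graphs differ vertically by `w`, so strict differentiability of `F` gives an error
  -- `o(w)`, better than `o` of the distance to `p`.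
  have hlo : (fun r => (v' (baseMap Φ (fun r => u r + w r) r) -
      v (baseMap Φ (fun r => u r + w r) r)) - F' (0, 0, 1) * w r) =o[𝓝 p] w := by
    have h1 := hFst.isLittleO
    have hc : Filter.Tendsto (fun r => (graphMap (fun r => u r + w r) r, graphMap u r)) (𝓝 p)
        (𝓝 (graphMap u p, graphMap u p)) := by
      have c1 := (contDiffAt_graphMap hu').continuousAt
      have c2 := (contDiffAt_graphMap hu).continuousAt
      have := c1.tendsto.prodMk_nhds c2.tendsto
      rwa [hgm] at this
    have h2 := h1.comp_tendsto hc
    have hsub : ∀ r, graphMap (fun r => u r + w r) r - graphMap u r = w r • (0, 0, 1) := by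
      intro r; simp [graphMap]
    simp only [Function.comp_def, hsub] at h2
    have h3 : (fun r => w r • ((0, 0, 1) : ℝ × ℝ × ℝ)) =O[𝓝 p] w := by
      refine Asymptotics.IsBigO.of_bound 1 (Filter.Eventually.of_forall fun r => ?_)
      simp [Prod.norm_def]
    refine (h2.trans_isBigO h3).congr' ?_ Filter.EventuallyEq.rfl
    filter_upwards [hF0, hvu'] with r hr hr'
    rw [hr, map_smul, smul_eq_mul, sub_zero, hr', mul_comm]
    rfl
  refine ⟨v, fun y => v' y - v y, B, F' (0, 0, 1), hκ, hv, hv'.sub hv, hB, hBp, hBr, ?_, e1, ?_⟩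
  · have hB' : Filter.Tendsto B (𝓝 (baseMap Φ u p)) (𝓝 p) := by
      have := hB.continuousAt.tendsto
      rwa [hBp] at this
    refine (hlo.comp_tendsto hB').congr' ?_ Filter.EventuallyEq.rfl
    filter_upwards [hBr] with y hy
    simp only [Function.comp_apply, hy]
  · simpa only [add_sub_cancel] using e2

/-- The function with prescribed derivatives at `p`. -/
noncomputable def jet (p : ℝ × ℝ) (a : ℝ) (b : ℕ → ℝ) (r : ℝ × ℝ) : ℝ :=
  a * (r.1 - p.1) + ∑ j ∈ Finset.range 6, b j * (r.2 - p.2) ^ j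

theorem contDiff_jet (p : ℝ × ℝ) (a : ℝ) (b : ℕ → ℝ) : ContDiff ℝ ∞ (jet p a b) := by
  unfold jet; fun_prop

theorem dt_jet (p : ℝ × ℝ) (a : ℝ) (b : ℕ → ℝ) : dt (jet p a b) p = a := by
  simp [dt, jet]

theorem dx_jet (p : ℝ × ℝ) (a : ℝ) (b : ℕ → ℝ) {i : ℕ} (hi : i < 6) :
    dx i (jet p a b) p = i.factorial * b i := by
  simp only [dx, jet, sub_self, mul_zero, zero_add]
  rw [iteratedDeriv_fun_sum fun j _ => by fun_prop]
  have h (j : ℕ) : iteratedDeriv i (fun y : ℝ => b j * (y - p.2) ^ j) p.2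
      = if i = j then i.factorial * b i else 0 := by
    rw [iteratedDeriv_const_mul_sub_pow]
    split_ifs with hij
    · subst hij; ring
    · rfl
  simp only [h, Finset.sum_ite_eq, Finset.mem_range, hi, if_true]

theorem jet_self (p : ℝ × ℝ) (a : ℝ) (b : ℕ → ℝ) : jet p a b p = b 0 := by
  simp [jet, Finset.sum_range_succ]

theorem KdVEq.holdsAt_iff_of_mem {E : KdVEq} (hE : E ∈ gaugedClass) {u : ℝ × ℝ → ℝ} {p : ℝ × ℝ}
    (hp : p.1 ∈ E.I) : E.HoldsAt u p ↔ dt u p + E.a p.1 * u p * dx 3 u p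
      + E.b p.1 * dx 1 u p * dx 2 u p + E.c p.1 * (u p) ^ 2 * dx 1 u p + E.f p.1 * u p * dx 1 u p
      + dx 5 u p + E.h p.1 * dx 3 u p = 0 := by
  obtain ⟨hg, hm, hn, hk⟩ := hE p.1 hp
  rw [KdVEq.HoldsAt, hg, hm, hn, hk]
  simp only [one_mul, zero_mul, add_zero]

theorem pow_sub_isLittleO {f : ℝ → ℝ} {c x₀ : ℝ}
    (h : (fun x => f x - c * (x - x₀)) =o[𝓝 x₀] fun x => x - x₀) (n : ℕ) (hn : n ≠ 0) :
    (fun x => f x ^ n - c ^ n * (x - x₀) ^ n) =o[𝓝 x₀] fun x => (x - x₀) ^ n := by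
  have hO : f =O[𝓝 x₀] fun x => x - x₀ := by
    have := h.isBigO.add ((Asymptotics.isBigO_refl (fun x => x - x₀) (𝓝 x₀)).const_mul_left c)
    simpa using this
  induction n with
  | zero => exact absurd rfl hn
  | succ n ih =>
    rcases Nat.eq_zero_or_pos n with rfl | hpos
    · simpa using h
    · have h1 := (ih hpos.ne').mul_isBigO hO
      have h2 := ((Asymptotics.isBigO_refl (fun x => (x - x₀) ^ n) (𝓝 x₀)).const_mul_left
        (c ^ n)).mul_isLittleO h
      have h3 := h1.add (by simpa [pow_succ] using h2)
      refine h3.congr' (Filter.Eventually.of_forall fun x => ?_)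
        (Filter.Eventually.of_forall fun x => ?_)
      · simp only; ring
      · simp only [pow_succ]

theorem sub_mul_isLittleO_of_curve {δ w : ℝ × ℝ → ℝ} {q : ℝ × ℝ} {κ c s₀ : ℝ} {n : ℕ}
    {g : ℝ → ℝ × ℝ} (hg : Filter.Tendsto g (𝓝 s₀) (𝓝 q))
    (h : (fun y => δ y - κ * w y) =o[𝓝 q] w)
    (hw : (fun s => w (g s) - c * (s - s₀) ^ n) =o[𝓝 s₀] fun s => (s - s₀) ^ n) :
    (fun s => δ (g s) - κ * c * (s - s₀) ^ n) =o[𝓝 s₀] fun s => (s - s₀) ^ n := by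
  have h1 := h.comp_tendsto hg
  have hO : (w ∘ g) =O[𝓝 s₀] fun s => (s - s₀) ^ n := by
    have := hw.isBigO.add
      ((Asymptotics.isBigO_refl (fun s => (s - s₀) ^ n) (𝓝 s₀)).const_mul_left c)
    simp only [sub_add_cancel] at this
    exact this
  have h2 := (h1.trans_isBigO hO).add (hw.const_mul_left κ)
  refine h2.congr' (Filter.Eventually.of_forall fun s => ?_) Filter.EventuallyEq.rfl
  simp only [Function.comp_apply]; ring

/-- A perturbation of order five in `x` leaves `v` and its `x`-derivatives up to order four
unchanged at `q`. All nonlinear terms cancel on subtraction, and `g = 1` leaves `δ_t + δ_xxxxx`; the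
number `120` is `5!`. -/
theorem perturbation_relation {E : KdVEq} (hE : E ∈ gaugedClass) {v δ : ℝ × ℝ → ℝ} {q : ℝ × ℝ}
    (hq : q.1 ∈ E.I) (hv : ContDiffAt ℝ ∞ v q) (hδ : ContDiffAt ℝ ∞ δ q) {c : ℝ}
    (hx : (fun ξ => δ (q.1, ξ) - c * (ξ - q.2) ^ 5) =o[𝓝 q.2] fun ξ => (ξ - q.2) ^ 5)
    (h : E.HoldsAt v q) (h' : E.HoldsAt (fun y => v y + δ y) q) : dt δ q + c * 120 = 0 := by
  have hi : ContDiffAt ℝ ∞ (fun y : ℝ => (q.1, y)) q.2 := by fun_prop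
  have hd := iteratedDeriv_of_sub_isLittleO (contDiffAt_of_infty (hδ.comp q.2 hi) 5) hx
  have d0 : δ q = 0 := hd 0 (by norm_num)
  have d1 : dx 1 δ q = 0 := hd 1 (by norm_num)
  have d2 : dx 2 δ q = 0 := hd 2 (by norm_num)
  have d3 : dx 3 δ q = 0 := hd 3 (by norm_num)
  have d5 : dx 5 δ q = c * 120 := (hd 5 le_rfl).trans (by simp [Nat.factorial])
  rw [KdVEq.holdsAt_iff_of_mem hE hq] at h h'
  simp only [dx_add hv hδ, dt_add hv hδ, d0, d1, d2, d3, d5, add_zero] at h'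
  linarith

/-- Since `δ` is `κ w∘B` to leading order and `κ ≠ 0`, the linear relation for `δ` passes to `w∘B`,
which is explicit. This is the tool that constrains `T` and `X`. -/
theorem IsAdmissible.exists_inverse_of_perturbation {E E' : KdVEq} (hE₁ : E' ∈ gaugedClass)
    {Φ : VarMap} (h : IsAdmissible E E' Φ)
    {u w : ℝ × ℝ → ℝ} {p : ℝ × ℝ} (hu : ContDiffAt ℝ ∞ u p) (hw : ContDiffAt ℝ ∞ w p)
    (hwp : w p = 0) (hp : graphMap u p ∈ Φ.source) (ht : Transversal Φ u p)
    (ht' : Transversal Φ (fun r => u r + w r) p) (hE : E.HoldsAt u p)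
    (hE' : E.HoldsAt (fun r => u r + w r) p) :
    ∃ B : ℝ × ℝ → ℝ × ℝ, ContDiffAt ℝ ∞ B (baseMap Φ u p) ∧ B (baseMap Φ u p) = p ∧
      (∀ᶠ y in 𝓝 (baseMap Φ u p), baseMap Φ (fun r => u r + w r) (B y) = y) ∧
      ∀ c₁ c₅ : ℝ, HasDerivAt (fun η => w (B (η, (baseMap Φ u p).2))) c₁ (baseMap Φ u p).1 →
        ((fun ξ => w (B ((baseMap Φ u p).1, ξ)) - c₅ * (ξ - (baseMap Φ u p).2) ^ 5)
          =o[𝓝 (baseMap Φ u p).2] fun ξ => (ξ - (baseMap Φ u p).2) ^ 5) → c₁ + c₅ * 120 = 0 := by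
  obtain ⟨v, δ, B, κ, hκ, hv, hδ, hB, hBp, hBr, hlo, e1, e2⟩ :=
    h.exists_perturbation hu hw hwp hp ht ht' hE hE'
  have hqI : (baseMap Φ u p).1 ∈ E'.I := h.target_subset _ (Φ.map_source hp)
  refine ⟨B, hB, hBp, hBr, fun c₁ c₅ h1 h5 => ?_⟩
  set q := baseMap Φ u p
  have g1 : ContDiffAt ℝ ∞ (fun η : ℝ => (η, q.2)) q.1 := by fun_prop
  have g2 : ContDiffAt ℝ ∞ (fun ξ : ℝ => (q.1, ξ)) q.2 := by fun_prop
  have hx := sub_mul_isLittleO_of_curve (w := fun y => w (B y)) g2.continuousAt.tendsto hlo h5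
  have h1' : (fun η => w (B (η, q.2)) - c₁ * (η - q.1) ^ 1) =o[𝓝 q.1] fun η => (η - q.1) ^ 1 := by
    have := h1.isLittleO
    have hz : w (B (q.1, q.2)) = 0 := by rw [Prod.mk.eta, hBp, hwp]
    simpa [hz, mul_comm] using this
  have ht := sub_mul_isLittleO_of_curve (w := fun y => w (B y)) g1.continuousAt.tendsto hlo h1'
  have hdt := iteratedDeriv_of_sub_isLittleO (contDiffAt_of_infty (hδ.comp q.1 g1) 1) ht 1 le_rfl
  have hdt : dt δ q = κ * c₁ := by
    rw [iteratedDeriv_one] at hdt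
    exact hdt.trans (by simp)
  have := perturbation_relation hE₁ hqI hv hδ hx e1 e2
  rw [hdt] at this
  have h3 : κ * (c₁ + c₅ * 120) = 0 := by linarith
  exact (mul_eq_zero.1 h3).resolve_left hκ

theorem IsPointTransformation.fderiv_rightInverse {Φ : VarMap} (hΦ : IsPointTransformation Φ)
    {u : ℝ × ℝ → ℝ} {q : ℝ × ℝ} {B : ℝ × ℝ → ℝ × ℝ} (hB : ContDiffAt ℝ ∞ B q)
    (hu : ContDiffAt ℝ ∞ u (B q)) (hp : graphMap u (B q) ∈ Φ.source)
    (hBr : ∀ᶠ y in 𝓝 q, baseMap Φ u (B y) = y) (d : ℝ × ℝ) :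
    baseProj (fderiv ℝ Φ (graphMap u (B q))
      ((fderiv ℝ B q d).1, (fderiv ℝ B q d).2, fderiv ℝ u (B q) (fderiv ℝ B q d))) = d := by
  have h1 := (hΦ.hasFDerivAt_baseMap hu hp).comp q (hB.differentiableAt (by simp)).hasFDerivAt
  have h2 : HasFDerivAt (baseMap Φ u ∘ B) (ContinuousLinearMap.id ℝ _) q :=
    (hasFDerivAt_id q).congr_of_eventuallyEq hBr
  exact congrArg (fun L : (ℝ × ℝ) →L[ℝ] ℝ × ℝ => L d) (h1.unique h2)

/-! ### The new time depends on the old time only -/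

/-- Provides a slope `b = u_x` and a velocity `a = u_t` for which the graph is transversal and `T_x
+ b T_u ≠ 0`. If `m₃ = 0`, each condition excludes at most one `b`, so one of three values works;
otherwise `a` is solved for so that the first expression equals `1`. -/
theorem exists_add_mul_ne_zero {m₁ m₂ m₃ n₁ n₂ : ℝ} (hm : m₁ ≠ 0 ∨ m₂ ≠ 0 ∨ m₃ ≠ 0)
    (hn : n₁ ≠ 0 ∨ n₂ ≠ 0) : ∃ b a : ℝ, m₁ + b * m₂ + a * m₃ ≠ 0 ∧ n₁ + b * n₂ ≠ 0 := by
  by_cases h3 : m₃ = 0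
  · subst h3
    by_contra! H
    have h0 := H 0 0
    have h1 := H 1 0
    have h2 := H 2 0
    grind
  · obtain ⟨b, hb⟩ : ∃ b : ℝ, n₁ + b * n₂ ≠ 0 := by
      rcases eq_or_ne n₁ 0 with h | h
      · exact ⟨1, by simpa [h] using hn⟩
      · exact ⟨0, by simpa using h⟩
    refine ⟨b, (1 - m₁ - b * m₂) / m₃, ?_, hb⟩
    rw [div_mul_cancel₀ _ h3]
    ring_nf
    norm_num

/-- The rows of `T` and `X` in an invertible matrix are independent. The three minors are the
coefficients of `1`, `u_x` and `u_t` in the Jacobian determinant along a graph. -/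
theorem exists_minor_ne_zero {D : (ℝ × ℝ × ℝ) →L[ℝ] ℝ × ℝ × ℝ} (hD : Function.Injective D) :
    (D (1, 0, 0)).1 * (D (0, 1, 0)).2.1 - (D (0, 1, 0)).1 * (D (1, 0, 0)).2.1 ≠ 0 ∨
    (D (1, 0, 0)).1 * (D (0, 0, 1)).2.1 - (D (0, 0, 1)).1 * (D (1, 0, 0)).2.1 ≠ 0 ∨
    (D (0, 0, 1)).1 * (D (0, 1, 0)).2.1 - (D (0, 1, 0)).1 * (D (0, 0, 1)).2.1 ≠ 0 := by
  have hs := (LinearMap.injective_iff_surjective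
    (f := (D : (ℝ × ℝ × ℝ) →ₗ[ℝ] ℝ × ℝ × ℝ))).1 hD
  obtain ⟨⟨a, b, c⟩, h⟩ := hs (1, 0, 0)
  obtain ⟨⟨a', b', c'⟩, h'⟩ := hs (0, 1, 0)
  have h : D (a, b, c) = (1, 0, 0) := h
  have h' : D (a', b', c') = (0, 1, 0) := h'
  rw [apply_mk_eq D] at h h'
  have e1 := congrArg Prod.fst h
  have e2 := congrArg (fun z => z.2.1) h
  have e3 := congrArg Prod.fst h'
  have e4 := congrArg (fun z => z.2.1) h'
  simp only [Prod.fst_add, Prod.snd_add, Prod.smul_fst, Prod.smul_snd, smul_eq_mul] at e1 e2 e3 e4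
  generalize (D (1, 0, 0)).1 = t1 at *
  generalize (D (0, 1, 0)).1 = t2 at *
  generalize (D (0, 0, 1)).1 = t3 at *
  generalize (D (1, 0, 0)).2.1 = x1 at *
  generalize (D (0, 1, 0)).2.1 = x2 at *
  generalize (D (0, 0, 1)).2.1 = x3 at *
  by_contra! H
  obtain ⟨H1, H2, H3⟩ := H
  have : (1 : ℝ) = 0 := by
    -- The left side is a `2 × 2` determinant which, by the Cauchy–Binet formula, is a combination
    -- of the three minors.
    have k1 : (a * t1 + b * t2 + c * t3) * (a' * x1 + b' * x2 + c' * x3)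
        - (a' * t1 + b' * t2 + c' * t3) * (a * x1 + b * x2 + c * x3) = 1 := by
      rw [e1, e2, e3, e4]; ring
    linear_combination -k1 + (a * b' - a' * b) * H1 + (a * c' - a' * c) * H2
      + (c * b' - c' * b) * H3
  exact one_ne_zero this

theorem fderiv_eq_of_hasDerivAt_curve {B : ℝ × ℝ → ℝ × ℝ} {q : ℝ × ℝ} (hB : ContDiffAt ℝ ∞ B q) :
    HasDerivAt (fun η => B (η, q.2)) (fderiv ℝ B q (1, 0)) q.1 ∧
      HasDerivAt (fun ξ => B (q.1, ξ)) (fderiv ℝ B q (0, 1)) q.2 := by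
  have h1 : HasFDerivAt B (fderiv ℝ B q) (q.1, q.2) :=
    (hB.differentiableAt (by simp)).hasFDerivAt
  exact ⟨h1.comp_hasDerivAt q.1 ((hasDerivAt_id q.1).prodMk (hasDerivAt_const _ _)),
    h1.comp_hasDerivAt q.2 ((hasDerivAt_const _ _).prodMk (hasDerivAt_id q.2))⟩

/-- The new time variable depends only on the old one. -/
theorem IsAdmissible.fderiv_time {E E' : KdVEq} (hE : E ∈ gaugedClass) (hE' : E' ∈ gaugedClass)
    {Φ : VarMap} (h : IsAdmissible E E' Φ) {z : ℝ × ℝ × ℝ} (hz : z ∈ Φ.source) :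
    (fderiv ℝ Φ z (0, 1, 0)).1 = 0 ∧ (fderiv ℝ Φ z (0, 0, 1)).1 = 0 := by
  by_contra hn
  have hn : (fderiv ℝ Φ z (0, 1, 0)).1 ≠ 0 ∨ (fderiv ℝ Φ z (0, 0, 1)).1 ≠ 0 := by
    by_contra! H; exact hn H
  have hΦ := h.isPointTransformation
  obtain ⟨b, a, hm, hb⟩ :=
    exists_add_mul_ne_zero (exists_minor_ne_zero (hΦ.fderiv_injective hz)) hn
  set p : ℝ × ℝ := (z.1, z.2.1) with hp
  have hzI : p.1 ∈ E.I := h.source_subset z hz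
  -- The fifth-order coefficient is solved from the equation, leaving `u_t = a` and `u_x = b` free.
  let cf : ℕ → ℝ := fun j => match j with
    | 0 => z.2.2
    | 1 => b
    | 5 => -(a + E.c p.1 * z.2.2 ^ 2 * b + E.f p.1 * z.2.2 * b) / 120
    | _ => 0
  set u := jet p a cf with hudef
  -- This perturbation changes no derivative occurring in the equation. Its composite with `B` would
  -- be of exact order five in the new `x` if the old time varied along the new `x`-axis.
  let w : ℝ × ℝ → ℝ := fun r => (r.1 - p.1) ^ 5
  have hu : ContDiffAt ℝ ∞ u p := (contDiff_jet _ _ _).contDiffAt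
  have hw : ContDiffAt ℝ ∞ w p := by fun_prop
  have up : u p = z.2.2 := jet_self _ _ _
  have ut : dt u p = a := dt_jet _ _ _
  have u1 : dx 1 u p = b := by rw [hudef, dx_jet _ _ _ (by norm_num)]; simp [cf]
  have u2 : dx 2 u p = 0 := by rw [hudef, dx_jet _ _ _ (by norm_num)]; simp [cf]
  have u3 : dx 3 u p = 0 := by rw [hudef, dx_jet _ _ _ (by norm_num)]; simp [cf]
  have u5 : dx 5 u p = -(a + E.c p.1 * z.2.2 ^ 2 * b + E.f p.1 * z.2.2 * b) := by
    rw [hudef, dx_jet _ _ _ (by norm_num)]; simp [cf, Nat.factorial]; ring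
  have wt : dt w p = 0 := by simp [dt, w]
  have wx (j : ℕ) : dx j w p = 0 := by simp [dx, w]
  have wp : w p = 0 := by simp [w]
  have hg : graphMap u p = z := by rw [graphMap, up]
  have hg' : graphMap (fun r => u r + w r) p = z := by rw [graphMap, up, wp, add_zero]
  have hH : E.HoldsAt u p := by
    rw [KdVEq.holdsAt_iff_of_mem hE hzI, up, ut, u1, u2, u3, u5]; ring
  have hH' : E.HoldsAt (fun r => u r + w r) p := by
    rw [KdVEq.holdsAt_iff_of_mem hE hzI]
    simp only [dx_add hu hw, dt_add hu hw, up, ut, u1, u2, u3, u5, wt, wx, wp]; ring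
  have hdet : ((fderiv ℝ Φ z (1, 0, 0)).1 + (fderiv ℝ Φ z (0, 0, 1)).1 * a) *
      ((fderiv ℝ Φ z (0, 1, 0)).2.1 + (fderiv ℝ Φ z (0, 0, 1)).2.1 * b)
      - ((fderiv ℝ Φ z (0, 1, 0)).1 + (fderiv ℝ Φ z (0, 0, 1)).1 * b) *
      ((fderiv ℝ Φ z (1, 0, 0)).2.1 + (fderiv ℝ Φ z (0, 0, 1)).2.1 * a) ≠ 0 := by
    convert hm using 1; ring
  have hT : Transversal Φ u p := transversal_of_ne_zero hu ut u1 (by rw [hg]) hdet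
  have ut' : dt (fun r => u r + w r) p = a := by rw [dt_add hu hw, ut, wt, add_zero]
  have u1' : dx 1 (fun r => u r + w r) p = b := by rw [dx_add hu hw, u1, wx, add_zero]
  have hT' : Transversal Φ (fun r => u r + w r) p :=
    transversal_of_ne_zero (hu.add hw) ut' u1' (by rw [hg']) hdet
  obtain ⟨B, hB, hBp, hBr, hrel⟩ := h.exists_inverse_of_perturbation hE' hu hw wp
    (hg ▸ hz) hT hT' hH hH'
  set q := baseMap Φ u p
  obtain ⟨k1, k2⟩ := fderiv_eq_of_hasDerivAt_curve hB
  have e0 : B (q.1, q.2) = p := hBp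
  have r1 : HasDerivAt (fun η => w (B (η, q.2))) 0 q.1 := by
    have k : HasDerivAt (fun η => (B (η, q.2)).1) _ q.1 := hasFDerivAt_fst.comp_hasDerivAt q.1 k1
    refine ((k.sub_const p.1).fun_pow 5).congr_deriv ?_
    simp [e0]
  have r5 : (fun ξ => w (B (q.1, ξ)) - (fderiv ℝ B q (0, 1)).1 ^ 5 * (ξ - q.2) ^ 5)
      =o[𝓝 q.2] fun ξ => (ξ - q.2) ^ 5 := by
    refine pow_sub_isLittleO ?_ 5 (by norm_num)
    have k : HasDerivAt (fun ξ => (B (q.1, ξ)).1) _ q.2 := hasFDerivAt_fst.comp_hasDerivAt q.2 k2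
    simpa [e0, mul_comm] using (k.sub_const p.1).isLittleO
  have hj := hrel _ _ r1 r5
  have hj0 : (fderiv ℝ B q (0, 1)).1 = 0 := by
    have : (fderiv ℝ B q (0, 1)).1 ^ 5 = 0 := by linarith
    exact pow_eq_zero_iff (by norm_num) |>.1 this
  have hq := hΦ.fderiv_rightInverse hB (u := fun r => u r + w r) (by rw [hBp]; exact hu.add hw)
    (by rw [hBp, hg']; exact hz) hBr (0, 1)
  rw [hBp, hg', fderiv_apply_eq (hu.add hw), ut', u1', apply_mk_eq (fderiv ℝ Φ z), hj0] at hq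
  simp only [baseProj_apply, Prod.fst_add, Prod.snd_add, Prod.smul_fst, Prod.smul_snd,
    Prod.mk.injEq, smul_eq_mul] at hq
  obtain ⟨q1, q2⟩ := hq
  have q3 : (fderiv ℝ B q (0, 1)).2 ≠ 0 := by
    intro h0
    rw [h0] at q2
    simp at q2
  apply hb
  -- With the old time stationary along the new `x`-direction, the image of that direction has time
  -- component `(T_x + b T_u)` times a nonzero number, and this must be zero.
  refine (mul_eq_zero.1 (?_ : (fderiv ℝ B q (0, 1)).2 * _ = 0)).resolve_left q3
  linear_combination q1

/-! ### The new space variable is affine in `x` and independent of `u` -/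

/-- Balls of the product are products of balls, so slices at fixed `t` are convex and a vanishing
`(x, u)`-gradient makes `f` constant on them. -/
theorem eq_of_fderiv_eq_zero_of_mem_ball {f : ℝ × ℝ × ℝ → ℝ} {z₀ : ℝ × ℝ × ℝ} {ε : ℝ}
    (hf : ∀ z ∈ Metric.ball z₀ ε, DifferentiableAt ℝ f z)
    (hx : ∀ z ∈ Metric.ball z₀ ε, fderiv ℝ f z (0, 1, 0) = 0)
    (hu : ∀ z ∈ Metric.ball z₀ ε, fderiv ℝ f z (0, 0, 1) = 0)
    {z : ℝ × ℝ × ℝ} (hz : z ∈ Metric.ball z₀ ε) : f z = f (z.1, z₀.2) := by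
  have hb : ∀ y : ℝ × ℝ, (z.1, y) ∈ Metric.ball z₀ ε ↔ y ∈ Metric.ball z₀.2 ε := by
    intro y
    have h1 : z.1 ∈ Metric.ball z₀.1 ε := by
      rw [← Prod.mk.eta (p := z₀), ← ball_prod_same] at hz
      exact hz.1
    rw [← Prod.mk.eta (p := z₀), ← ball_prod_same, Set.mem_prod]
    exact and_iff_right h1
  have hd : ∀ y ∈ Metric.ball z₀.2 ε, HasFDerivAt (fun y : ℝ × ℝ => f (z.1, y)) (0 : (ℝ × ℝ) →L[ℝ] ℝ) y := by
    intro y hy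
    have h1 := (hf _ ((hb y).2 hy)).hasFDerivAt.comp y
      ((hasFDerivAt_const z.1 y).prodMk (hasFDerivAt_id y))
    refine h1.congr_fderiv ?_
    ext
    · simpa using hx _ ((hb y).2 hy)
    · simpa using hu _ ((hb y).2 hy)
  have hz2 : z.2 ∈ Metric.ball z₀.2 ε := (hb z.2).1 hz
  have hε : 0 < ε := dist_nonneg.trans_lt (Metric.mem_ball.1 hz)
  exact Metric.isOpen_ball.is_const_of_fderiv_eq_zero (𝕜 := ℝ)
    (convex_ball z₀.2 ε).isPreconnected
    (fun y hy => (hd y hy).differentiableAt.differentiableWithinAt)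
    (fun y hy => (hd y hy).fderiv) hz2 (Metric.mem_ball_self hε)

theorem IsPointTransformation.fderiv_fst {Φ : VarMap} (hΦ : IsPointTransformation Φ)
    {z : ℝ × ℝ × ℝ} (hz : z ∈ Φ.source) (d : ℝ × ℝ × ℝ) :
    fderiv ℝ (fun z => (Φ z).1) z d = (fderiv ℝ Φ z d).1 := by
  rw [(hΦ.hasFDerivAt hz).fst.fderiv]
  rfl

theorem IsPointTransformation.fderiv_snd_fst {Φ : VarMap} (hΦ : IsPointTransformation Φ)
    {z : ℝ × ℝ × ℝ} (hz : z ∈ Φ.source) (d : ℝ × ℝ × ℝ) :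
    fderiv ℝ (fun z => (Φ z).2.1) z d = (fderiv ℝ Φ z d).2.1 := by
  rw [(hΦ.hasFDerivAt hz).snd.fst.fderiv]
  rfl

theorem IsPointTransformation.fderiv_snd_snd {Φ : VarMap} (hΦ : IsPointTransformation Φ)
    {z : ℝ × ℝ × ℝ} (hz : z ∈ Φ.source) (d : ℝ × ℝ × ℝ) :
    fderiv ℝ (fun z => (Φ z).2.2) z d = (fderiv ℝ Φ z d).2.2 := by
  rw [(hΦ.hasFDerivAt hz).snd.snd.fderiv]
  rfl

/-- The new space variable does not depend on `u` and depends on `x` affinely. -/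
theorem IsAdmissible.fderiv_space {E E' : KdVEq} (hE : E ∈ gaugedClass) (hE' : E' ∈ gaugedClass)
    {Φ : VarMap} (h : IsAdmissible E E' Φ) {z : ℝ × ℝ × ℝ} (hz : z ∈ Φ.source) :
    (fderiv ℝ Φ z (0, 0, 1)).2.1 = 0 ∧
      (fderiv ℝ Φ z (0, 1, 0)).2.1 ^ 5 = (fderiv ℝ Φ z (1, 0, 0)).1 := by
  have hΦ := h.isPointTransformation
  obtain ⟨hTx, hTu⟩ := h.fderiv_time hE hE' hz
  have hm := exists_minor_ne_zero (hΦ.fderiv_injective hz)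
  rw [hTx, hTu] at hm
  have hTt : (fderiv ℝ Φ z (1, 0, 0)).1 ≠ 0 := fun h0 => by simp [h0] at hm
  have hX : (fderiv ℝ Φ z (0, 1, 0)).2.1 ≠ 0 ∨ (fderiv ℝ Φ z (0, 0, 1)).2.1 ≠ 0 := by
    by_contra! H; simp [H] at hm
  suffices key : ∀ b : ℝ, (fderiv ℝ Φ z (0, 1, 0)).2.1 + (fderiv ℝ Φ z (0, 0, 1)).2.1 * b ≠ 0 →
      ((fderiv ℝ Φ z (0, 1, 0)).2.1 + (fderiv ℝ Φ z (0, 0, 1)).2.1 * b) ^ 5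
        = (fderiv ℝ Φ z (1, 0, 0)).1 by
    have h0 : (fderiv ℝ Φ z (0, 0, 1)).2.1 = 0 := by
      by_contra hne
      -- If `X_u ≠ 0`, the expression `X_x + b X_u` takes every nonzero value `s`; the values `1`
      -- and `2` give different fifth powers.
      have k (s : ℝ) (hs : s ≠ 0) : s ^ 5 = (fderiv ℝ Φ z (1, 0, 0)).1 := by
        have := key ((s - (fderiv ℝ Φ z (0, 1, 0)).2.1) / (fderiv ℝ Φ z (0, 0, 1)).2.1)
        rw [mul_div_cancel₀ _ hne, add_sub_cancel] at this
        exact this hs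
      have k1 := k 1 one_ne_zero
      have k2 := k 2 two_ne_zero
      norm_num [← k1] at k2
    refine ⟨h0, ?_⟩
    have := key 0
    rw [mul_zero, add_zero] at this
    exact this (hX.resolve_right (by simp [h0]))
  intro b hb
  set p : ℝ × ℝ := (z.1, z.2.1) with hp
  have hzI : p.1 ∈ E.I := h.source_subset z hz
  let a : ℝ := -(E.c p.1 * z.2.2 ^ 2 * b + E.f p.1 * z.2.2 * b)
  let cf : ℕ → ℝ := fun j => match j with
    | 0 => z.2.2
    | 1 => b
    | _ => 0
  -- Together with `w_t = 1` this makes `w_t + w_xxxxx = 0`, so adding `w` preserves the equation at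
  -- `p`.
  let cw : ℕ → ℝ := fun j => match j with
    | 5 => -1 / 120
    | _ => 0
  set u := jet p a cf with hudef
  set w := jet p 1 cw with hwdef
  have hu : ContDiffAt ℝ ∞ u p := (contDiff_jet _ _ _).contDiffAt
  have hw : ContDiffAt ℝ ∞ w p := (contDiff_jet _ _ _).contDiffAt
  have up : u p = z.2.2 := jet_self _ _ _
  have ut : dt u p = a := dt_jet _ _ _
  have u1 : dx 1 u p = b := by rw [hudef, dx_jet _ _ _ (by norm_num)]; simp [cf]
  have u2 : dx 2 u p = 0 := by rw [hudef, dx_jet _ _ _ (by norm_num)]; simp [cf]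
  have u3 : dx 3 u p = 0 := by rw [hudef, dx_jet _ _ _ (by norm_num)]; simp [cf]
  have u5 : dx 5 u p = 0 := by rw [hudef, dx_jet _ _ _ (by norm_num)]; simp [cf]
  have wt : dt w p = 1 := dt_jet _ _ _
  have w1 : dx 1 w p = 0 := by rw [hwdef, dx_jet _ _ _ (by norm_num)]; simp [cw]
  have w2 : dx 2 w p = 0 := by rw [hwdef, dx_jet _ _ _ (by norm_num)]; simp [cw]
  have w3 : dx 3 w p = 0 := by rw [hwdef, dx_jet _ _ _ (by norm_num)]; simp [cw]
  have w5 : dx 5 w p = -1 := by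
    rw [hwdef, dx_jet _ _ _ (by norm_num)]; norm_num [cw, Nat.factorial]
  have wp : w p = 0 := jet_self _ _ _
  have hg : graphMap u p = z := by rw [graphMap, up]
  have hg' : graphMap (fun r => u r + w r) p = z := by rw [graphMap, up, wp, add_zero]
  have hH : E.HoldsAt u p := by
    rw [KdVEq.holdsAt_iff_of_mem hE hzI, up, ut, u1, u2, u3, u5]; simp only [a]; ring
  have hH' : E.HoldsAt (fun r => u r + w r) p := by
    rw [KdVEq.holdsAt_iff_of_mem hE hzI]
    simp only [dx_add hu hw, dt_add hu hw, up, ut, u1, u2, u3, u5, wt, w1, w2, w3, w5, wp, a]; ring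
  have hdet (a : ℝ) : ((fderiv ℝ Φ z (1, 0, 0)).1 + (fderiv ℝ Φ z (0, 0, 1)).1 * a) *
      ((fderiv ℝ Φ z (0, 1, 0)).2.1 + (fderiv ℝ Φ z (0, 0, 1)).2.1 * b)
      - ((fderiv ℝ Φ z (0, 1, 0)).1 + (fderiv ℝ Φ z (0, 0, 1)).1 * b) *
      ((fderiv ℝ Φ z (1, 0, 0)).2.1 + (fderiv ℝ Φ z (0, 0, 1)).2.1 * a) ≠ 0 := by
    rw [hTx, hTu]
    simpa using ⟨hTt, hb⟩
  have hT : Transversal Φ u p := transversal_of_ne_zero hu ut u1 (by rw [hg]) (hdet a)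
  have ut' : dt (fun r => u r + w r) p = a + 1 := by rw [dt_add hu hw, ut, wt]
  have u1' : dx 1 (fun r => u r + w r) p = b := by rw [dx_add hu hw, u1, w1, add_zero]
  have hT' : Transversal Φ (fun r => u r + w r) p :=
    transversal_of_ne_zero (hu.add hw) ut' u1' (by rw [hg']) (hdet _)
  obtain ⟨B, hB, hBp, hBr, hrel⟩ := h.exists_inverse_of_perturbation hE' hu hw wp
    (hg ▸ hz) hT hT' hH hH'
  have hq1 : (baseMap Φ u p).1 = (Φ z).1 := by simp only [baseMap, hg]
  set q := baseMap Φ u p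
  obtain ⟨k1, k2⟩ := fderiv_eq_of_hasDerivAt_curve hB
  have e0 : B (q.1, q.2) = p := hBp
  have hq := hΦ.fderiv_rightInverse hB (u := fun r => u r + w r) (by rw [hBp]; exact hu.add hw)
    (by rw [hBp, hg']; exact hz) hBr
  have hql := hq (1, 0)
  have hqr := hq (0, 1)
  rw [hBp, hg', fderiv_apply_eq (hu.add hw), ut', u1', apply_mk_eq (fderiv ℝ Φ z)] at hql hqr
  simp only [baseProj_apply, Prod.fst_add, Prod.snd_add, Prod.smul_fst, Prod.smul_snd,
    Prod.mk.injEq, smul_eq_mul, hTx, hTu, mul_zero, add_zero] at hql hqr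
  have hj : (fderiv ℝ B q (0, 1)).1 = 0 := (mul_eq_zero.1 hqr.1).resolve_right hTt
  have hi := hqr.2
  rw [hj] at hi
  -- the old time is locally a function of the new time
  obtain ⟨ε, hε, hball⟩ := Metric.isOpen_iff.1 Φ.open_source z hz
  have hbox : ∀ y ∈ Metric.ball z ε, (Φ y).1 = (Φ (y.1, z.2)).1 := fun y hy =>
    eq_of_fderiv_eq_zero_of_mem_ball (f := fun y => (Φ y).1)
      (fun y hy => (hΦ.hasFDerivAt (hball hy)).fst.differentiableAt)
      (fun y hy => by rw [hΦ.fderiv_fst (hball hy)]; exact (h.fderiv_time hE hE' (hball hy)).1)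
      (fun y hy => by rw [hΦ.fderiv_fst (hball hy)]; exact (h.fderiv_time hE hE' (hball hy)).2) hy
  let A : ℝ → ℝ := fun s => (Φ (s, z.2)).1
  have hA : HasStrictDerivAt A (fderiv ℝ Φ z (1, 0, 0)).1 z.1 := by
    have h1 : ContDiffAt ℝ ∞ A z.1 := by
      have h2 : ContDiffAt ℝ ∞ Φ (z.1, z.2) := hΦ.contDiffAt hz
      have h3 : ContDiffAt ℝ ∞ (fun s : ℝ => (s, z.2)) z.1 := by fun_prop
      exact (h2.comp z.1 h3).fst
    have h2 : HasDerivAt A (fderiv ℝ Φ z (1, 0, 0)).1 z.1 := by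
      have h3 : HasFDerivAt Φ (fderiv ℝ Φ z) (z.1, z.2) := hΦ.hasFDerivAt hz
      have h4 := h3.comp_hasDerivAt z.1 ((hasDerivAt_id z.1).prodMk (hasDerivAt_const z.1 z.2))
      exact hasFDerivAt_fst.comp_hasDerivAt z.1 h4
    exact h1.hasStrictDerivAt' h2 (by simp)
  have hinv := hA.hasStrictFDerivAt_equiv hTt |>.eventually_left_inverse
  set A' := hA.hasStrictFDerivAt_equiv hTt |>.localInverse with hA'
  have hBt : Filter.Tendsto B (𝓝 q) (𝓝 p) := by
    have := hB.continuousAt.tendsto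
    rwa [hBp] at this
  have hBt1 : Filter.Tendsto (fun y => (B y).1) (𝓝 q) (𝓝 z.1) :=
    (continuous_fst.tendsto p).comp hBt
  have hBg : Filter.Tendsto (fun y => graphMap (fun r => u r + w r) (B y)) (𝓝 q) (𝓝 z) := by
    have := (contDiffAt_graphMap (hu.add hw)).continuousAt.tendsto.comp hBt
    rwa [hg'] at this
  have hloc : ∀ᶠ y in 𝓝 q, (B y).1 = A' y.1 := by
    filter_upwards [hBr, hBt1.eventually hinv, hBg.eventually (Metric.ball_mem_nhds z hε)]
      with y h1 h2 h3
    rw [← h2]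
    congr 1
    have h4 := hbox _ h3
    have h5 := congrArg Prod.fst h1
    exact h4.symm.trans h5
  have g2 : Filter.Tendsto (fun ξ : ℝ => (q.1, ξ)) (𝓝 q.2) (𝓝 q) :=
    (by fun_prop : ContinuousAt (fun ξ : ℝ => (q.1, ξ)) q.2).tendsto
  -- On a line of constant new time the old time is constant, so only the fifth-power part of `w`
  -- contributes there.
  have hline : ∀ᶠ ξ in 𝓝 q.2, (B (q.1, ξ)).1 = p.1 := by
    filter_upwards [g2.eventually hloc] with ξ h1
    rw [h1, ← hloc.self_of_nhds, hBp]
  have hwj (r : ℝ × ℝ) : w r = (r.1 - p.1) - (r.2 - p.2) ^ 5 / 120 := by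
    simp [hwdef, jet, cw, Finset.sum_range_succ]; ring
  have r1 : HasDerivAt (fun η => w (B (η, q.2))) (fderiv ℝ B q (1, 0)).1 q.1 := by
    have c1 : HasDerivAt (fun η => (B (η, q.2)).1) _ q.1 :=
      hasFDerivAt_fst.comp_hasDerivAt q.1 k1
    have c2 : HasDerivAt (fun η => (B (η, q.2)).2) _ q.1 :=
      hasFDerivAt_snd.comp_hasDerivAt q.1 k1
    simp only [hwj]
    refine ((c1.sub_const p.1).sub (((c2.sub_const p.2).fun_pow 5).div_const 120)).congr_deriv ?_
    simp [e0]
  have r5 : (fun ξ => w (B (q.1, ξ)) - (-((fderiv ℝ B q (0, 1)).2 ^ 5) / 120) * (ξ - q.2) ^ 5)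
      =o[𝓝 q.2] fun ξ => (ξ - q.2) ^ 5 := by
    have c2 : HasDerivAt (fun ξ => (B (q.1, ξ)).2) _ q.2 :=
      hasFDerivAt_snd.comp_hasDerivAt q.2 k2
    have c3 : (fun ξ => ((B (q.1, ξ)).2 - p.2) - (fderiv ℝ B q (0, 1)).2 * (ξ - q.2))
        =o[𝓝 q.2] fun ξ => ξ - q.2 := by
      simpa [e0, mul_comm] using (c2.sub_const p.2).isLittleO
    have c4 := (pow_sub_isLittleO c3 5 (by norm_num)).const_mul_left (-1 / 120)
    refine c4.congr' ?_ Filter.EventuallyEq.rfl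
    filter_upwards [hline] with ξ h1
    rw [hwj, h1]; ring
  have hfin := hrel _ _ r1 r5
  have hfin' : (fderiv ℝ B q (1, 0)).1 = (fderiv ℝ B q (0, 1)).2 ^ 5 := by linarith
  -- The inverse Jacobian is triangular, so `B_ξ` and `B_η` supply `1/(X_x + b X_u)` and `1/T_t`;
  -- the relation `hfin'` equates the fifth power of the former with the latter.
  have hi' : (fderiv ℝ B q (0, 1)).2 *
      ((fderiv ℝ Φ z (0, 1, 0)).2.1 + (fderiv ℝ Φ z (0, 0, 1)).2.1 * b) = 1 := by
    linear_combination hi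
  have hl := hql.1
  rw [hfin'] at hl
  have hi5 : (fderiv ℝ B q (0, 1)).2 ^ 5 *
      ((fderiv ℝ Φ z (0, 1, 0)).2.1 + (fderiv ℝ Φ z (0, 0, 1)).2.1 * b) ^ 5 = 1 := by
    rw [← mul_pow, hi', one_pow]
  have hne : (fderiv ℝ B q (0, 1)).2 ^ 5 ≠ 0 := left_ne_zero_of_mul_eq_one hi5
  exact mul_left_cancel₀ hne (hi5.trans hl.symm)

/-! ### The new dependent variable is affine in `u` -/

theorem contDiffAt_fderiv_apply {E F : Type*} [NormedAddCommGroup E] [NormedSpace ℝ E]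
    [NormedAddCommGroup F] [NormedSpace ℝ F] {f : E → F} {x : E} (h : ContDiffAt ℝ ∞ f x) (d : E) :
    ContDiffAt ℝ ∞ (fun y => fderiv ℝ f y d) x :=
  (h.fderiv_right (m := ∞) (by simp)).clm_apply contDiffAt_const

/-- The mean value theorem in `u` writes the difference as `U_u` at an intermediate point times the
quartic. Expanding `U_u` to first order along `(0, 1, b)` then produces the fifth-order term. -/
theorem quartic_perturbation_isLittleO {U : ℝ × ℝ × ℝ → ℝ} {z : ℝ × ℝ × ℝ}
    (hU : ContDiffAt ℝ ∞ U z) (b : ℝ) :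
    (fun x => U (z.1, x, z.2.2 + b * (x - z.2.1) + (x - z.2.1) ^ 4 / 24)
        - U (z.1, x, z.2.2 + b * (x - z.2.1)) - fderiv ℝ U z (0, 0, 1) / 24 * (x - z.2.1) ^ 4
        - fderiv ℝ (fun y => fderiv ℝ U y (0, 0, 1)) z (0, 1, b) / 24 * (x - z.2.1) ^ 5)
      =o[𝓝 z.2.1] fun x => (x - z.2.1) ^ 5 := by
  set x₀ := z.2.1 with hx₀
  set G : ℝ × ℝ × ℝ → ℝ := fun y => fderiv ℝ U y (0, 0, 1) with hG
  have hGd : HasFDerivAt G (fderiv ℝ G z) z :=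
    ((contDiffAt_fderiv_apply hU _).differentiableAt (by simp)).hasFDerivAt
  set L := fderiv ℝ G z
  have hev : ∀ᶠ y in 𝓝 z, DifferentiableAt ℝ U y :=
    ((contDiffAt_of_infty hU 1).eventually (by simp)).mono fun y hy => hy.differentiableAt (by simp)
  obtain ⟨ε, hε, hball⟩ := Metric.eventually_nhds_iff_ball.1 hev
  have hc : ∀ θ : ℝ, ContinuousAt
      (fun x : ℝ => ((z.1, x, z.2.2 + b * (x - x₀) + θ * ((x - x₀) ^ 4 / 24)) : ℝ × ℝ × ℝ)) x₀ := by
    intro θ; fun_prop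
  have hpt : ∀ᶠ x in 𝓝 x₀, ∃ θ ∈ Set.Icc (0 : ℝ) 1,
      U (z.1, x, z.2.2 + b * (x - x₀) + (x - x₀) ^ 4 / 24) - U (z.1, x, z.2.2 + b * (x - x₀))
        = G (z.1, x, z.2.2 + b * (x - x₀) + θ * ((x - x₀) ^ 4 / 24)) * ((x - x₀) ^ 4 / 24) := by
    have m0 := (hc 0).preimage_mem_nhds (t := Metric.ball z ε) (by
      simpa [hx₀] using Metric.ball_mem_nhds z hε)
    have m1 := (hc 1).preimage_mem_nhds (t := Metric.ball z ε) (by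
      simpa [hx₀] using Metric.ball_mem_nhds z hε)
    filter_upwards [m0, m1] with x h0 h1
    set w := (x - x₀) ^ 4 / 24
    set y := z.2.2 + b * (x - x₀)
    have hw : 0 ≤ w := by positivity
    rcases hw.eq_or_lt with hw0 | hwpos
    · exact ⟨0, by simp, by rw [← hw0]; simp⟩
    have hseg : ∀ s ∈ Set.Icc y (y + w), (z.1, x, s) ∈ Metric.ball z ε := by
      intro s hs
      rw [Set.mem_preimage, ← Prod.mk.eta (p := z), ← ball_prod_same, Set.mem_prod] at h0 h1
      rw [← Prod.mk.eta (p := z), ← ball_prod_same, Set.mem_prod]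
      refine ⟨h0.1, ?_⟩
      have h0 := h0.2
      have h1 := h1.2
      rw [← Prod.mk.eta (p := z.2), ← ball_prod_same, Set.mem_prod] at h0 h1 ⊢
      refine ⟨h0.1, ?_⟩
      have h0 := h0.2
      have h1 := h1.2
      simp only [zero_mul, add_zero, one_mul] at h0 h1
      have hcv := (convex_ball z.2.2 ε).ordConnected
      exact hcv.out h0 h1 hs
    have hd : ∀ s ∈ Set.Icc y (y + w),
        HasDerivAt (fun s => U (z.1, x, s)) (G (z.1, x, s)) s := by
      intro s hs
      have h2 := (hball _ (hseg s hs)).hasFDerivAt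
      exact h2.comp_hasDerivAt s ((hasDerivAt_const s z.1).prodMk
        ((hasDerivAt_const s x).prodMk (hasDerivAt_id s)))
    obtain ⟨s, hs, hse⟩ := exists_hasDerivAt_eq_slope (fun s => U (z.1, x, s))
      (fun s => G (z.1, x, s)) (by linarith : y < y + w)
      (fun s hs => (hd s hs).continuousAt.continuousWithinAt)
      (fun s hs => hd s (Set.Ioo_subset_Icc_self hs))
    refine ⟨(s - y) / w, ⟨by have := hs.1; exact div_nonneg (by linarith) hw,
      by have := hs.2; rw [div_le_one hwpos]; linarith⟩, ?_⟩
    rw [div_mul_cancel₀ _ hwpos.ne', add_sub_cancel, hse, add_sub_cancel_left,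
      div_mul_cancel₀ _ hwpos.ne']
  obtain ⟨θ, hθe⟩ := hpt.choice
  -- The position of the intermediate point matters only at fourth order, so it does not affect the
  -- first-order expansion of `G`.
  have hθw : (fun x => θ x * ((x - x₀) ^ 4 / 24)) =o[𝓝 x₀] fun x => x - x₀ := by
    have h1 : (fun x => θ x * ((x - x₀) ^ 4 / 24)) =O[𝓝 x₀] fun x => (x - x₀) ^ 4 := by
      refine Asymptotics.IsBigO.of_bound 1 (hθe.mono fun x hθ => ?_)
      rw [norm_mul, norm_div, Real.norm_of_nonneg hθ.1.1, one_mul]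
      have h2 := hθ.1.2
      have h3 := norm_nonneg ((x - x₀) ^ 4)
      have h4 := hθ.1.1
      rw [show ‖(24 : ℝ)‖ = 24 by norm_num]
      nlinarith
    refine h1.trans_isLittleO ?_
    have := Asymptotics.isLittleO_pow_sub_sub x₀ (m := 4) (by norm_num)
    simpa only [← norm_pow, Asymptotics.isLittleO_norm_left] using this
  let y : ℝ → ℝ × ℝ × ℝ := fun x => (z.1, x, z.2.2 + b * (x - x₀) + θ x * ((x - x₀) ^ 4 / 24))
  have hyO : (fun x => y x - z) =O[𝓝 x₀] fun x => x - x₀ := by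
    have h1 : (fun x => b * (x - x₀) + θ x * ((x - x₀) ^ 4 / 24)) =O[𝓝 x₀] fun x => x - x₀ :=
      ((Asymptotics.isBigO_refl (fun x => x - x₀) (𝓝 x₀)).const_mul_left b).add hθw.isBigO
    have h2 : (fun x => ((0, x - x₀, b * (x - x₀) + θ x * ((x - x₀) ^ 4 / 24)) : ℝ × ℝ × ℝ))
        =O[𝓝 x₀] fun x => x - x₀ :=
      (Asymptotics.isBigO_zero _ _).prod_left ((Asymptotics.isBigO_refl _ _).prod_left h1)
    refine h2.congr_left fun x => ?_
    refine Prod.ext ?_ (Prod.ext ?_ ?_)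
    · simp [y]
    · simp [y, hx₀]
    · simp only [y, Prod.snd_sub]; ring
  have hyt : Filter.Tendsto y (𝓝 x₀) (𝓝 z) := by
    have h1 : Filter.Tendsto (fun x : ℝ => x - x₀) (𝓝 x₀) (𝓝 0) := by
      have : ContinuousAt (fun x : ℝ => x - x₀) x₀ := by fun_prop
      simpa using this.tendsto
    have h2 := (hyO.trans_tendsto h1).add_const z
    simpa using h2
  have hGo : (fun x => G (y x) - G z - (x - x₀) * L (0, 1, b)) =o[𝓝 x₀] fun x => x - x₀ := by
    have h1 := (hGd.isLittleO.comp_tendsto hyt).trans_isBigO hyO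
    have h2 := h1.add (hθw.mul_isBigO (Asymptotics.isBigO_refl (fun _ => L (0, 0, 1)) (𝓝 x₀))
      |>.trans_isBigO (Asymptotics.isBigO_of_le' (c := ‖L (0, 0, 1)‖) _ fun x => by
        rw [norm_mul, mul_comm]))
    refine h2.congr_left fun x => ?_
    have h3 : y x - z = (x - x₀) • ((0, 1, b) : ℝ × ℝ × ℝ)
        + (θ x * ((x - x₀) ^ 4 / 24)) • ((0, 0, 1) : ℝ × ℝ × ℝ) := by
      refine Prod.ext ?_ (Prod.ext ?_ ?_)
      · simp [y]
      · simp [y, hx₀]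
      · simp only [y, Prod.snd_sub, Prod.snd_add, Prod.smul_snd, smul_eq_mul]; ring
    simp only [Function.comp_apply, h3, map_add, map_smul, smul_eq_mul]
    ring
  have hfin := (hGo.mul_isBigO
    (Asymptotics.isBigO_refl (fun x => (x - x₀) ^ 4) (𝓝 x₀))).const_mul_left (1 / 24)
  refine hfin.congr' ?_ (Filter.Eventually.of_forall fun x => ?_)
  · filter_upwards [hθe] with x hx
    rw [hx.2]
    ring
  · simp only; ring

theorem iteratedDeriv_quartic_perturbation {U : ℝ × ℝ × ℝ → ℝ} {z : ℝ × ℝ × ℝ}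
    (hU : ContDiffAt ℝ ∞ U z) (b : ℝ) {i : ℕ} (hi : i ≤ 5) :
    iteratedDeriv i (fun x => U (z.1, x, z.2.2 + b * (x - z.2.1) + (x - z.2.1) ^ 4 / 24)
        - U (z.1, x, z.2.2 + b * (x - z.2.1))) z.2.1
      = (if i = 5 then fderiv ℝ (fun y => fderiv ℝ U y (0, 0, 1)) z (0, 1, b) / 24 * 120 else 0)
        + if i = 4 then fderiv ℝ U z (0, 0, 1) / 24 * 24 else 0 := by
  have hs : ContDiffAt ℝ ∞ (fun x => U (z.1, x, z.2.2 + b * (x - z.2.1) + (x - z.2.1) ^ 4 / 24)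
        - U (z.1, x, z.2.2 + b * (x - z.2.1))) z.2.1 := by
    refine ContDiffAt.sub ?_ ?_
    · refine ContDiffAt.comp z.2.1 (g := U) (by simpa using hU) (by fun_prop)
    · refine ContDiffAt.comp z.2.1 (g := U) (by simpa using hU) (by fun_prop)
  have hp : ContDiffAt ℝ ∞ (fun x => fderiv ℝ U z (0, 0, 1) / 24 * (x - z.2.1) ^ 4) z.2.1 := by
    fun_prop
  have h1 := iteratedDeriv_of_sub_isLittleO (contDiffAt_of_infty (hs.sub hp) 5)
    (quartic_perturbation_isLittleO hU b) i hi
  rw [iteratedDeriv_fun_sub (contDiffAt_of_infty hs i) (contDiffAt_of_infty hp i),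
    iteratedDeriv_const_mul_sub_pow] at h1
  have h2 := sub_eq_iff_eq_add.1 h1
  rw [h2]
  norm_num [Nat.factorial]

theorem IsAdmissible.fderiv_components_ne_zero {E E' : KdVEq} (hE : E ∈ gaugedClass)
    (hE' : E' ∈ gaugedClass) {Φ : VarMap} (h : IsAdmissible E E' Φ) {z : ℝ × ℝ × ℝ}
    (hz : z ∈ Φ.source) : (fderiv ℝ Φ z (1, 0, 0)).1 ≠ 0 ∧ (fderiv ℝ Φ z (0, 1, 0)).2.1 ≠ 0 ∧
      (fderiv ℝ Φ z (0, 0, 1)).2.2 ≠ 0 := by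
  have hi := h.isPointTransformation.fderiv_injective hz
  obtain ⟨hTx, hTu⟩ := h.fderiv_time hE hE' hz
  obtain ⟨hXu, hX5⟩ := h.fderiv_space hE hE' hz
  have hm := exists_minor_ne_zero hi
  rw [hTx, hTu, hXu] at hm
  refine ⟨fun h0 => by simp [h0] at hm, fun h0 => by simp [h0] at hm, fun h0 => ?_⟩
  have h1 : fderiv ℝ Φ z (0, 0, 1) = 0 := Prod.ext hTu (Prod.ext hXu h0)
  have h2 := hi (h1.trans (map_zero _).symm)
  simp at h2

/-- Since `T_x = T_u = X_u = 0`, the Jacobian determinant along any graph is `T_t X_x`, independent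
of the graph. -/
theorem IsAdmissible.transversal {E E' : KdVEq} (hE : E ∈ gaugedClass) (hE' : E' ∈ gaugedClass)
    {Φ : VarMap} (h : IsAdmissible E E' Φ) {u : ℝ × ℝ → ℝ} {p : ℝ × ℝ} (hu : ContDiffAt ℝ ∞ u p)
    (hp : graphMap u p ∈ Φ.source) : Transversal Φ u p := by
  obtain ⟨hTx, hTu⟩ := h.fderiv_time hE hE' hp
  obtain ⟨hXu, -⟩ := h.fderiv_space hE hE' hp
  obtain ⟨h1, h2, -⟩ := h.fderiv_components_ne_zero hE hE' hp
  refine transversal_of_ne_zero hu rfl rfl rfl ?_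
  rw [hTx, hTu, hXu]
  simpa using ⟨h1, h2⟩

theorem hasDerivAt_curve_fst {Φ : ℝ × ℝ × ℝ → ℝ × ℝ × ℝ} {z : ℝ × ℝ × ℝ}
    (h : ContDiffAt ℝ ∞ Φ z) : HasDerivAt (fun s => (Φ (s, z.2)).1) (fderiv ℝ Φ z (1, 0, 0)).1 z.1 := by
  have h3 : HasFDerivAt Φ (fderiv ℝ Φ z) (z.1, z.2) := (h.differentiableAt (by simp)).hasFDerivAt
  have h4 := h3.comp_hasDerivAt z.1 ((hasDerivAt_id z.1).prodMk (hasDerivAt_const z.1 z.2))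
  exact hasFDerivAt_fst.comp_hasDerivAt z.1 h4

theorem mk_mem_ball {z y : ℝ × ℝ × ℝ} {ε : ℝ} (hy : y ∈ Metric.ball z ε) :
    (y.1, z.2) ∈ Metric.ball z ε := by
  have hε : 0 < ε := dist_nonneg.trans_lt (Metric.mem_ball.1 hy)
  rw [← Prod.mk.eta (p := z), ← ball_prod_same] at hy ⊢
  exact ⟨hy.1, Metric.mem_ball_self hε⟩

/-- The local form of the transformation of the independent variables. -/
theorem IsAdmissible.exists_local_form {E E' : KdVEq} (hE : E ∈ gaugedClass)
    (hE' : E' ∈ gaugedClass) {Φ : VarMap} (h : IsAdmissible E E' Φ) {z : ℝ × ℝ × ℝ} {ε : ℝ}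
    (hball : Metric.ball z ε ⊆ Φ.source) (hε : 0 < ε) :
    ∃ α β γ : ℝ → ℝ, ContDiffAt ℝ ∞ α z.1 ∧ ContDiffAt ℝ ∞ β z.1 ∧ ContDiffAt ℝ ∞ γ z.1 ∧
      deriv α z.1 = β z.1 ^ 5 ∧ β z.1 ≠ 0 ∧
      (∀ y ∈ Metric.ball z ε, (fderiv ℝ Φ y (0, 1, 0)).2.1 = β y.1) ∧
      ∀ y ∈ Metric.ball z ε, (Φ y).1 = α y.1 ∧ (Φ y).2.1 = β y.1 * y.2.1 + γ y.1 := by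
  have hΦ := h.isPointTransformation
  have hz : z ∈ Φ.source := hball (Metric.mem_ball_self hε)
  let α : ℝ → ℝ := fun s => (Φ (s, z.2)).1
  let β : ℝ → ℝ := fun s => (fderiv ℝ Φ (s, z.2) (0, 1, 0)).2.1
  let γ : ℝ → ℝ := fun s => (Φ (s, z.2)).2.1 - β s * z.2.1
  have hcurve (s : ℝ) : ContDiffAt ℝ ∞ (fun s : ℝ => (s, z.2)) s := by fun_prop
  have hα : ContDiffAt ℝ ∞ α z.1 :=
    (ContDiffAt.comp z.1 (g := Φ) (hΦ.contDiffAt hz) (hcurve _)).fst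
  have hβs : ∀ s, (s, z.2) ∈ Φ.source → ContDiffAt ℝ ∞ β s := fun s hs =>
    (ContDiffAt.comp s (g := fun y => fderiv ℝ Φ y (0, 1, 0))
      (contDiffAt_fderiv_apply (hΦ.contDiffAt hs) _) (hcurve _)).snd.fst
  have hβ : ContDiffAt ℝ ∞ β z.1 := hβs _ hz
  have hγ : ContDiffAt ℝ ∞ γ z.1 :=
    ((ContDiffAt.comp z.1 (g := Φ) (hΦ.contDiffAt hz) (hcurve _)).snd.fst).sub
      (hβ.mul contDiffAt_const)
  have hT : ∀ y ∈ Metric.ball z ε, (Φ y).1 = α y.1 := fun y hy =>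
    eq_of_fderiv_eq_zero_of_mem_ball (f := fun y => (Φ y).1)
      (fun y hy => (hΦ.hasFDerivAt (hball hy)).fst.differentiableAt)
      (fun y hy => by rw [hΦ.fderiv_fst (hball hy)]; exact (h.fderiv_time hE hE' (hball hy)).1)
      (fun y hy => by rw [hΦ.fderiv_fst (hball hy)]; exact (h.fderiv_time hE hE' (hball hy)).2) hy
  have hTt : ∀ y ∈ Metric.ball z ε, (fderiv ℝ Φ y (1, 0, 0)).1 = deriv α y.1 := by
    intro y hy
    rw [← (hasDerivAt_curve_fst (hΦ.contDiffAt (hball hy))).deriv]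
    refine Filter.EventuallyEq.deriv_eq ?_
    have hcy : ContinuousAt (fun s : ℝ => (s, y.2)) y.1 := by fun_prop
    filter_upwards [hcy.preimage_mem_nhds (Metric.isOpen_ball.mem_nhds hy)] with s hs
    exact hT _ hs
  -- `X_x⁵ = T_t` depends on `t` only, and the odd power is injective.
  have hX : ∀ y ∈ Metric.ball z ε, (fderiv ℝ Φ y (0, 1, 0)).2.1 = β y.1 := by
    intro y hy
    have h1 := (h.fderiv_space hE hE' (hball hy)).2
    have h2 := (h.fderiv_space hE hE' (hball (mk_mem_ball hy))).2
    rw [hTt _ hy] at h1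
    rw [hTt _ (mk_mem_ball hy)] at h2
    have h3 : Odd 5 := by decide
    exact h3.strictMono_pow.injective (h1.trans h2.symm)
  have hXd : ∀ y ∈ Metric.ball z ε, HasFDerivAt (fun y : ℝ × ℝ × ℝ => (Φ y).2.1 - β y.1 * y.2.1)
      (fderiv ℝ (fun y => (Φ y).2.1) y - (β y.1 • ((ContinuousLinearMap.fst ℝ ℝ ℝ).comp
        (ContinuousLinearMap.snd ℝ ℝ (ℝ × ℝ))) + y.2.1 • (deriv β y.1 •
          ContinuousLinearMap.fst ℝ ℝ (ℝ × ℝ)))) y := by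
    intro y hy
    have h1 := (hΦ.hasFDerivAt (hball hy)).snd.fst.differentiableAt.hasFDerivAt
    have h2 : HasDerivAt β (deriv β y.1) y.1 :=
      ((hβs _ (hball (mk_mem_ball hy))).differentiableAt (by simp)).hasDerivAt
    have h3 : HasFDerivAt (fun y : ℝ × ℝ × ℝ => β y.1) _ y :=
      h2.comp_hasFDerivAt y (ContinuousLinearMap.fst ℝ ℝ (ℝ × ℝ)).hasFDerivAt
    exact h1.sub (h3.mul hasFDerivAt_snd.fst)
  have hXform : ∀ y ∈ Metric.ball z ε, (Φ y).2.1 - β y.1 * y.2.1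
      = (Φ (y.1, z.2)).2.1 - β y.1 * z.2.1 := fun y hy =>
    eq_of_fderiv_eq_zero_of_mem_ball (f := fun y => (Φ y).2.1 - β y.1 * y.2.1)
      (fun y hy => (hXd y hy).differentiableAt)
      (fun y hy => by
        rw [(hXd y hy).fderiv]
        simp [hΦ.fderiv_snd_fst (hball hy), hX y hy])
      (fun y hy => by
        rw [(hXd y hy).fderiv]
        simp [hΦ.fderiv_snd_fst (hball hy), (h.fderiv_space hE hE' (hball hy)).1]) hy
  have hzb := Metric.mem_ball_self (x := z) hε
  refine ⟨α, β, γ, hα, hβ, hγ, ?_, ?_, hX, fun y hy => ⟨hT y hy, ?_⟩⟩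
  · rw [← hTt z hzb, ← (h.fderiv_space hE hE' hz).2, hX z hzb]
  · rw [← hX z hzb]; exact (h.fderiv_components_ne_zero hE hE' hz).2.1
  · have := hXform y hy
    simp only [γ]
    linarith

/-- The image of a graph under an admissible transformation. -/
theorem IsAdmissible.exists_image {E E' : KdVEq} (hE : E ∈ gaugedClass)
    (hE' : E' ∈ gaugedClass) {Φ : VarMap} (h : IsAdmissible E E' Φ) {z : ℝ × ℝ × ℝ}
    (hz : z ∈ Φ.source) {α β γ : ℝ → ℝ}
    (hform : ∀ᶠ y in 𝓝 z, (Φ y).1 = α y.1 ∧ (Φ y).2.1 = β y.1 * y.2.1 + γ y.1)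
    {u : ℝ × ℝ → ℝ} (hu : ContDiffAt ℝ ∞ u (z.1, z.2.1)) (huz : u (z.1, z.2.1) = z.2.2)
    (hEu : E.HoldsAt u (z.1, z.2.1)) :
    ∃ v : ℝ × ℝ → ℝ, ContDiffAt ℝ ∞ v (α z.1, β z.1 * z.2.1 + γ z.1) ∧
      E'.HoldsAt v (α z.1, β z.1 * z.2.1 + γ z.1) ∧
      ∀ᶠ r : ℝ × ℝ in 𝓝 (z.1, z.2.1),
        v (α r.1, β r.1 * r.2 + γ r.1) = (Φ (graphMap u r)).2.2 := by
  have hg : graphMap u (z.1, z.2.1) = z := by rw [graphMap, huz]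
  have hp : graphMap u (z.1, z.2.1) ∈ Φ.source := hg ▸ hz
  obtain ⟨v, -, hv, -, -, -, hvu⟩ :=
    h.isPointTransformation.exists_image hu hp (h.transversal hE hE' hu hp)
  have hH := (h.maps.holdsAt_iff hu hp hv hvu).1 hEu
  have hq : baseMap Φ u (z.1, z.2.1) = (α z.1, β z.1 * z.2.1 + γ z.1) := by
    simp only [baseMap, hg, hform.self_of_nhds]
  rw [hq] at hv hH
  refine ⟨v, hv, hH, ?_⟩
  have hc : Filter.Tendsto (graphMap u) (𝓝 (z.1, z.2.1)) (𝓝 z) := by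
    have := (contDiffAt_graphMap hu).continuousAt.tendsto
    rwa [hg] at this
  filter_upwards [hvu, hc.eventually hform] with r h1 h2
  rw [← h1]
  congr 1
  exact Prod.ext h2.1.symm h2.2.symm

/-- The new dependent variable is affine in `u`, with a coefficient that does not depend on `x`. -/
theorem IsAdmissible.fderiv_fderiv_dependent {E E' : KdVEq} (hE : E ∈ gaugedClass)
    (hE' : E' ∈ gaugedClass) {Φ : VarMap} (h : IsAdmissible E E' Φ) {z : ℝ × ℝ × ℝ}
    (hz : z ∈ Φ.source) (b : ℝ) :
    fderiv ℝ (fun y => fderiv ℝ (fun y => (Φ y).2.2) y (0, 0, 1)) z (0, 1, b) = 0 := by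
  have hΦ := h.isPointTransformation
  obtain ⟨ε, hε, hball⟩ := Metric.isOpen_iff.1 Φ.open_source z hz
  obtain ⟨α, β, γ, hα, hβ, hγ, hα5, hβ0, -, hform⟩ := h.exists_local_form hE hE' hball hε
  have hform' : ∀ᶠ y in 𝓝 z, (Φ y).1 = α y.1 ∧ (Φ y).2.1 = β y.1 * y.2.1 + γ y.1 := by
    filter_upwards [Metric.ball_mem_nhds z hε] with y hy using hform y hy
  set p : ℝ × ℝ := (z.1, z.2.1) with hp
  have hzI : p.1 ∈ E.I := h.source_subset z hz
  let a : ℝ := -(E.c p.1 * z.2.2 ^ 2 * b + E.f p.1 * z.2.2 * b)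
  let cf : ℕ → ℝ := fun j => match j with
    | 0 => z.2.2
    | 1 => b
    | _ => 0
  -- A purely quartic perturbation: the equation contains no fourth derivative, so adding it is
  -- harmless.
  let cw : ℕ → ℝ := fun j => match j with
    | 4 => 1 / 24
    | _ => 0
  set u := jet p a cf with hudef
  set w := jet p 0 cw with hwdef
  have hu : ContDiffAt ℝ ∞ u p := (contDiff_jet _ _ _).contDiffAt
  have hw : ContDiffAt ℝ ∞ w p := (contDiff_jet _ _ _).contDiffAt
  have up : u p = z.2.2 := jet_self _ _ _
  have ut : dt u p = a := dt_jet _ _ _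
  have u1 : dx 1 u p = b := by rw [hudef, dx_jet _ _ _ (by norm_num)]; simp [cf]
  have u2 : dx 2 u p = 0 := by rw [hudef, dx_jet _ _ _ (by norm_num)]; simp [cf]
  have u3 : dx 3 u p = 0 := by rw [hudef, dx_jet _ _ _ (by norm_num)]; simp [cf]
  have u5 : dx 5 u p = 0 := by rw [hudef, dx_jet _ _ _ (by norm_num)]; simp [cf]
  have wt : dt w p = 0 := dt_jet _ _ _
  have w1 : dx 1 w p = 0 := by rw [hwdef, dx_jet _ _ _ (by norm_num)]; simp [cw]
  have w2 : dx 2 w p = 0 := by rw [hwdef, dx_jet _ _ _ (by norm_num)]; simp [cw]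
  have w3 : dx 3 w p = 0 := by rw [hwdef, dx_jet _ _ _ (by norm_num)]; simp [cw]
  have w5 : dx 5 w p = 0 := by rw [hwdef, dx_jet _ _ _ (by norm_num)]; simp [cw]
  have wp : w p = 0 := jet_self _ _ _
  have hH : E.HoldsAt u p := by
    rw [KdVEq.holdsAt_iff_of_mem hE hzI, up, ut, u1, u2, u3, u5]; simp only [a]; ring
  have hH' : E.HoldsAt (fun r => u r + w r) p := by
    rw [KdVEq.holdsAt_iff_of_mem hE hzI]
    simp only [dx_add hu hw, dt_add hu hw, up, ut, u1, u2, u3, u5, wt, w1, w2, w3, w5, wp, a]; ring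
  obtain ⟨v, hv, hvH, hvu⟩ := h.exists_image hE hE' hz hform' hu up hH
  obtain ⟨v', hv', hvH', hvu'⟩ := h.exists_image hE hE' hz hform' (hu.add hw)
    (by rw [← hp, up, wp, add_zero]) hH'
  have hd {F : ℝ → ℝ} (hF : ContDiffAt ℝ ∞ F z.1) : HasDerivAt F (deriv F z.1) z.1 :=
    (hF.differentiableAt (by simp)).hasDerivAt
  have t1 := dt_of_eventuallyEq (p := p) hv (hd hα) (hd hβ) (hd hγ) hvu
  have t2 := dt_of_eventuallyEq (p := p) hv' (hd hα) (hd hβ) (hd hγ) hvu'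
  have x1 := fun j => dx_of_eventuallyEq (p := p) hvu j
  have x2 := fun j => dx_of_eventuallyEq (p := p) hvu' j
  set V : ℝ × ℝ × ℝ → ℝ := fun y => (Φ y).2.2 with hVdef
  have hV : ContDiffAt ℝ ∞ V z := (hΦ.contDiffAt hz).snd.snd
  have hux (y : ℝ) : u (p.1, y) = z.2.2 + b * (y - z.2.1) := by
    simp [hudef, jet, cf, Finset.sum_range_succ, hp]
  have hwx (y : ℝ) : w (p.1, y) = (y - z.2.1) ^ 4 / 24 := by
    simp [hwdef, jet, cw, Finset.sum_range_succ, hp]; ring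
  have hwt (s : ℝ) : w (s, p.2) = 0 := by
    simp [hwdef, jet, cw, Finset.sum_range_succ]
  have hWt : dt (fun r => (Φ (graphMap (fun r => u r + w r) r)).2.2) p
      = dt (fun r => (Φ (graphMap u r)).2.2) p := by
    simp only [dt, graphMap, hwt, add_zero]
  have c1 : ContDiffAt ℝ ∞ (fun x => V (z.1, x, z.2.2 + b * (x - z.2.1) + (x - z.2.1) ^ 4 / 24))
      z.2.1 := ContDiffAt.comp z.2.1 (g := V) (by simpa using hV) (by fun_prop)
  have c2 : ContDiffAt ℝ ∞ (fun x => V (z.1, x, z.2.2 + b * (x - z.2.1)))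
      z.2.1 := ContDiffAt.comp z.2.1 (g := V) (by simpa using hV) (by fun_prop)
  have hWx (j : ℕ) (hj : j ≤ 5) := iteratedDeriv_quartic_perturbation hV b hj
  have hWd (j : ℕ) : dx j (fun r => (Φ (graphMap (fun r => u r + w r) r)).2.2) p
      - dx j (fun r => (Φ (graphMap u r)).2.2) p
      = iteratedDeriv j (fun x => V (z.1, x, z.2.2 + b * (x - z.2.1) + (x - z.2.1) ^ 4 / 24)
        - V (z.1, x, z.2.2 + b * (x - z.2.1))) z.2.1 := by
    rw [iteratedDeriv_fun_sub (contDiffAt_of_infty c1 j) (contDiffAt_of_infty c2 j)]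
    simp only [dx, graphMap, hux, hwx]
    rfl
  have hβj (j : ℕ) : β p.1 ^ j ≠ 0 := pow_ne_zero _ hβ0
  -- The images agree in `x`-derivatives below order four; the fourth ones may differ but do not
  -- enter the equation.
  have hlow (j : ℕ) (hj : j < 4) : dx j v' (α p.1, β p.1 * p.2 + γ p.1)
      = dx j v (α p.1, β p.1 * p.2 + γ p.1) := by
    have e1 := hWx j (by omega)
    rw [if_neg (by omega), if_neg (by omega), ← hWd, ← x1, ← x2, ← mul_sub, add_zero] at e1
    exact sub_eq_zero.1 ((mul_eq_zero.1 e1).resolve_left (hβj j))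
  have hv0 : v' (α p.1, β p.1 * p.2 + γ p.1) = v (α p.1, β p.1 * p.2 + γ p.1) := by
    have := hlow 0 (by norm_num)
    simpa [dx] using this
  have hvt : dt v' (α p.1, β p.1 * p.2 + γ p.1) = dt v (α p.1, β p.1 * p.2 + γ p.1) := by
    rw [hWt, ← t1, hlow 1 (by norm_num)] at t2
    have h5 : deriv α z.1 ≠ 0 := by rw [hα5]; exact pow_ne_zero _ hβ0
    exact mul_left_cancel₀ h5 (add_right_cancel t2)
  have hqI : (α z.1, β z.1 * z.2.1 + γ z.1).1 ∈ E'.I := by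
    have := h.target_subset _ (Φ.map_source hz)
    rwa [hform'.self_of_nhds.1] at this
  rw [KdVEq.holdsAt_iff_of_mem hE' hqI] at hvH hvH'
  change dt v' (α p.1, β p.1 * p.2 + γ p.1) + _ * v' (α p.1, β p.1 * p.2 + γ p.1) *
    dx 3 v' (α p.1, β p.1 * p.2 + γ p.1) + _ * dx 1 v' (α p.1, β p.1 * p.2 + γ p.1) *
    dx 2 v' (α p.1, β p.1 * p.2 + γ p.1) + _ * v' (α p.1, β p.1 * p.2 + γ p.1) ^ 2 *
    dx 1 v' (α p.1, β p.1 * p.2 + γ p.1) + _ * v' (α p.1, β p.1 * p.2 + γ p.1) *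
    dx 1 v' (α p.1, β p.1 * p.2 + γ p.1) + dx 5 v' (α p.1, β p.1 * p.2 + γ p.1) +
    _ * dx 3 v' (α p.1, β p.1 * p.2 + γ p.1) = 0 at hvH'
  rw [hvt, hv0, hlow 1 (by norm_num), hlow 2 (by norm_num), hlow 3 (by norm_num)] at hvH'
  -- All other terms coincide, hence the fifth derivatives do as well; their difference is, up to a
  -- factor, the mixed derivative of `U` to be annihilated.
  have h5 : dx 5 v' (α p.1, β p.1 * p.2 + γ p.1) = dx 5 v (α p.1, β p.1 * p.2 + γ p.1) := by
    linear_combination hvH' - hvH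
  have e5 := hWx 5 le_rfl
  rw [if_pos rfl, if_neg (by norm_num), ← hWd, ← x1, ← x2, h5, sub_self, add_zero] at e5
  linarith

theorem mk_mk_mem_ball {z : ℝ × ℝ × ℝ} {ε : ℝ} {t x u : ℝ} :
    (t, x, u) ∈ Metric.ball z ε ↔
      t ∈ Metric.ball z.1 ε ∧ x ∈ Metric.ball z.2.1 ε ∧ u ∈ Metric.ball z.2.2 ε := by
  conv_lhs => rw [← Prod.mk.eta (p := z), ← Prod.mk.eta (p := z.2), ← ball_prod_same,
    ← ball_prod_same]
  exact Iff.rfl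

/-- The local form of the transformation of the dependent variable. -/
theorem IsAdmissible.exists_dependent_form {E E' : KdVEq} (hE : E ∈ gaugedClass)
    (hE' : E' ∈ gaugedClass) {Φ : VarMap} (h : IsAdmissible E E' Φ) {z : ℝ × ℝ × ℝ} {ε : ℝ}
    (hball : Metric.ball z ε ⊆ Φ.source) (hε : 0 < ε) :
    ∃ (φ : ℝ → ℝ) (ψ : ℝ × ℝ → ℝ), ContDiffAt ℝ ∞ φ z.1 ∧
      (∀ x ∈ Metric.ball z.2.1 ε, ContDiffAt ℝ ∞ ψ (z.1, x)) ∧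
      (∀ y ∈ Metric.ball z ε, (fderiv ℝ Φ y (0, 0, 1)).2.2 = φ y.1) ∧
      ∀ y ∈ Metric.ball z ε, (Φ y).2.2 = φ y.1 * y.2.2 + ψ (y.1, y.2.1) := by
  have hΦ := h.isPointTransformation
  set V : ℝ × ℝ × ℝ → ℝ := fun y => (Φ y).2.2 with hVdef
  have hV : ∀ y ∈ Φ.source, ContDiffAt ℝ ∞ V y := fun y hy => (hΦ.contDiffAt hy).snd.snd
  let φ : ℝ → ℝ := fun s => fderiv ℝ V (s, z.2) (0, 0, 1)
  let ψ : ℝ × ℝ → ℝ := fun r => V (r.1, r.2, z.2.2) - φ r.1 * z.2.2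
  have hφ : ContDiffAt ℝ ∞ φ z.1 :=
    ContDiffAt.comp z.1 (g := fun y => fderiv ℝ V y (0, 0, 1))
      (contDiffAt_fderiv_apply (hV _ (hball (Metric.mem_ball_self hε))) _) (by fun_prop)
  have hVu : ∀ y ∈ Metric.ball z ε, fderiv ℝ V y (0, 0, 1) = φ y.1 := fun y hy =>
    eq_of_fderiv_eq_zero_of_mem_ball (f := fun y => fderiv ℝ V y (0, 0, 1))
      (fun y hy => (contDiffAt_fderiv_apply (hV _ (hball hy)) _).differentiableAt (by simp))
      (fun y hy => h.fderiv_fderiv_dependent hE hE' (hball hy) 0)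
      -- The cases `b = 0` and `b = 1` separate the `x`- and `u`-derivatives of `U_u`.
      (fun y hy => by
        have h0 := h.fderiv_fderiv_dependent hE hE' (hball hy) 0
        have h1 := h.fderiv_fderiv_dependent hE hE' (hball hy) 1
        rw [apply_mk_eq] at h0 h1
        simp only [zero_smul, one_smul, zero_add, add_zero] at h0 h1
        rw [h0, zero_add] at h1
        exact h1) hy
  refine ⟨φ, ψ, hφ, fun x hx => ?_, fun y hy => ?_, fun y hy => ?_⟩
  · have hm : (z.1, x, z.2.2) ∈ Metric.ball z ε :=
      mk_mk_mem_ball.2 ⟨Metric.mem_ball_self hε, hx, Metric.mem_ball_self hε⟩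
    have h1 : ContDiffAt ℝ ∞ (fun r : ℝ × ℝ => V (r.1, r.2, z.2.2)) (z.1, x) :=
      ContDiffAt.comp (z.1, x) (g := V) (hV _ (hball hm)) (by fun_prop)
    have h2 : ContDiffAt ℝ ∞ (fun r : ℝ × ℝ => φ r.1) (z.1, x) :=
      ContDiffAt.comp (z.1, x) (g := φ) hφ contDiffAt_fst
    exact h1.sub (h2.mul contDiffAt_const)
  · rw [← hΦ.fderiv_snd_snd (hball hy)]
    exact hVu y hy
  · obtain ⟨t, x, u⟩ := y
    obtain ⟨ht, hx, hu⟩ := mk_mk_mem_ball.1 hy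
    have hd : ∀ s ∈ Metric.ball z.2.2 ε, HasDerivAt (fun s => V (t, x, s) - φ t * s) 0 s := by
      intro s hs
      have hm : (t, x, s) ∈ Metric.ball z ε := mk_mk_mem_ball.2 ⟨ht, hx, hs⟩
      have h1 : HasFDerivAt V _ (t, x, s) :=
        ((hV _ (hball hm)).differentiableAt (by simp)).hasFDerivAt
      have h2 := h1.comp_hasDerivAt s ((hasDerivAt_const s t).prodMk
        ((hasDerivAt_const s x).prodMk (hasDerivAt_id s)))
      refine (h2.sub ((hasDerivAt_id s).const_mul (φ t))).congr_deriv ?_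
      rw [hVu _ hm]
      simp
    have := Metric.isOpen_ball.is_const_of_deriv_eq_zero (convex_ball z.2.2 ε).isPreconnected
      (fun s hs => (hd s hs).differentiableAt.differentiableWithinAt)
      (fun s hs => (hd s hs).deriv) hu (Metric.mem_ball_self hε)
    simp only [ψ]
    linarith

/-! ### Determining identity, its splitting, and the differential -/

/-- The determining identity for the jets of solutions. -/
theorem IsAdmissible.jet_identity {E E' : KdVEq} (hE : E ∈ gaugedClass)
    (hE' : E' ∈ gaugedClass) {Φ : VarMap} (h : IsAdmissible E E' Φ) {t x y : ℝ}
    (hz : (t, x, y) ∈ Φ.source) {α β γ φ : ℝ → ℝ} {ψ : ℝ × ℝ → ℝ} (hα : ContDiffAt ℝ ∞ α t)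
    (hβ : ContDiffAt ℝ ∞ β t) (hγ : ContDiffAt ℝ ∞ γ t) (hφ : ContDiffAt ℝ ∞ φ t)
    (hψ : ContDiffAt ℝ ∞ ψ (t, x)) (hα5 : deriv α t = β t ^ 5) (hβ0 : β t ≠ 0)
    (hform : ∀ᶠ w in 𝓝 (t, x, y), (Φ w).1 = α w.1 ∧ (Φ w).2.1 = β w.1 * w.2.1 + γ w.1)
    (hform' : ∀ᶠ w in 𝓝 (t, x, y), (Φ w).2.2 = φ w.1 * w.2.2 + ψ (w.1, w.2.1)) (b₁ b₂ b₃ : ℝ) :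
    deriv φ t * y - φ t * (E.a t * y * b₃ + E.b t * b₁ * b₂ + E.c t * y ^ 2 * b₁
        + E.f t * y * b₁ + E.h t * b₃) + dt ψ (t, x)
      - (deriv β t * x + deriv γ t) * (φ t * b₁ + dx 1 ψ (t, x)) / β t
      + β t ^ 2 * E'.a (α t) * (φ t * y + ψ (t, x)) * (φ t * b₃ + dx 3 ψ (t, x))
      + β t ^ 2 * E'.b (α t) * (φ t * b₁ + dx 1 ψ (t, x)) * (φ t * b₂ + dx 2 ψ (t, x))
      + β t ^ 4 * E'.c (α t) * (φ t * y + ψ (t, x)) ^ 2 * (φ t * b₁ + dx 1 ψ (t, x))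
      + β t ^ 4 * E'.f (α t) * (φ t * y + ψ (t, x)) * (φ t * b₁ + dx 1 ψ (t, x))
      + dx 5 ψ (t, x) + β t ^ 2 * E'.h (α t) * (φ t * b₃ + dx 3 ψ (t, x)) = 0 := by
  set p : ℝ × ℝ := (t, x) with hp
  have hzI : p.1 ∈ E.I := h.source_subset _ hz
  -- `u_t` is solved from the equation with `u_xxxxx = 0`, so `y`, `b₁`, `b₂`, `b₃` remain free.
  let a : ℝ := -(E.a t * y * b₃ + E.b t * b₁ * b₂ + E.c t * y ^ 2 * b₁
        + E.f t * y * b₁ + E.h t * b₃)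
  let cf : ℕ → ℝ := fun j => match j with
    | 0 => y
    | 1 => b₁
    | 2 => b₂ / 2
    | 3 => b₃ / 6
    | _ => 0
  set u := jet p a cf with hudef
  have hu : ContDiffAt ℝ ∞ u p := (contDiff_jet _ _ _).contDiffAt
  have up : u p = y := jet_self _ _ _
  have ut : dt u p = a := dt_jet _ _ _
  have u1 : dx 1 u p = b₁ := by rw [hudef, dx_jet _ _ _ (by norm_num)]; simp [cf]
  have u2 : dx 2 u p = b₂ := by
    rw [hudef, dx_jet _ _ _ (by norm_num)]; simp [cf, Nat.factorial]; ring
  have u3 : dx 3 u p = b₃ := by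
    rw [hudef, dx_jet _ _ _ (by norm_num)]; simp [cf, Nat.factorial]; ring
  have u5 : dx 5 u p = 0 := by rw [hudef, dx_jet _ _ _ (by norm_num)]; simp [cf]
  have hH : E.HoldsAt u p := by
    rw [KdVEq.holdsAt_iff_of_mem hE hzI, up, ut, u1, u2, u3, u5]; simp only [a, hp]; ring
  obtain ⟨v, hv, hvH, hvu⟩ := h.exists_image hE hE' hz hform hu up hH
  have hgt : Filter.Tendsto (graphMap u) (𝓝 p) (𝓝 (t, x, y)) := by
    have := (contDiffAt_graphMap hu).continuousAt.tendsto
    rwa [show graphMap u p = (t, x, y) by rw [graphMap, up]] at this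
  have hvW : ∀ᶠ r : ℝ × ℝ in 𝓝 p, v (α r.1, β r.1 * r.2 + γ r.1) = φ r.1 * u r + ψ r := by
    filter_upwards [hvu, hgt.eventually hform'] with r h1 h2
    exact h1.trans h2
  have hd {F : ℝ → ℝ} (hF : ContDiffAt ℝ ∞ F t) : HasDerivAt F (deriv F t) t :=
    (hF.differentiableAt (by simp)).hasDerivAt
  have hφ2 : ContDiffAt ℝ ∞ (fun r : ℝ × ℝ => φ r.1) p :=
    ContDiffAt.comp p (g := φ) hφ contDiffAt_fst
  have hφu : ContDiffAt ℝ ∞ (fun r : ℝ × ℝ => φ r.1 * u r) p := hφ2.mul hu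
  have t1 := dt_of_eventuallyEq (p := p) hv (hd hα) (hd hβ) (hd hγ) hvW
  have x1 := fun j => dx_of_eventuallyEq (p := p) hvW j
  have hWx (j : ℕ) : dx j (fun r => φ r.1 * u r + ψ r) p = φ t * dx j u p + dx j ψ p := by
    rw [dx_add hφu hψ]
    congr 1
    simp only [dx, hp]
    rw [iteratedDeriv_const_mul_field]
  have hWt : dt (fun r => φ r.1 * u r + ψ r) p = deriv φ t * y + φ t * a + dt ψ p := by
    rw [dt_add hφu hψ]
    congr 1
    have h2 := ((hd hφ).mul (hasDerivAt_dt hu)).deriv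
    rw [ut] at h2
    have h3 : u (t, p.2) = y := up
    rw [h3] at h2
    exact h2
  have h0 : v (α t, β t * x + γ t) = φ t * y + ψ p := by
    have := hvW.self_of_nhds
    rw [up] at this
    exact this
  have hqI : α t ∈ E'.I := by
    have := h.target_subset _ (Φ.map_source hz)
    rwa [hform.self_of_nhds.1] at this
  have e1 := x1 1
  have e2 := x1 2
  have e3 := x1 3
  have e5 := x1 5
  rw [hWx] at e1 e2 e3 e5
  rw [hWt] at t1
  rw [u1] at e1
  rw [u2] at e2
  rw [u3] at e3
  rw [u5] at e5
  simp only [hp] at e1 e2 e3 e5 t1 h0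
  rw [KdVEq.holdsAt_iff_of_mem hE' hqI, h0] at hvH
  simp only at hvH
  simp only [hp]
  rw [hα5] at t1
  generalize dt v (α t, β t * x + γ t) = vt at *
  generalize dx 1 v (α t, β t * x + γ t) = v1 at *
  generalize dx 2 v (α t, β t * x + γ t) = v2 at *
  generalize dx 3 v (α t, β t * x + γ t) = v3 at *
  generalize dx 5 v (α t, β t * x + γ t) = v5 at *
  have e1' : v1 = (φ t * b₁ + dx 1 ψ (t, x)) / β t := by
    rw [eq_div_iff hβ0, ← e1]; ring
  rw [← e2, ← e3, mul_div_assoc, ← e1']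
  rw [← e1]
  have k : dx 5 ψ (t, x) = β t ^ 5 * v5 := by rw [e5]; ring
  rw [k]
  simp only [a] at t1
  -- The image equation times `β⁵ = α_t`, with the time derivative of `v` eliminated.
  linear_combination -t1 + β t ^ 5 * hvH

theorem eq_zero_of_quadratic {P Q R y₀ ε : ℝ} (hε : 0 < ε)
    (h : ∀ y ∈ Metric.ball y₀ ε, P + Q * y + R * y ^ 2 = 0) : P = 0 ∧ Q = 0 ∧ R = 0 := by
  have h0 := h y₀ (Metric.mem_ball_self hε)
  have h1 := h (y₀ + ε / 2) (by
    rw [Metric.mem_ball, Real.dist_eq, add_sub_cancel_left, abs_of_pos (by linarith)]; linarith)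
  have h2 := h (y₀ - ε / 2) (by
    rw [Metric.mem_ball, Real.dist_eq, sub_sub_cancel_left, abs_neg, abs_of_pos (by linarith)]
    linarith)
  have hR : R = 0 := by
    have : R * (ε ^ 2 / 2) = 0 := by linear_combination h1 + h2 - 2 * h0
    exact (mul_eq_zero.1 this).resolve_right (by positivity)
  subst hR
  have hQ : Q = 0 := by
    have : Q * ε = 0 := by linear_combination h1 - h2
    exact (mul_eq_zero.1 this).resolve_right hε.ne'
  subst hQ
  exact ⟨by linarith, rfl, rfl⟩

/-- Splitting of the determining identity with respect to the jet variables. -/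
theorem split_jet_identity {a b c f h A B C F H φ φ' β X ψ ψt ψ1 ψ2 ψ3 ψ5 y₀ ε : ℝ} (hε : 0 < ε)
    (hφ : φ ≠ 0) (hβ : β ≠ 0)
    (hid : ∀ y ∈ Metric.ball y₀ ε, ∀ b₁ b₂ b₃ : ℝ,
      φ' * y - φ * (a * y * b₃ + b * b₁ * b₂ + c * y ^ 2 * b₁ + f * y * b₁ + h * b₃) + ψt
      - X * (φ * b₁ + ψ1) / β + β ^ 2 * A * (φ * y + ψ) * (φ * b₃ + ψ3)
      + β ^ 2 * B * (φ * b₁ + ψ1) * (φ * b₂ + ψ2) + β ^ 4 * C * (φ * y + ψ) ^ 2 * (φ * b₁ + ψ1)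
      + β ^ 4 * F * (φ * y + ψ) * (φ * b₁ + ψ1) + ψ5 + β ^ 2 * H * (φ * b₃ + ψ3) = 0) :
    a = β ^ 2 * A * φ ∧ h = β ^ 2 * (A * ψ + H) ∧ b = β ^ 2 * B * φ ∧ B * ψ1 = 0 ∧
      c = β ^ 4 * C * φ ^ 2 ∧ f = β ^ 4 * (2 * C * φ * ψ + F * φ) ∧
      X = β * (β ^ 2 * B * ψ2 + β ^ 4 * (C * ψ ^ 2 + F * ψ)) ∧
      (ψ1 = 0 → ψ3 = 0 → ψ5 = 0 → φ' = 0 ∧ ψt = 0) := by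
  -- Coefficient of `b₃`, linear in `y`.
  obtain ⟨p1, p2, -⟩ := eq_zero_of_quadratic hε (y₀ := y₀) (R := 0)
    (P := φ * (β ^ 2 * (A * ψ + H) - h)) (Q := φ * (β ^ 2 * A * φ - a)) fun y hy => by
      linear_combination hid y hy 0 0 1 - hid y hy 0 0 0
  have hy := Metric.mem_ball_self (x := y₀) hε
  -- Coefficient of `b₁ b₂` as a mixed second difference; next come those of `b₂` and, as a
  -- quadratic in `y`, of `b₁`.
  have p3 : φ * (β ^ 2 * B * φ - b) = 0 := by
    linear_combination hid _ hy 1 1 0 - hid _ hy 1 0 0 - hid _ hy 0 1 0 + hid _ hy 0 0 0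
  have p4 : β ^ 2 * φ * (B * ψ1) = 0 := by
    linear_combination hid _ hy 0 1 0 - hid _ hy 0 0 0
  obtain ⟨q1, q2, q3⟩ := eq_zero_of_quadratic hε (y₀ := y₀)
    (P := φ * (-X / β + β ^ 2 * B * ψ2 + β ^ 4 * (C * ψ ^ 2 + F * ψ)))
    (Q := φ * (-f + β ^ 4 * (2 * C * φ * ψ + F * φ))) (R := φ * (-c + β ^ 4 * C * φ ^ 2))
    fun y hy => by linear_combination hid y hy 1 0 0 - hid y hy 0 0 0
  have z {s : ℝ} (hs : φ * s = 0) : s = 0 := (mul_eq_zero.1 hs).resolve_left hφ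
  have q1 := z q1
  have hX : X / β = β ^ 2 * B * ψ2 + β ^ 4 * (C * ψ ^ 2 + F * ψ) := by
    linear_combination -q1
  refine ⟨by linarith [z p2], by linarith [z p1], by linarith [z p3],
    (mul_eq_zero.1 p4).resolve_left (mul_ne_zero (pow_ne_zero _ hβ) hφ), by linarith [z q3],
    by linarith [z q2], ?_, ?_⟩
  · rw [← hX, mul_div_cancel₀ _ hβ]
  · rintro rfl rfl rfl
    obtain ⟨r1, r2, -⟩ := eq_zero_of_quadratic hε (y₀ := y₀) (R := 0) (P := ψt) (Q := φ')
      fun y hy => by linear_combination hid y hy 0 0 0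
    exact ⟨r2, r1⟩

theorem dx_eq_zero_of_eventually_const {ψ : ℝ × ℝ → ℝ} {t x c : ℝ}
    (h : ∀ᶠ y in 𝓝 x, ψ (t, y) = c) {j : ℕ} (hj : j ≠ 0) : dx j ψ (t, x) = 0 := by
  have h1 : (fun y => ψ (t, y)) =ᶠ[𝓝 x] fun _ => c := h
  have h2 := h1.iteratedDeriv_eq j
  simp only [dx]
  rw [h2, iteratedDeriv_const, if_neg hj]

theorem clm_eq_zero {F : Type*} [NormedAddCommGroup F] [NormedSpace ℝ F]
    {L : (ℝ × ℝ × ℝ) →L[ℝ] F} (h1 : L (1, 0, 0) = 0) (h2 : L (0, 1, 0) = 0)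
    (h3 : L (0, 0, 1) = 0) : L = 0 := by
  refine ContinuousLinearMap.ext fun d => ?_
  obtain ⟨a, b, c⟩ := d
  rw [apply_mk_eq, h1, h2, h3]
  simp

theorem fderiv_eq_zero_of_eventuallyEq_fst {f : ℝ × ℝ × ℝ → ℝ} {F : ℝ → ℝ} {z : ℝ × ℝ × ℝ}
    (h : ∀ᶠ y in 𝓝 z, f y = F y.1) (hF : HasDerivAt F 0 z.1) : fderiv ℝ f z = 0 := by
  have h1 : HasFDerivAt (fun y : ℝ × ℝ × ℝ => F y.1) _ z :=
    hF.comp_hasFDerivAt z (ContinuousLinearMap.fst ℝ ℝ (ℝ × ℝ)).hasFDerivAt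
  have h2 : f =ᶠ[𝓝 z] fun y => F y.1 := h
  rw [h2.fderiv_eq, h1.fderiv, zero_smul]

/-- The differential of an admissible transformation between equations of the gauged subclass and
the relations between their coefficients. -/
theorem IsAdmissible.differential {E E' : KdVEq} (hE : E ∈ gaugedClass)
    (hE' : E' ∈ gaugedClass) {Φ : VarMap} (h : IsAdmissible E E' Φ) {z : ℝ × ℝ × ℝ}
    (hz : z ∈ Φ.source) :
    ∃ β φ σ : ℝ, β ≠ 0 ∧ φ ≠ 0 ∧ (Φ z).2.2 = φ * (z.2.2 + σ) ∧
      fderiv ℝ Φ z (1, 0, 0) = (β ^ 5, σ * β * E.f z.1 - σ ^ 2 * β * E.c z.1, 0) ∧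
      fderiv ℝ Φ z (0, 1, 0) = (0, β, 0) ∧ fderiv ℝ Φ z (0, 0, 1) = (0, 0, φ) ∧
      fderiv ℝ (fun y => (fderiv ℝ Φ y (0, 1, 0)).2.1) z = 0 ∧
      fderiv ℝ (fun y => (fderiv ℝ Φ y (0, 0, 1)).2.2) z = 0 ∧
      E'.a (Φ z).1 = E.a z.1 / (β ^ 2 * φ) ∧ E'.b (Φ z).1 = E.b z.1 / (β ^ 2 * φ) ∧
      E'.c (Φ z).1 = E.c z.1 / (β ^ 4 * φ ^ 2) ∧
      E'.f (Φ z).1 = (E.f z.1 - 2 * σ * E.c z.1) / (β ^ 4 * φ) ∧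
      E'.h (Φ z).1 = (E.h z.1 - σ * E.a z.1) / β ^ 2 := by
  have hΦ := h.isPointTransformation
  obtain ⟨ε, hε, hball⟩ := Metric.isOpen_iff.1 Φ.open_source z hz
  obtain ⟨α, β, γ, hα, hβ, hγ, hα5, hβ0, hX, hform⟩ := h.exists_local_form hE hE' hball hε
  obtain ⟨φ, ψ, hφ, hψ, hU, hform'⟩ := h.exists_dependent_form hE hE' hball hε
  have hzb := Metric.mem_ball_self (x := z) hε
  have hφ0 : φ z.1 ≠ 0 := by
    rw [← hU z hzb]; exact (h.fderiv_components_ne_zero hE hE' hz).2.2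
  obtain ⟨t, x₀, u₀⟩ := z
  simp only at hα hβ hγ hα5 hβ0 hφ hψ hφ0
  have hx₀ : x₀ ∈ Metric.ball x₀ ε := Metric.mem_ball_self hε
  have hsplit (x : ℝ) (hx : x ∈ Metric.ball x₀ ε) := split_jet_identity (y₀ := u₀) hε hφ0 hβ0
    fun y hy b₁ b₂ b₃ => by
      have hm : (t, x, y) ∈ Metric.ball (t, x₀, u₀) ε :=
        mk_mk_mem_ball.2 ⟨Metric.mem_ball_self hε, hx, hy⟩
      have hn := Metric.isOpen_ball.mem_nhds hm
      exact h.jet_identity hE hE' (hball hm) hα hβ hγ hφ (hψ x hx) hα5 hβ0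
        (by filter_upwards [hn] with w hw using hform w hw)
        (by filter_upwards [hn] with w hw using hform' w hw) b₁ b₂ b₃
  -- The role of nondegeneracy: `E'.a ≠ 0` makes `ψ` recoverable from the relation for `h`, `E'.c ≠
  -- 0` from that for `f`. If both vanish, `E'.b ≠ 0`, as otherwise `a = b = c = 0` for `E`, and
  -- then `B ψ_x = 0` applies.
  have hconst : ∀ x ∈ Metric.ball x₀ ε, ψ (t, x) = ψ (t, x₀) := by
    obtain ⟨a0, h0, b0, -, c0, f0, -, -⟩ := hsplit x₀ hx₀
    by_cases hA : E'.a (α t) = 0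
    · by_cases hC : E'.c (α t) = 0
      · have hB : E'.b (α t) ≠ 0 := by
          intro hB
          refine E.nondegenerate t (h.source_subset _ hz) ?_
          rw [a0, b0, c0, hA, hB, hC]; ring
        have hψd : ∀ x ∈ Metric.ball x₀ ε, HasDerivAt (fun y => ψ (t, y)) 0 x := by
          intro x hx
          obtain ⟨-, -, -, h1, -⟩ := hsplit x hx
          have h2 := (mul_eq_zero.1 h1).resolve_left hB
          rw [dx, iteratedDeriv_one] at h2
          have h3 : ContDiffAt ℝ ∞ (fun y => ψ (t, y)) x :=
            ContDiffAt.comp x (g := ψ) (hψ x hx) (by fun_prop)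
          have h4 := (h3.differentiableAt (by simp)).hasDerivAt
          exact h4.congr_deriv h2
        intro x hx
        exact Metric.isOpen_ball.is_const_of_deriv_eq_zero (convex_ball x₀ ε).isPreconnected
          (fun s hs => (hψd s hs).differentiableAt.differentiableWithinAt)
          (fun s hs => (hψd s hs).deriv) hx hx₀
      · intro x hx
        obtain ⟨-, -, -, -, -, f1, -⟩ := hsplit x hx
        have : 2 * β t ^ 4 * E'.c (α t) * φ t * (ψ (t, x) - ψ (t, x₀)) = 0 := by
          linear_combination f0 - f1
        have hne : 2 * β t ^ 4 * E'.c (α t) * φ t ≠ 0 := by positivity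
        exact sub_eq_zero.1 ((mul_eq_zero.1 this).resolve_left hne)
    · intro x hx
      obtain ⟨-, h1, -⟩ := hsplit x hx
      have : β t ^ 2 * E'.a (α t) * (ψ (t, x) - ψ (t, x₀)) = 0 := by
        linear_combination h0 - h1
      have hne : β t ^ 2 * E'.a (α t) ≠ 0 := by positivity
      exact sub_eq_zero.1 ((mul_eq_zero.1 this).resolve_left hne)
  have hψx (x : ℝ) (hx : x ∈ Metric.ball x₀ ε) {j : ℕ} (hj : j ≠ 0) : dx j ψ (t, x) = 0 :=
    dx_eq_zero_of_eventually_const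
      (by filter_upwards [Metric.isOpen_ball.mem_nhds hx] with y hy using hconst y hy) hj
  -- The right-hand side is free of `x`, so comparing coefficients in `x` gives `β_t = 0` and the
  -- value of `γ_t`.
  have hXeq : ∀ x ∈ Metric.ball x₀ ε, deriv β t * x + deriv γ t
      = β t ^ 5 * (E'.c (α t) * ψ (t, x₀) ^ 2 + E'.f (α t) * ψ (t, x₀)) := by
    intro x hx
    obtain ⟨-, -, -, -, -, -, h1, -⟩ := hsplit x hx
    rw [hψx x hx two_ne_zero, hconst x hx] at h1
    rw [h1]; ring
  obtain ⟨hγ', hβ', -⟩ := eq_zero_of_quadratic (R := 0) hε fun x hx => by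
    have := hXeq x hx
    show (deriv γ t - β t ^ 5 * (E'.c (α t) * ψ (t, x₀) ^ 2 + E'.f (α t) * ψ (t, x₀)))
      + deriv β t * x + 0 * x ^ 2 = 0
    linear_combination this
  obtain ⟨a0, h0, b0, -, c0, f0, -, himp⟩ := hsplit x₀ hx₀
  obtain ⟨hφ', hψt⟩ := himp (hψx x₀ hx₀ one_ne_zero) (hψx x₀ hx₀ three_ne_zero)
    (hψx x₀ hx₀ (by norm_num))
  have hd {F : ℝ → ℝ} (hF : ContDiffAt ℝ ∞ F t) : HasDerivAt F (deriv F t) t :=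
    (hF.differentiableAt (by simp)).hasDerivAt
  have hc : Filter.Tendsto (fun s : ℝ => (s, x₀, u₀)) (𝓝 t) (𝓝 (t, x₀, u₀)) :=
    (by fun_prop : ContinuousAt (fun s : ℝ => (s, x₀, u₀)) t).tendsto
  have hnear : ∀ᶠ y in 𝓝 (t, x₀, u₀), y ∈ Metric.ball (t, x₀, u₀) ε :=
    Metric.ball_mem_nhds _ hε
  have hcurve : HasDerivAt (fun s => Φ (s, x₀, u₀)) (fderiv ℝ Φ (t, x₀, u₀) (1, 0, 0)) t :=
    (hΦ.hasFDerivAt hz).comp_hasDerivAt t ((hasDerivAt_id t).prodMk (hasDerivAt_const t (x₀, u₀)))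
  have hXt : (fderiv ℝ Φ (t, x₀, u₀) (1, 0, 0)).2.1 = deriv γ t := by
    have h1 : HasDerivAt (fun s => (Φ (s, x₀, u₀)).2.1) _ t :=
      hasFDerivAt_fst.comp_hasDerivAt t (hasFDerivAt_snd.comp_hasDerivAt t hcurve)
    have h2 := ((hd hβ).mul_const x₀).add (hd hγ)
    rw [hβ', zero_mul, zero_add] at h2
    refine h1.unique (h2.congr_of_eventuallyEq ?_)
    filter_upwards [hc.eventually hnear] with s hs using (hform _ hs).2
  have hUt : (fderiv ℝ Φ (t, x₀, u₀) (1, 0, 0)).2.2 = 0 := by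
    have h1 : HasDerivAt (fun s => (Φ (s, x₀, u₀)).2.2) _ t :=
      hasFDerivAt_snd.comp_hasDerivAt t (hasFDerivAt_snd.comp_hasDerivAt t hcurve)
    have h2 := ((hd hφ).mul_const u₀).add (hasDerivAt_dt (hψ x₀ hx₀))
    rw [hφ', hψt, zero_mul, zero_add] at h2
    refine h1.unique (h2.congr_of_eventuallyEq ?_)
    filter_upwards [hc.eventually hnear] with s hs using hform' _ hs
  obtain ⟨hTx, hTu⟩ := h.fderiv_time hE hE' hz
  obtain ⟨hXu, hX5⟩ := h.fderiv_space hE hE' hz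
  have hUx : (fderiv ℝ Φ (t, x₀, u₀) (0, 1, 0)).2.2 = 0 := by
    have h1 : HasDerivAt (fun s => Φ (t, s, u₀)) (fderiv ℝ Φ (t, x₀, u₀) (0, 1, 0)) x₀ :=
      (hΦ.hasFDerivAt hz).comp_hasDerivAt x₀ ((hasDerivAt_const x₀ t).prodMk
        ((hasDerivAt_id x₀).prodMk (hasDerivAt_const x₀ u₀)))
    have h2 : HasDerivAt (fun s => (Φ (t, s, u₀)).2.2) _ x₀ :=
      hasFDerivAt_snd.comp_hasDerivAt x₀ (hasFDerivAt_snd.comp_hasDerivAt x₀ h1)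
    refine h2.unique ((hasDerivAt_const x₀ (φ t * u₀ + ψ (t, x₀))).congr_of_eventuallyEq ?_)
    filter_upwards [Metric.ball_mem_nhds x₀ hε] with s hs
    rw [hform' (t, s, u₀) (mk_mk_mem_ball.2 ⟨Metric.mem_ball_self hε, hs, Metric.mem_ball_self hε⟩)]
    simp only [hconst s hs]
  have hXx := hX _ hzb
  have hUu := hU _ hzb
  simp only at hXx hUu
  -- `φ u + ψ = φ (u + σ)` with `σ = ψ / φ`.
  refine ⟨β t, φ t, ψ (t, x₀) / φ t, hβ0, hφ0, ?_, Prod.ext ?_ (Prod.ext ?_ hUt),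
    Prod.ext hTx (Prod.ext hXx hUx), Prod.ext hTu (Prod.ext hXu hUu), ?_, ?_, ?_⟩
  · rw [(hform' _ hzb)]
    simp only
    field_simp
  · rw [← hX5, hXx]
  · simp only
    rw [hXt, sub_eq_zero.1 hγ', f0, c0]
    field_simp
    ring
  · exact fderiv_eq_zero_of_eventuallyEq_fst (F := β) (hnear.mono fun y hy => hX y hy)
      ((hd hβ).congr_deriv hβ')
  · exact fderiv_eq_zero_of_eventuallyEq_fst (F := φ) (hnear.mono fun y hy => hU y hy)
      ((hd hφ).congr_deriv hφ')
  · rw [(hform _ hzb).1]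
    simp only [a0, b0, c0, f0, h0]
    refine ⟨?_, ?_, ?_, ?_, ?_⟩ <;> field_simp <;> ring

/-! ### From pointwise relations to global constants -/

/-- Admissible transformations between equations of the gauged subclass. -/
theorem IsAdmissible.exists_consts {E E' : gaugedClass} {Φ : VarMap}
    (h : IsAdmissible E.1 E'.1 Φ) :
    ∃ (k : GaugedConsts) (γ : ℝ → ℝ),
      (∀ t ∈ E.1.I, HasDerivAt γ (k.σ * k.β * E.1.f t - k.σ ^ 2 * k.β * E.1.c t) t) ∧
      ∀ z ∈ Φ.source,
        Φ z = (k.time z.1, k.β * z.2.1 + γ z.1, k.φ * (z.2.2 + k.σ)) ∧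
        E'.1.a (k.time z.1) = E.1.a z.1 / (k.β ^ 2 * k.φ) ∧
        E'.1.b (k.time z.1) = E.1.b z.1 / (k.β ^ 2 * k.φ) ∧
        E'.1.c (k.time z.1) = E.1.c z.1 / (k.β ^ 4 * k.φ ^ 2) ∧
        E'.1.f (k.time z.1) = (E.1.f z.1 - 2 * k.σ * E.1.c z.1) / (k.β ^ 4 * k.φ) ∧
        E'.1.h (k.time z.1) = (E.1.h z.1 - k.σ * E.1.a z.1) / k.β ^ 2 := by
  have hΦ := h.isPointTransformation
  choose! B F S hB0 hF0 hval hDt hDx hDu hB' hF' hcoef using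
    fun z (hz : z ∈ Φ.source) => h.differential E.2 E'.2 hz
  obtain ⟨z₁, hz₁⟩ := hΦ.connected.nonempty
  -- The domain is connected but its slices at fixed `t` need not be, so every global claim is
  -- stated as constancy of a function with zero differential on the whole domain.
  have hconst {f : ℝ × ℝ × ℝ → ℝ} (hd : ∀ z ∈ Φ.source, DifferentiableAt ℝ f z)
      (h0 : ∀ z ∈ Φ.source, fderiv ℝ f z = 0) : ∀ z ∈ Φ.source, f z = f z₁ := fun z hz =>
    Φ.open_source.is_const_of_fderiv_eq_zero (𝕜 := ℝ) hΦ.connected.isPreconnected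
      (fun z hz => (hd z hz).differentiableWithinAt) (fun z hz => h0 z hz) hz hz₁
  have hsm (d : ℝ × ℝ × ℝ) : ∀ z ∈ Φ.source, ContDiffAt ℝ ∞ (fun y => fderiv ℝ Φ y d) z :=
    fun z hz => contDiffAt_fderiv_apply (hΦ.contDiffAt hz) d
  have hB : ∀ z ∈ Φ.source, B z = B z₁ := fun z hz => by
    have := hconst (fun z hz => (hsm (0, 1, 0) z hz).snd.fst.differentiableAt (by simp)) hB' z hz
    rwa [hDx z hz, hDx z₁ hz₁] at this
  have hF : ∀ z ∈ Φ.source, F z = F z₁ := fun z hz => by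
    have := hconst (fun z hz => (hsm (0, 0, 1) z hz).snd.snd.differentiableAt (by simp)) hF' z hz
    rwa [hDu z hz, hDu z₁ hz₁] at this
  have hf1 (z : ℝ × ℝ × ℝ) : HasFDerivAt (fun y : ℝ × ℝ × ℝ => y.1)
      (ContinuousLinearMap.fst ℝ ℝ (ℝ × ℝ)) z := hasFDerivAt_fst
  have hf2 (z : ℝ × ℝ × ℝ) : HasFDerivAt (fun y : ℝ × ℝ × ℝ => y.2.1)
      ((ContinuousLinearMap.fst ℝ ℝ ℝ).comp (ContinuousLinearMap.snd ℝ ℝ (ℝ × ℝ))) z :=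
    hasFDerivAt_snd.fst
  have hf3 (z : ℝ × ℝ × ℝ) : HasFDerivAt (fun y : ℝ × ℝ × ℝ => y.2.2) valProj z :=
    hasFDerivAt_snd.snd
  have hzero {f : ℝ × ℝ × ℝ → ℝ} {L : ℝ × ℝ × ℝ → (ℝ × ℝ × ℝ) →L[ℝ] ℝ}
      (hd : ∀ z ∈ Φ.source, HasFDerivAt f (L z) z)
      (h1 : ∀ z ∈ Φ.source, L z (1, 0, 0) = 0) (h2 : ∀ z ∈ Φ.source, L z (0, 1, 0) = 0)
      (h3 : ∀ z ∈ Φ.source, L z (0, 0, 1) = 0) : ∀ z ∈ Φ.source, f z = f z₁ :=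
    hconst (fun z hz => (hd z hz).differentiableAt) fun z hz =>
      (hd z hz).fderiv.trans (clm_eq_zero (h1 z hz) (h2 z hz) (h3 z hz))
  have hT := hzero (f := fun z => (Φ z).1 - B z₁ ^ 5 * z.1)
    (fun z hz => (hΦ.hasFDerivAt hz).fst.sub ((hf1 z).const_mul _))
    (fun z hz => by simp [hDt z hz, hB z hz]) (fun z hz => by simp [hDx z hz])
    (fun z hz => by simp [hDu z hz])
  have hU := hzero (f := fun z => (Φ z).2.2 - F z₁ * z.2.2)
    (fun z hz => (hΦ.hasFDerivAt hz).snd.snd.sub ((hf3 z).const_mul _))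
    (fun z hz => by simp [hDt z hz]) (fun z hz => by simp [hDx z hz])
    (fun z hz => by simp [hDu z hz, hF z hz])
  have hS : ∀ z ∈ Φ.source, S z = S z₁ := fun z hz => by
    have h1 := hU z hz
    simp only [hval z hz, hval z₁ hz₁, hF z hz] at h1
    exact mul_left_cancel₀ (hF0 z₁ hz₁) (by linear_combination h1)
  -- The antiderivative lives on the whole interval of `E`, even if the domain lies over only a
  -- part; subtracting it and `β x` from `X` leaves a constant.
  obtain ⟨γ, hγ⟩ := exists_gauged_antiderivative E (S z₁) (B z₁)
  have hX := hzero (f := fun z => (Φ z).2.1 - B z₁ * z.2.1 - γ z.1)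
    (fun z hz => ((hΦ.hasFDerivAt hz).snd.fst.sub ((hf2 z).const_mul _)).sub
      ((hγ z.1 (h.source_subset z hz)).comp_hasFDerivAt z (hf1 z)))
    (fun z hz => by simp [hDt z hz, hB z hz, hS z hz]) (fun z hz => by simp [hDx z hz, hB z hz])
    (fun z hz => by simp [hDu z hz])
  let k : GaugedConsts := ⟨B z₁, F z₁, S z₁, (Φ z₁).1 - B z₁ ^ 5 * z₁.1, hB0 z₁ hz₁, hF0 z₁ hz₁⟩
  have hk : ∀ z ∈ Φ.source, (Φ z).1 = k.time z.1 := fun z hz => by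
    have := hT z hz
    simp only [GaugedConsts.time, k] at this ⊢
    linarith
  refine ⟨k, fun t => γ t + ((Φ z₁).2.1 - B z₁ * z₁.2.1 - γ z₁.1),
    fun t ht => (hγ t ht).add_const _, fun z hz => ⟨Prod.ext (hk z hz) (Prod.ext ?_ ?_), ?_⟩⟩
  · have := hX z hz
    simp only [k] at this ⊢
    linarith
  · rw [hval z hz, hF z hz, hS z hz]
  · rw [← hk z hz]
    have := hcoef z hz
    rwa [hB z hz, hF z hz, hS z hz] at this

/-! ### Normalization and the final statement -/

theorem isNormalizedWrt_gaugedGroup : IsNormalizedWrt gaugedClass gaugedGroup := by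
  classical
  intro E E' Φ h
  obtain ⟨k, γ, hγ, hΦ⟩ := h.exists_consts
  choose γ' hγ' using fun F : gaugedClass => exists_gauged_antiderivative F k.σ k.β
  -- An element of the group needs `γ` for every equation: the given transformation dictates it for
  -- `E`, and any antiderivative serves elsewhere.
  obtain ⟨T, hT, hTk⟩ := exists_mem_gaugedGroup k (Function.update γ' E γ) fun F t ht => by
    by_cases hF : F = E
    · subst hF
      rw [Function.update_self]
      exact hγ t ht
    · rw [Function.update_of_ne hF]
      exact hγ' F t ht
  obtain ⟨hrel, hvar⟩ := hTk E
  refine ⟨T, hT, fun z hz => ?_, ?_⟩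
  · rw [hvar z (by rw [T.source_eq]; exact h.source_subset z hz), Function.update_self]
    exact (hΦ z hz).1
  · rintro _ ⟨w, hw, rfl⟩
    obtain ⟨z, hz, rfl⟩ : ∃ z ∈ Φ.source, Φ z = w :=
      ⟨_, Φ.map_target hw, Φ.right_inv hw⟩
    obtain ⟨hform, ha, hb, hc, hf, hh⟩ := hΦ z hz
    have hzI := h.source_subset z hz
    obtain ⟨g1, m1, n1, k1⟩ := E'.2 _ (h.target_subset _ hw)
    have hI : k.time z.1 ∈ (T.onEq E).1.I := by
      rw [hrel.1]; exact Set.mem_image_of_mem _ hzI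
    obtain ⟨g2, m2, n2, k2⟩ := (T.onEq E).2 _ hI
    obtain ⟨ra, rb, rc, rf, rh⟩ := hrel.2 z.1 hzI
    rw [hform] at g1 m1 n1 k1 ⊢
    simp only at g1 m1 n1 k1 ⊢
    rw [g1, m1, n1, k1, g2, m2, n2, k2, ha, hb, hc, hf, hh, ra, rb, rc, rf, rh]
    simp

/-- An equivalence transformation restricted to one equation is an admissible transformation, so
normalization applies. -/
theorem EquivTransformation.exists_mem_gaugedGroup_eq (T : EquivTransformation gaugedClass)
    (E : gaugedClass) : ∃ S ∈ gaugedGroup,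
      S.onEq E = T.onEq E ∧ Set.EqOn (S.onVar E) (T.onVar E) (T.onVar E).source := by
  obtain ⟨S, hS, hv, hc⟩ := isNormalizedWrt_gaugedGroup E (T.onEq E) (T.onVar E) (T.admissible E)
  rw [fst_image_target] at hc
  refine ⟨S, hS, ?_, hv.symm⟩
  -- Both maps of variables are defined over the full interval of `E` and agree there, so their
  -- ranges, hence the image intervals, coincide.
  have hI : (T.onEq E).1.I = (S.onEq E).1.I := by
    rw [← fst_image_target, ← fst_image_target, ← (T.onVar E).image_source_eq_target,
      ← (S.onVar E).image_source_eq_target, hv.image_eq, T.source_eq, S.source_eq]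
  exact Subtype.ext (KdVEq.eq_of_agreeOn hI hc).symm

theorem corollary3 :
    -- reduction of every equation of the class to the subclass, for any choice of antiderivatives
    (∀ (E : KdVEq) (K M τ ν : ℝ → ℝ),
      (∀ t ∈ E.I, HasDerivAt K (E.k t) t) →
      (∀ t ∈ E.I, HasDerivAt M (E.m t) t) →
      (∀ t ∈ E.I, HasDerivAt τ (E.g t * Real.exp (-5 * K t)) t) →
      (∀ t ∈ E.I, HasDerivAt ν (E.n t * Real.exp (-K t)) t) →
      ∃ (E' : KdVEq) (Φ : VarMap), E' ∈ gaugedClass ∧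
        Φ.source = {z | z.1 ∈ E.I} ∧ Φ.target = {z | z.1 ∈ E'.I} ∧
        (∀ z ∈ Φ.source,
          Φ z = (τ z.1, Real.exp (-K z.1) * z.2.1 - ν z.1, Real.exp (M z.1) * z.2.2)) ∧
        IsAdmissible E E' Φ) ∧
    -- all parameter values give equivalence transformations of the subclass
    (∀ P : GaugedParams, ∃ T : EquivTransformation gaugedClass, T.IsGivenBy P) ∧
    -- these transformations form a group: identity, composition, inverse
    (∃ T ∈ gaugedGroup, T.onEq = Equiv.refl _ ∧
      ∀ E, Set.EqOn (T.onVar E) id (T.onVar E).source) ∧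
    (∀ S ∈ gaugedGroup, ∀ T ∈ gaugedGroup, ∃ R ∈ gaugedGroup, S.IsComp T R) ∧
    (∀ T ∈ gaugedGroup, ∃ R ∈ gaugedGroup, R.onEq = T.onEq.symm ∧
      ∀ E, Set.EqOn (R.onVar (T.onEq E)) (T.onVar E).symm (T.onVar E).target) ∧
    -- every equivalence transformation of the subclass has this form on each equation
    (∀ (T : EquivTransformation gaugedClass) (E : gaugedClass), ∃ S ∈ gaugedGroup,
      S.onEq E = T.onEq E ∧ Set.EqOn (S.onVar E) (T.onVar E) (T.onVar E).source) ∧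
    -- the subclass is normalized with respect to this group
    IsNormalizedWrt gaugedClass gaugedGroup := by
  exact ⟨fun E K M τ ν hK hM hτ hν => exists_gauging_transformation E hK hM hτ hν,
    fun P => P.exists_isGivenBy, exists_identity_mem_gaugedGroup,
    fun S hS T hT => exists_comp_mem_gaugedGroup hS hT,
    fun T hT => exists_inverse_mem_gaugedGroup hT,
    fun T E => T.exists_mem_gaugedGroup_eq E, isNormalizedWrt_gaugedGroup⟩
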